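/- **Setting.** Let $g_\phi=\mathrm{diag}(e^{i\phi/2},e^{-i\phi/2})$ and $a_\theta=\begin{pmatrix}\cos\frac\theta2&-\sin\frac\theta2\\ \sin\frac\theta2&\cos\frac\theta2\end{pmatrix}$ in $SU(2)$, and $U(1)=\{g_\phi\}$. Let $D^j_{mn}$ be the Wigner functions on $SU(2)$, normalised so that $D^j_{mn}(g_\phi a_\theta g_\psi)=e^{-im\phi}d^j_{mn}(\theta)e^{-in\psi}$, with $d^j_{mn}$ the standard (real) Wigner $d$-functions, and let $C^{jm}_{j_1m_1j_2m_2}$ be the $SU(2)$ Clebsch–Gordan coefficients in the Condon–Shortley convention. Fix $r_1,r_2\in(0,2\pi)$ and $n_1,n_2\in\frac12\mathbb Z$. For $\theta\in[0,\pi]$ put $$\lambda(\theta)=2\arccos\!\big(\cos\tfrac{r_1}2\cos\tfrac{r_2}2-\cos\theta\sin\tfrac{r_1}2\sin\tfrac{r_2}2\big),$$ a bijection of $[0,\pi]$ onto $I=[\,|r_1-r_2|,\min(r_1+r_2,4\pi-r_1-r_2)\,]$, and let $d\nu(r_3)=\dfrac{\sin\frac{r_3}2}{4\sin\frac{r_1}2\sin\frac{r_2}2}\,dr_3$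 on $I$. A pair of maps $y,w:[0,\pi]\to SU(2)$ is called admissible if, for every $\theta\in[0,\pi]$, $y(\theta)\in U(1)a_\theta U(1)$ and $g_{r_1}y(\theta)g_{r_2}y(\theta)^{-1}=w(\theta)g_{\lambda(\theta)}w(\theta)^{-1}$. (No regularity in $\theta$ is required; continuous $y$ and Borel $w$ are a special case.) For such a pair define, with $r_3=\lambda(\theta)$, $$\langle (r_1,n_1)j_1m_1,(r_2,n_2)j_2m_2|(r_3,n_3)jm\rangle:=\sum_{p} C^{jm}_{j_1m_1j_2m_2}\,C^{j(n_1+p)}_{j_1n_1j_2p}\,D^{j_2}_{pn_2}(y(\theta))\,\overline{D^j_{(n_1+p)n_3}(w(\theta))},$$ where $p\in j_2+\mathbb Z$ runs from $\max(-j-n_1,-j_2)$ to $\min(j-n_1,j_2)$; $C$ and $D$ are zero when their labels are out of range. The explicit choice is $y(\theta)=a_\theta$ and $w(\theta)=g_{\phi_w}a_{\theta_w}$, where for $0<\theta<\pi$ the angles $0\le\theta_w\le\pi$, $\phi_w$ are the spherical coordinates of $$\begin{pmatrix}\cos\theta_w\\ \sin\theta_w\cos\phi_w\\ \sin\theta_w\sin\phi_w\end{pmatrix}=\frac1{\sin\frac{r_3}2}\begin{pmatrix}\sin\frac{r_1}2\cos\frac{r_2}2+\cos\theta\cos\frac{r_1}2\sin\frac{r_2}2\\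 \sin\theta\cos\frac{r_1}2\sin\frac{r_2}2\\ \sin\theta\sin\frac{r_1}2\sin\frac{r_2}2\end{pmatrix}$$ (with suitable values at the end points $\theta=0,\pi$, which do not affect the integrals below). **Theorem.** (1) The explicit choice is admissible. (2) For the explicit choice, let $j_1,j_1'\ge|n_1|$ and $j_2,j_2'\ge|n_2|$ with $j_1,j_1'\in n_1+\mathbb Z$, $j_2,j_2'\in n_2+\mathbb Z$, and let $m,m_1,m_1'$ be such that $m_1$, $m-m_1$, $m_1'$, $m-m_1'$ are weights of the spin $j_1,j_2,j_1',j_2'$ representations respectively. Then the integrands below are integrable, the sum over $n_3$ converges, and $$\sum_{n_3\in n_1+n_2+\mathbb Z}\ {\sum_j}'\frac1{2j+1}\int_I\langle (r_1,n_1)j_1m_1,(r_2,n_2)j_2(m-m_1)|(r_3,n_3)jm\rangle\,\overline{\langle (r_1,n_1)j_1'm_1',(r_2,n_2)j_2'(m-m_1')|(r_3,n_3)jm\rangle}\,d\nu(r_3)=\frac{\delta_{j_1j_1'}\delta_{j_2j_2'}\delta_{m_1m_1'}}{(2j_1+1)(2j_2+1)},$$ where the primed sum is over the $j$ satisfying the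 triangle conditions (including $j\in j_1+j_2+\mathbb Z$) for $(j_1,j_2)$ and for $(j_1',j_2')$ and having $m$ and $n_3$ as weights. (3) If $(y,w)$ is admissible and $\phi,\psi,\zeta$ are arbitrary real functions of $\theta$, then $(g_\phi y\,g_\psi,\ g_\phi w\,g_\zeta)$ is admissible, and its coefficients are those of $(y,w)$ multiplied by the phase factor $e^{i(n_1\phi-n_2\psi+n_3\zeta)}$, evaluated at $\theta=\lambda^{-1}(r_3)$. Conversely, for every admissible $(y,w)$ there are real functions $\phi,\psi,\zeta$ with $y=g_\phi a_\theta g_\psi$ and $w=g_\phi w_{\mathrm{explicit}}\,g_\zeta$ for all $0<\theta<\pi$. (4) The orthogonality relations of (2) hold, unchanged, for every admissible choice $(y,w)$. -/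

import Mathlib

/-! Half-integers are stored doubled: the spins `j ∈ ½ℕ` are given by `J = 2j : ℕ`, and the weights
`m, n ∈ ½ℤ` by `M = 2m : ℤ`, `N = 2n : ℤ`. Capital letters always denote doubled labels. -/

noncomputable section

namespace DoubleSU2

open Matrix MeasureTheory

/-- The group `SU(2)`. -/
abbrev SU2 : Type := Matrix.specialUnitaryGroup (Fin 2) ℂ

/-! ### Euler-angle matrices -/

/-- The matrix `diag(exp(iφ/2), exp(-iφ/2))`. -/
def diagMatrix (φ : ℝ) : Matrix (Fin 2) (Fin 2) ℂ :=
  !![Complex.exp (Complex.I * (φ / 2)), 0; 0, Complex.exp (-(Complex.I * (φ / 2)))]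

/-- The matrix with rows `(cos θ/2, -sin θ/2)` and `(sin θ/2, cos θ/2)`. -/
def rotMatrix (θ : ℝ) : Matrix (Fin 2) (Fin 2) ℂ :=
  !![(Real.cos (θ / 2) : ℂ), -(Real.sin (θ / 2) : ℂ);
     (Real.sin (θ / 2) : ℂ), (Real.cos (θ / 2) : ℂ)]

lemma diagMatrix_mem (φ : ℝ) : diagMatrix φ ∈ Matrix.specialUnitaryGroup (Fin 2) ℂ := by
  rw [Matrix.mem_specialUnitaryGroup_iff, Matrix.mem_unitaryGroup_iff]
  have h1 : Complex.exp (Complex.I * (φ / 2)) * Complex.exp (-(Complex.I * (φ / 2))) = 1 := by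
    rw [← Complex.exp_add]; simp
  have h0 : (starRingEnd ℂ) (Complex.I * (φ / 2)) = -(Complex.I * (φ / 2)) := by
    rw [map_mul, Complex.conj_I, map_div₀, Complex.conj_ofReal, Complex.conj_ofNat, neg_mul]
  have h2 : (starRingEnd ℂ) (Complex.exp (Complex.I * (φ / 2)))
      = Complex.exp (-(Complex.I * (φ / 2))) := by
    rw [← Complex.exp_conj, h0]
  have h3 : (starRingEnd ℂ) (Complex.exp (-(Complex.I * (φ / 2))))
      = Complex.exp (Complex.I * (φ / 2)) := by
    rw [← Complex.exp_conj, map_neg, h0, neg_neg]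
  constructor
  · ext i k
    fin_cases i <;> fin_cases k <;>
      simp [diagMatrix, Matrix.mul_apply, Matrix.star_apply, h2, h3, h1, mul_comm]
  · simp [diagMatrix, Matrix.det_fin_two, h1]

lemma rotMatrix_mem (θ : ℝ) : rotMatrix θ ∈ Matrix.specialUnitaryGroup (Fin 2) ℂ := by
  rw [Matrix.mem_specialUnitaryGroup_iff, Matrix.mem_unitaryGroup_iff]
  have h : (Real.sin (θ / 2) : ℂ) * Real.sin (θ / 2) + Real.cos (θ / 2) * Real.cos (θ / 2) = 1 := by
    have := Real.sin_sq_add_cos_sq (θ / 2)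
    rw [sq, sq] at this
    exact_mod_cast this
  have hs : (starRingEnd ℂ) (Real.sin (θ / 2) : ℂ) = Real.sin (θ / 2) := Complex.conj_ofReal _
  have hc : (starRingEnd ℂ) (Real.cos (θ / 2) : ℂ) = Real.cos (θ / 2) := Complex.conj_ofReal _
  rw [rotMatrix]
  generalize (Real.sin (θ / 2) : ℂ) = s at *
  generalize (Real.cos (θ / 2) : ℂ) = c at *
  constructor
  · ext i k
    fin_cases i <;> fin_cases k <;>
      simp [Matrix.mul_apply, Matrix.star_apply, hs, hc] <;> first | ring1 | linear_combination h
  · rw [Matrix.det_fin_two_of]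
    linear_combination h

/-- The diagonal element `g_φ ∈ SU(2)`; the `g_φ` form the subgroup `U(1)`, and `g_r`, for
`0 ≤ r ≤ 2π`, is the chosen representative of the conjugacy class `C_r`. -/
def gDiag (φ : ℝ) : SU2 := ⟨diagMatrix φ, diagMatrix_mem φ⟩

/-- The element `a_θ ∈ SU(2)`. -/
def aRot (θ : ℝ) : SU2 := ⟨rotMatrix θ, rotMatrix_mem θ⟩

/-! ### Wigner functions and Clebsch–Gordan coefficients of `SU(2)` -/

/-- `m ∈ {-j, -j+1, …, j}`, for `J = 2j`, `M = 2m`. -/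
def IsWeight (J : ℕ) (M : ℤ) : Prop := |M| ≤ (J : ℤ) ∧ Even ((J : ℤ) - M)

open Classical in
/-- The Wigner function `D^j_{mn}`, with `J = 2j`, `M = 2m`, `N = 2n`: the `(m, n)` matrix element
of the `(2j+1)`-dimensional irreducible representation of `SU(2)`, with
`D^j_{mn}(g_φ a_θ g_ψ) = e^{-imφ} d^j_{mn}(θ) e^{-inψ}`. For `j = 1/2` it is the matrix
`U = conj g` in the basis `m = 1/2, -1/2`; for general `j` it is the `2j`-th symmetric power of `U`,
acting on homogeneous polynomials by `x ↦ U₀₀ x + U₁₀ y`, `y ↦ U₀₁ x + U₁₁ y`, written in the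
orthonormal basis `x^{j+m} y^{j-m} / √((j+m)! (j-m)!)`; in the code `y` is set to `1`.
It is zero by convention if `m` or `n` is not a weight of the spin `j` representation. -/
def wignerD (J : ℕ) (M N : ℤ) (u : SU2) : ℂ :=
  if IsWeight J M ∧ IsWeight J N then
    (Real.sqrt
      (((((J + M) / 2).toNat.factorial : ℝ) * (((J - M) / 2).toNat.factorial : ℝ)) /
        ((((J + N) / 2).toNat.factorial : ℝ) * (((J - N) / 2).toNat.factorial : ℝ))) : ℂ) *
    (((Polynomial.C (star (u.1 0 0)) * Polynomial.X + Polynomial.C (star (u.1 1 0))) ^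
          ((J + N) / 2).toNat *
        (Polynomial.C (star (u.1 0 1)) * Polynomial.X + Polynomial.C (star (u.1 1 1))) ^
          ((J - N) / 2).toNat).coeff ((J + M) / 2).toNat)
  else 0

/-- `1 / k!`, which is zero for negative integers `k`. -/
def invFact (k : ℤ) : ℝ := if 0 ≤ k then 1 / (k.toNat.factorial : ℝ) else 0

/-- `j` satisfies the triangle condition for `(j₁, j₂)`: `|j₁ - j₂| ≤ j ≤ j₁ + j₂` and
`j₁ + j₂ - j ∈ ℤ`. -/
def Triangle (J₁ J₂ J : ℕ) : Prop :=
  |(J₁ : ℤ) - J₂| ≤ J ∧ J ≤ J₁ + J₂ ∧ Even ((J₁ : ℤ) + J₂ - J)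

open Classical in
/-- The Clebsch–Gordan coefficient `C^{j m}_{j₁ m₁ j₂ m₂}` of `SU(2)` (Condon–Shortley phase
convention), by Van der Waerden's formula
`δ_{m, m₁+m₂} √((2j+1) (j₁+j₂-j)! (j₁-j₂+j)! (j₂-j₁+j)! / (j₁+j₂+j+1)!)`
`√((j₁+m₁)! (j₁-m₁)! (j₂+m₂)! (j₂-m₂)! (j+m)! (j-m)!)`
`∑_z (-1)^z / (z! (j₁+j₂-j-z)! (j₁-m₁-z)! (j₂+m₂-z)! (j-j₂+m₁+z)! (j-j₁-m₂+z)!)`.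
It is zero outside the range of admissible labels. -/
def clebschGordan (J₁ : ℕ) (M₁ : ℤ) (J₂ : ℕ) (M₂ : ℤ) (J : ℕ) (M : ℤ) : ℝ :=
  if IsWeight J₁ M₁ ∧ IsWeight J₂ M₂ ∧ IsWeight J M ∧ Triangle J₁ J₂ J ∧ M = M₁ + M₂ then
    Real.sqrt (((J : ℝ) + 1) *
        ((((J₁ + J₂ - J : ℤ) / 2).toNat.factorial : ℝ) *
          (((J₁ - J₂ + J : ℤ) / 2).toNat.factorial : ℝ) *
          (((J₂ - J₁ + J : ℤ) / 2).toNat.factorial : ℝ) /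
          (((J₁ + J₂ + J : ℤ) / 2 + 1).toNat.factorial : ℝ))) *
      Real.sqrt
        ((((J₁ + M₁) / 2).toNat.factorial : ℝ) * (((J₁ - M₁) / 2).toNat.factorial : ℝ) *
          (((J₂ + M₂) / 2).toNat.factorial : ℝ) * (((J₂ - M₂) / 2).toNat.factorial : ℝ) *
          (((J + M) / 2).toNat.factorial : ℝ) * (((J - M) / 2).toNat.factorial : ℝ)) *
      ∑ z ∈ Finset.range (((J₁ + J₂ - J : ℤ) / 2).toNat + 1),
        (-1 : ℝ) ^ z * invFact z * invFact ((J₁ + J₂ - J : ℤ) / 2 - z) *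
          invFact ((J₁ - M₁) / 2 - z) * invFact ((J₂ + M₂) / 2 - z) *
          invFact ((J - J₂ + M₁) / 2 + z) * invFact ((J - J₁ - M₂) / 2 + z)
  else 0

/-! ### Conjugacy class `r₃`, double coset label `θ`, and the measure `ν` -/

/-- `λ_{r₁,r₂}(θ)`: the class label `r₃` of the double coset `U(1) a_θ U(1)`. -/
def lam (r₁ r₂ θ : ℝ) : ℝ :=
  2 * Real.arccos (Real.cos (r₁ / 2) * Real.cos (r₂ / 2) -
    Real.cos θ * Real.sin (r₁ / 2) * Real.sin (r₂ / 2))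

/-- The inverse `λ_{r₁,r₂}⁻¹` of `λ_{r₁,r₂}` on `[0, π]`. -/
def lamInv (r₁ r₂ r₃ : ℝ) : ℝ := Function.invFunOn (lam r₁ r₂) (Set.Icc 0 Real.pi) r₃

/-- The interval `I_{r₁,r₂} = [|r₁ - r₂|, min (r₁ + r₂, 4π - (r₁ + r₂))]`. -/
def classInterval (r₁ r₂ : ℝ) : Set ℝ := Set.Icc |r₁ - r₂| (min (r₁ + r₂) (4 * Real.pi - (r₁ + r₂)))

/-- The measure `dν(r₃) = sin(r₃/2) / (4 sin(r₁/2) sin(r₂/2)) dr₃` on `I_{r₁,r₂}`, zero outside. -/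
def nu (r₁ r₂ : ℝ) : Measure ℝ :=
  (volume : Measure ℝ).withDensity ((classInterval r₁ r₂).indicator fun r₃ =>
    ENNReal.ofReal (Real.sin (r₃ / 2) / (4 * Real.sin (r₁ / 2) * Real.sin (r₂ / 2))))

/-! ### Choices of `y` and `w` -/

/-- The pair `θ ↦ y(θ)`, `θ ↦ w(θ)` is an admissible choice: `y(θ)` represents the double coset
`U(1) a_θ U(1)`, and `g_{r₁} y(θ) g_{r₂} y(θ)⁻¹ = w(θ) g_{r₃} w(θ)⁻¹` with `r₃ = λ_{r₁,r₂}(θ)`.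
No continuity or measurability in `θ` is asked for. -/
def IsAdmissible (r₁ r₂ : ℝ) (y w : ℝ → SU2) : Prop :=
  ∀ θ ∈ Set.Icc 0 Real.pi,
    (∃ φ ψ : ℝ, y θ = gDiag φ * aRot θ * gDiag ψ) ∧
    gDiag r₁ * y θ * gDiag r₂ * (y θ)⁻¹ = w θ * gDiag (lam r₁ r₂ θ) * (w θ)⁻¹

/-- The unit vector `n̂_w(θ) = (cos θ_w, sin θ_w cos φ_w, sin θ_w sin φ_w)`, for `0 < θ < π`. -/
def nHat (r₁ r₂ θ : ℝ) : Fin 3 → ℝ :=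
  (1 / Real.sin (lam r₁ r₂ θ / 2)) •
    ![Real.sin (r₁ / 2) * Real.cos (r₂ / 2) + Real.cos θ * Real.cos (r₁ / 2) * Real.sin (r₂ / 2),
      Real.sin θ * Real.cos (r₁ / 2) * Real.sin (r₂ / 2),
      Real.sin θ * Real.sin (r₁ / 2) * Real.sin (r₂ / 2)]

/-- The explicit choice `w(θ) = g_{φ_w} a_{θ_w}`, with `(θ_w, φ_w)` the spherical coordinates
of `n̂_w(θ)`. -/
def wExplicit (r₁ r₂ θ : ℝ) : SU2 :=
  gDiag (Complex.arg ⟨nHat r₁ r₂ θ 1, nHat r₁ r₂ θ 2⟩) * aRot (Real.arccos (nHat r₁ r₂ θ 0))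

/-! ### Clebsch–Gordan coefficients of the quantum double of `SU(2)` -/

/-- `∑'_p C^{j m}_{j₁ m₁ j₂ m₂} C^{j (n₁+p)}_{j₁ n₁ j₂ p} D^{j₂}_{p n₂}(y) conj(D^j_{(n₁+p) n₃}(w))`,
where `p` runs from `max(-j-n₁, -j₂)` to `min(j-n₁, j₂)` in integer steps (with `p - j₂ ∈ ℤ`). -/
def cgValue (N₁ : ℤ) (J₁ : ℕ) (M₁ N₂ : ℤ) (J₂ : ℕ) (M₂ N₃ : ℤ) (J : ℕ) (M : ℤ) (y w : SU2) : ℂ :=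
  ∑ P ∈ (Finset.Icc (max (-(J : ℤ) - N₁) (-(J₂ : ℤ))) (min ((J : ℤ) - N₁) (J₂ : ℤ))).filter
      (fun P => Even ((J₂ : ℤ) - P)),
    (clebschGordan J₁ M₁ J₂ M₂ J M : ℂ) * (clebschGordan J₁ N₁ J₂ P J (N₁ + P) : ℂ) *
      wignerD J₂ P N₂ y * star (wignerD J (N₁ + P) N₃ w)

/-- The Clebsch–Gordan coefficient `⟨(r₁,n₁) j₁ m₁, (r₂,n₂) j₂ m₂ | (r₃,n₃) j m⟩` of `D(SU(2))`
built with the choices `y` and `w`, where `r₃ = λ_{r₁,r₂}(θ)`. -/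
def doubleCG (y w : ℝ → SU2) (r₁ : ℝ) (N₁ : ℤ) (J₁ : ℕ) (M₁ : ℤ) (r₂ : ℝ) (N₂ : ℤ) (J₂ : ℕ) (M₂ : ℤ)
    (r₃ : ℝ) (N₃ : ℤ) (J : ℕ) (M : ℤ) : ℂ :=
  cgValue N₁ J₁ M₁ N₂ J₂ M₂ N₃ J M (y (lamInv r₁ r₂ r₃)) (w (lamInv r₁ r₂ r₃))

open Classical in
/-- The range of the primed sum over `j`: the `j` that are allowed by both `(j₁, j₂)` and
`(j₁', j₂')` and that have both `m` and `n₃` as weights. -/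
def jRange (J₁ J₂ J₁' J₂' : ℕ) (M N₃ : ℤ) : Finset ℕ :=
  (Finset.range (J₁ + J₂ + 1)).filter fun J =>
    Triangle J₁ J₂ J ∧ Triangle J₁' J₂' J ∧ IsWeight J M ∧ IsWeight J N₃

/-- The orthogonality relations for the coefficients built with the choices `y` and `w`. The index
`n₃` runs over `n₁ + n₂ + ℤ`, i.e. `N₃ = N₁ + N₂ + 2k` with `k ∈ ℤ`. The labels are such that
`D^{j₁}_{m₁ n₁}`, `D^{j₂}_{(m-m₁) n₂}`, `D^{j₁'}_{m₁' n₁}` and `D^{j₂'}_{(m-m₁') n₂}` exist. -/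
def OrthogonalityRelations (r₁ r₂ : ℝ) (N₁ N₂ : ℤ) (y w : ℝ → SU2) : Prop :=
  ∀ (J₁ J₂ J₁' J₂' : ℕ) (M M₁ M₁' : ℤ),
    IsWeight J₁ N₁ → IsWeight J₂ N₂ → IsWeight J₁' N₁ → IsWeight J₂' N₂ →
    IsWeight J₁ M₁ → IsWeight J₂ (M - M₁) → IsWeight J₁' M₁' → IsWeight J₂' (M - M₁') →
    (∀ (J : ℕ) (N₃ : ℤ), IntegrableOn (fun r₃ =>
        doubleCG y w r₁ N₁ J₁ M₁ r₂ N₂ J₂ (M - M₁) r₃ N₃ J M *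
          star (doubleCG y w r₁ N₁ J₁' M₁' r₂ N₂ J₂' (M - M₁') r₃ N₃ J M))
        (classInterval r₁ r₂) (nu r₁ r₂)) ∧
    HasSum (fun k : ℤ =>
        ∑ J ∈ jRange J₁ J₂ J₁' J₂' M (N₁ + N₂ + 2 * k),
          (1 / ((J : ℂ) + 1)) *
            ∫ r₃ in classInterval r₁ r₂,
              doubleCG y w r₁ N₁ J₁ M₁ r₂ N₂ J₂ (M - M₁) r₃ (N₁ + N₂ + 2 * k) J M *
                star (doubleCG y w r₁ N₁ J₁' M₁' r₂ N₂ J₂' (M - M₁') r₃ (N₁ + N₂ + 2 * k) J M)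
              ∂(nu r₁ r₂))
      (if J₁ = J₁' ∧ J₂ = J₂' ∧ M₁ = M₁' then 1 / (((J₁ : ℂ) + 1) * ((J₂ : ℂ) + 1)) else 0)

end DoubleSU2

end

open DoubleSU2

/-!
The products of coefficients in the orthogonality relations are computed for fixed `j`.

* Summing over `n₃` eliminates `w`, because the rows of the matrix of Wigner functions are
  orthonormal (`sum_wignerD_mul_star`). This leaves a single sum over `p` of products
  `D^{j₂}_{p n₂}(y) conj(D^{j₂'}_{p n₂}(y))`, in which the phases of `y` cancel.
* The substitution `r₃ = λ(θ)` turns `ν` into `½ sin θ dθ` (`setIntegral_nu`), and the `d`-functions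
  with equal weights are orthogonal for this measure (`integral_wignerD_aRot`).
* The remaining sum over `p` is an orthogonality relation of Clebsch–Gordan coefficients after the
  roles of `j₁` and `j` are exchanged (`sum_clebschGordan_mul_exchange`), and the final sum over `j`
  is the completeness relation (`sum_coupledSpins_clebschGordan_mul`).

The orthogonality of the `d`-functions and that of the Clebsch–Gordan coefficients have the same
source. In both cases raising and lowering operators are adjoint to each other, which gives two
relations between neighbouring inner products. For different spins they force the inner products to
vanish (`eq_zero_of_two_ladders`); for equal spins they reduce the norm to an extreme weight, where
it is a beta integral, respectively a convolution of binomial coefficients. For the Clebsch–Gordan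
coefficients the action of these operators is an identity between Van der Waerden's sums, proved by
telescoping (`vdwSum_raise`). Completeness follows from orthonormality because the matrix of
coefficients is square.

The explicit choice is admissible by a computation of the first rows of both sides
(`wExplicit_conj`). Two solutions `w` for the same `y` differ by an element of the centraliser of
`g_{r₃}`, which is `U(1)` as `sin (r₃ / 2) ≠ 0` for `0 < θ < π` (`IsAdmissible.exists_change`).
A change of the choices multiplies all coefficients with the same `n₁, n₂, n₃` by the same phase,
so the integrands for an arbitrary admissible choice agree with those for the explicit choice on
`0 < θ < π`; in particular they are integrable, although `y` and `w` need not be measurable.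
-/

noncomputable section

namespace DoubleSU2

open MeasureTheory

section Poly

open Polynomial

/-! ### Weights -/

lemma isWeight_iff {J : ℕ} {M : ℤ} : IsWeight J M ↔ ∃ k ≤ J, M = 2 * (k : ℤ) - J := by
  unfold IsWeight
  constructor
  · rintro ⟨h1, t, ht⟩
    rw [abs_le] at h1
    exact ⟨(J - t).toNat, by omega, by omega⟩
  · rintro ⟨k, hk, rfl⟩
    refine ⟨by rw [abs_le]; omega, (J : ℤ) - k, by omega⟩

/-- The (doubled) weights of the spin `J / 2` representation. -/
def weights (J : ℕ) : Finset ℤ := (Finset.range (J + 1)).image fun k : ℕ => 2 * (k : ℤ) - J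

lemma mem_weights {J : ℕ} {M : ℤ} : M ∈ weights J ↔ IsWeight J M := by
  rw [isWeight_iff, weights, Finset.mem_image]
  exact ⟨fun ⟨k, hk, h⟩ => ⟨k, by simpa [Nat.lt_succ_iff] using hk, h.symm⟩,
    fun ⟨k, hk, h⟩ => ⟨k, by simpa [Nat.lt_succ_iff] using hk, h.symm⟩⟩

lemma sum_weights {R : Type*} [AddCommMonoid R] (J : ℕ) (f : ℤ → R) :
    ∑ M ∈ weights J, f M = ∑ k ∈ Finset.range (J + 1), f (2 * (k : ℤ) - J) := by
  rw [weights, Finset.sum_image]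
  intro a _ b _ h
  simp only at h
  omega

lemma isWeight_neg {J : ℕ} {M : ℤ} : IsWeight J (-M) ↔ IsWeight J M := by
  have : Even ((J : ℤ) - -M) ↔ Even ((J : ℤ) - M) := by
    rw [sub_neg_eq_add, Int.even_add, Int.even_sub]
  rw [IsWeight, IsWeight, abs_neg, this]

/-! ### Matrix entries in `SU(2)` -/

lemma su2_mul_apply (u v : SU2) (i l : Fin 2) :
    (u * v).1 i l = u.1 i 0 * v.1 0 l + u.1 i 1 * v.1 1 l := by
  change (u.1 * v.1) i l = _
  rw [Matrix.mul_apply, Fin.sum_univ_two]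

@[simp] lemma gDiag_zero_zero (φ : ℝ) : (gDiag φ).1 0 0 = Complex.exp (Complex.I * (φ / 2)) := rfl

@[simp] lemma gDiag_zero_one (φ : ℝ) : (gDiag φ).1 0 1 = 0 := rfl

@[simp] lemma gDiag_one_zero (φ : ℝ) : (gDiag φ).1 1 0 = 0 := rfl

@[simp] lemma gDiag_one_one (φ : ℝ) : (gDiag φ).1 1 1 = Complex.exp (-(Complex.I * (φ / 2))) := rfl

@[simp] lemma aRot_zero_zero (θ : ℝ) : (aRot θ).1 0 0 = (Real.cos (θ / 2) : ℂ) := rfl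

@[simp] lemma aRot_zero_one (θ : ℝ) : (aRot θ).1 0 1 = -(Real.sin (θ / 2) : ℂ) := rfl

@[simp] lemma aRot_one_zero (θ : ℝ) : (aRot θ).1 1 0 = (Real.sin (θ / 2) : ℂ) := rfl

@[simp] lemma aRot_one_one (θ : ℝ) : (aRot θ).1 1 1 = (Real.cos (θ / 2) : ℂ) := rfl

lemma star_exp_I_mul (x : ℝ) : star (Complex.exp (Complex.I * (x / 2))) =
    Complex.exp (-(Complex.I * (x / 2))) := by
  change (starRingEnd ℂ) _ = _
  rw [← Complex.exp_conj, map_mul, Complex.conj_I, map_div₀, Complex.conj_ofReal,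
    Complex.conj_ofNat, neg_mul]

/-! ### Wigner functions -/

lemma coeff_linear_pow {R : Type*} [CommRing R] (x y : R) (n k : ℕ) :
    ((C x * X + C y) ^ n).coeff k = x ^ k * y ^ (n - k) * n.choose k := by
  rw [add_pow, finsetSum_coeff]
  have : ∀ i ∈ Finset.range (n + 1),
      ((C x * X) ^ i * C y ^ (n - i) * (n.choose i : R[X])).coeff k =
        if k = i then x ^ i * y ^ (n - i) * n.choose i else 0 := by
    intro i _
    rw [mul_pow, ← C_pow, ← C_pow, ← C_eq_natCast, mul_assoc, ← C_mul, mul_right_comm, ← C_mul,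
      coeff_C_mul_X_pow]
    simp [mul_assoc]
  rw [Finset.sum_congr rfl this, Finset.sum_ite_eq]
  split_ifs with hk
  · rfl
  · rw [Nat.choose_eq_zero_of_lt (by simpa [Nat.lt_succ_iff] using hk)]
    simp

/-- The image of the monomial `x ^ a * y ^ b` under the substitution defining the Wigner functions,
dehomogenised by `y = 1`. -/
def wignerPoly (u : SU2) (a b : ℕ) : ℂ[X] :=
  (C (star (u.1 0 0)) * X + C (star (u.1 1 0))) ^ a *
    (C (star (u.1 0 1)) * X + C (star (u.1 1 1))) ^ b

lemma wignerD_weight (J k a : ℕ) (hk : k ≤ J) (ha : a ≤ J) (u : SU2) :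
    wignerD J (2 * (k : ℤ) - J) (2 * (a : ℤ) - J) u =
      (Real.sqrt ((k.factorial * (J - k).factorial : ℝ) / (a.factorial * (J - a).factorial)) : ℂ) *
        (wignerPoly u a (J - a)).coeff k := by
  rw [wignerD, if_pos ⟨isWeight_iff.2 ⟨k, hk, rfl⟩, isWeight_iff.2 ⟨a, ha, rfl⟩⟩]
  have e1 : (((J : ℤ) + (2 * (k : ℤ) - J)) / 2).toNat = k := by omega
  have e2 : (((J : ℤ) - (2 * (k : ℤ) - J)) / 2).toNat = J - k := by omega
  have e3 : (((J : ℤ) + (2 * (a : ℤ) - J)) / 2).toNat = a := by omega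
  have e4 : (((J : ℤ) - (2 * (a : ℤ) - J)) / 2).toNat = J - a := by omega
  rw [e1, e2, e3, e4, wignerPoly]

lemma wignerD_of_not (J : ℕ) (M N : ℤ) (u : SU2) (h : ¬ (IsWeight J M ∧ IsWeight J N)) :
    wignerD J M N u = 0 := by
  rw [wignerD, if_neg h]

lemma su2_rows (u : SU2) (i l : Fin 2) :
    u.1 i 0 * star (u.1 l 0) + u.1 i 1 * star (u.1 l 1) = if i = l then 1 else 0 := by
  have h := (Matrix.mem_unitaryGroup_iff.1 (Matrix.mem_specialUnitaryGroup_iff.1 u.2).1)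
  have h2 := congrFun (congrFun h i) l
  rw [Matrix.mul_apply, Fin.sum_univ_two, Matrix.star_apply, Matrix.star_apply,
    Matrix.one_apply] at h2
  exact h2

/-- The generating function of the binomially weighted products of coefficients is
`((α x + β) (ᾱ y + β̄) + (γ x + δ) (γ̄ y + δ̄)) ^ J`, and this is `(x y + 1) ^ J` by unitarity. -/
lemma sum_choose_wignerPoly (u : SU2) (J k l : ℕ) :
    ∑ a ∈ Finset.range (J + 1), (J.choose a : ℂ) *
      (star ((wignerPoly u a (J - a)).coeff k) * (wignerPoly u a (J - a)).coeff l) =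
      if k = l then (J.choose k : ℂ) else 0 := by
  set α := star (u.1 0 0)
  set β := star (u.1 1 0)
  set γ := star (u.1 0 1)
  set δ := star (u.1 1 1)
  have h00 : star α * α + star γ * γ = 1 := by
    simpa [α, γ] using su2_rows u 0 0
  have h11 : star β * β + star δ * δ = 1 := by
    simpa [β, δ] using su2_rows u 1 1
  have h01 : star α * β + star γ * δ = 0 := by
    simpa [α, β, γ, δ] using su2_rows u 0 1
  have h10 : star β * α + star δ * γ = 0 := by
    simpa [α, β, γ, δ] using su2_rows u 1 0
  -- the polynomials in `x` are constants of `ℂ[x][y]`, those in `y` have constant coefficients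
  let p : ℂ[X][X] := C (C (star α) * X + C (star β))
  let q : ℂ[X][X] := C (C (star γ) * X + C (star δ))
  let p' : ℂ[X][X] := (C α * X + C β).map C
  let q' : ℂ[X][X] := (C γ * X + C δ).map C
  have key : p * p' + q * q' = C X * X + C 1 := by
    have e : p * p' + q * q' = C (C (star α * α + star γ * γ)) * C X * X
        + C (C (star α * β + star γ * δ)) * C X + C (C (star β * α + star δ * γ)) * X
        + C (C (star β * β + star δ * δ)) := by
      simp only [p, q, p', q', Polynomial.map_add, Polynomial.map_mul, Polynomial.map_C,
        Polynomial.map_X, C_add, C_mul]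
      ring
    rw [e, h00, h11, h01, h10]
    simp
  have hstar : ∀ a, star ((wignerPoly u a (J - a)).coeff k) =
      ((C (star α) * X + C (star β)) ^ a * (C (star γ) * X + C (star δ)) ^ (J - a)).coeff k := by
    intro a
    have := Polynomial.coeff_map (p := wignerPoly u a (J - a)) (starRingEnd ℂ) k
    rw [starRingEnd_apply] at this
    rw [← this, wignerPoly]
    simp [α, β, γ, δ]
  have h1 := congrArg (fun P : ℂ[X][X] => (P.coeff l).coeff k) (congrArg (· ^ J) key)
  rw [coeff_linear_pow, add_pow, finsetSum_coeff, finsetSum_coeff] at h1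
  rw [one_pow, mul_one, ← C_eq_natCast, coeff_mul_C, coeff_X_pow] at h1
  have h2 : (if k = l then (J.choose k : ℂ) else 0) = (if k = l then 1 else 0) * (J.choose l : ℂ) := by
    split_ifs with h
    · rw [h, one_mul]
    · rw [zero_mul]
  rw [h2]
  refine Eq.trans (Finset.sum_congr rfl fun a _ => ?_) h1
  have e : (p * p') ^ a * (q * q') ^ (J - a) * ((J.choose a : ℕ) : ℂ[X][X]) =
      C (C (J.choose a : ℂ) *
        ((C (star α) * X + C (star β)) ^ a * (C (star γ) * X + C (star δ)) ^ (J - a))) *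
      (wignerPoly u a (J - a)).map C := by
    simp only [wignerPoly, p, q, p', q', Polynomial.map_mul, Polynomial.map_pow, C_mul, C_pow,
      mul_pow, map_natCast]
    ring
  rw [e, coeff_C_mul, coeff_map, coeff_mul_C, coeff_C_mul, hstar]
  ring

/-- The rows of the matrix of Wigner functions are orthonormal. -/
lemma sum_wignerD_mul_star (J : ℕ) (M M' : ℤ) (hM : IsWeight J M) (hM' : IsWeight J M') (u : SU2) :
    ∑ N ∈ weights J, star (wignerD J M N u) * wignerD J M' N u = if M = M' then 1 else 0 := by
  obtain ⟨k, hk, rfl⟩ := isWeight_iff.1 hM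
  obtain ⟨l, hl, rfl⟩ := isWeight_iff.1 hM'
  rw [sum_weights]
  have hf : ∀ n : ℕ, (n.factorial : ℝ) ≠ 0 := fun n => by positivity
  have hch : ∀ a ≤ J, (J.choose a : ℝ) = J.factorial / (a.factorial * (J - a).factorial) :=
    fun a ha => Nat.cast_choose ℝ ha
  have hterm : ∀ a ∈ Finset.range (J + 1),
      star (wignerD J (2 * (k : ℤ) - J) (2 * (a : ℤ) - J) u) *
        wignerD J (2 * (l : ℤ) - J) (2 * (a : ℤ) - J) u =
      (Real.sqrt (k.factorial * (J - k).factorial) * Real.sqrt (l.factorial * (J - l).factorial) /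
        J.factorial : ℝ) * ((J.choose a : ℂ) *
      (star ((wignerPoly u a (J - a)).coeff k) * (wignerPoly u a (J - a)).coeff l)) := by
    intro a ha
    have ha : a ≤ J := by simpa [Nat.lt_succ_iff] using ha
    rw [wignerD_weight J k a hk ha, wignerD_weight J l a hl ha, star_mul']
    have hreal : Real.sqrt ((k.factorial * (J - k).factorial : ℝ) / (a.factorial * (J - a).factorial)) *
        Real.sqrt ((l.factorial * (J - l).factorial : ℝ) / (a.factorial * (J - a).factorial)) =
        (Real.sqrt (k.factorial * (J - k).factorial) * Real.sqrt (l.factorial * (J - l).factorial) /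
        J.factorial) * J.choose a := by
      have hs := Real.mul_self_sqrt (show (0 : ℝ) ≤ a.factorial * (J - a).factorial by positivity)
      rw [Real.sqrt_div (by positivity), Real.sqrt_div (by positivity), hch a ha, div_mul_div_comm,
        hs]
      have := hf J
      field_simp
    have hreal' := congrArg (fun x : ℝ => (x : ℂ)) hreal
    simp only [Complex.ofReal_mul, Complex.ofReal_natCast] at hreal'
    have hst : star ((Real.sqrt ((k.factorial * (J - k).factorial : ℝ) /
        (a.factorial * (J - a).factorial)) : ℝ) : ℂ) = _ := Complex.conj_ofReal _
    rw [hst, mul_mul_mul_comm, hreal']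
    ring
  rw [Finset.sum_congr rfl hterm, ← Finset.mul_sum, sum_choose_wignerPoly]
  by_cases h : k = l
  · subst h
    have : (Real.sqrt (k.factorial * (J - k).factorial) * Real.sqrt (k.factorial * (J - k).factorial) /
        J.factorial : ℝ) * J.choose k = 1 := by
      rw [Real.mul_self_sqrt (by positivity), hch k hk]
      have := hf J; have := hf k; have := hf (J - k)
      field_simp
    rw [if_pos rfl, if_pos rfl]
    exact_mod_cast this
  · rw [if_neg h, if_neg (by omega), mul_zero]

lemma norm_wignerD_le_one (J : ℕ) (M N : ℤ) (u : SU2) : ‖wignerD J M N u‖ ≤ 1 := by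
  by_cases h : IsWeight J M ∧ IsWeight J N
  · have h1 := sum_wignerD_mul_star J M M h.1 h.1 u
    have h2 : ∑ N ∈ weights J, ‖wignerD J M N u‖ ^ 2 = 1 := by
      rw [if_pos rfl] at h1
      have : ∀ z : ℂ, star z * z = ((‖z‖ ^ 2 : ℝ) : ℂ) := fun z => by
        rw [mul_comm]; exact_mod_cast Complex.mul_conj' z
      simp only [this] at h1
      exact_mod_cast h1
    have h3 := Finset.single_le_sum (f := fun N => ‖wignerD J M N u‖ ^ 2) (fun _ _ => by positivity)
      (mem_weights.2 h.2)
    rw [h2] at h3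
    exact (sq_le_one_iff₀ (norm_nonneg _)).1 h3
  · rw [wignerD_of_not J M N u h, norm_zero]; exact zero_le_one

lemma measurable_coeff_mul {α : Type*} [MeasurableSpace α] {P Q : α → ℂ[X]}
    (hP : ∀ n, Measurable fun x => (P x).coeff n) (hQ : ∀ n, Measurable fun x => (Q x).coeff n)
    (n : ℕ) : Measurable fun x => (P x * Q x).coeff n := by
  simp only [coeff_mul]
  exact Finset.measurable_sum _ fun i _ => (hP _).mul (hQ _)

lemma measurable_wignerD {α : Type*} [MeasurableSpace α] {u : α → SU2}
    (hu : ∀ i l, Measurable fun x => (u x).1 i l) (J : ℕ) (M N : ℤ) :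
    Measurable fun x => wignerD J M N (u x) := by
  have hs : ∀ i l, Measurable fun x => star ((u x).1 i l) := fun i l =>
    (continuous_star.measurable).comp (hu i l)
  unfold wignerD
  split_ifs
  · refine Measurable.const_mul (measurable_coeff_mul (fun n => ?_) (fun n => ?_) _) _
    · simp only [coeff_linear_pow]
      exact (((hs _ _).pow_const _).mul ((hs _ _).pow_const _)).mul_const _
    · simp only [coeff_linear_pow]
      exact (((hs _ _).pow_const _).mul ((hs _ _).pow_const _)).mul_const _
  · exact measurable_const

/-- Multiplication by diagonal elements changes a Wigner function by a phase factor. -/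
lemma wignerD_gDiag_mul_gDiag (J : ℕ) (M N : ℤ) (φ ψ : ℝ) (u : SU2) :
    wignerD J M N (gDiag φ * u * gDiag ψ) =
      Complex.exp (-(Complex.I * ((M / 2 : ℂ) * φ + (N / 2 : ℂ) * ψ))) * wignerD J M N u := by
  by_cases h : IsWeight J M ∧ IsWeight J N
  · obtain ⟨⟨k, hk, rfl⟩, ⟨a, ha, rfl⟩⟩ := And.imp isWeight_iff.1 isWeight_iff.1 h
    rw [wignerD_weight J k a hk ha, wignerD_weight J k a hk ha, mul_left_comm]
    congr 1
    set e := Complex.exp (Complex.I * (φ / 2)) with he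
    set e' := Complex.exp (-(Complex.I * (φ / 2))) with he'
    set f := Complex.exp (Complex.I * (ψ / 2)) with hf
    set f' := Complex.exp (-(Complex.I * (ψ / 2))) with hf'
    have hee : e * e' = 1 := by rw [he, he', ← Complex.exp_add]; simp
    have cI : ∀ x : ℝ, star (Complex.exp (Complex.I * (x / 2))) =
        Complex.exp (-(Complex.I * (x / 2))) := star_exp_I_mul
    have cI' : ∀ x : ℝ, star (Complex.exp (-(Complex.I * (x / 2)))) =
        Complex.exp (Complex.I * (x / 2)) := fun x => by rw [← cI, star_star]
    have h00 : star ((gDiag φ * u * gDiag ψ).1 0 0) = e' * star (u.1 0 0) * f' := by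
      simp [su2_mul_apply, cI, he', hf', -RCLike.star_def]
    have h01 : star ((gDiag φ * u * gDiag ψ).1 0 1) = e' * star (u.1 0 1) * f := by
      simp [su2_mul_apply, cI, cI', he', hf, -RCLike.star_def]
    have h10 : star ((gDiag φ * u * gDiag ψ).1 1 0) = e * star (u.1 1 0) * f' := by
      simp [su2_mul_apply, cI, cI', he, hf', -RCLike.star_def]
    have h11 : star ((gDiag φ * u * gDiag ψ).1 1 1) = e * star (u.1 1 1) * f := by
      simp [su2_mul_apply, cI', he, hf, -RCLike.star_def]
    have hP : wignerPoly (gDiag φ * u * gDiag ψ) a (J - a) =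
        C (f' ^ a * f ^ (J - a) * e ^ J) * (wignerPoly u a (J - a)).comp (C (e' ^ 2) * X) := by
      have hC : (C e * C e' : ℂ[X]) = 1 := by rw [← C_mul, hee, C_1]
      have hJ : e ^ J = e ^ a * e ^ (J - a) := by rw [← pow_add, Nat.add_sub_cancel' ha]
      rw [wignerPoly, wignerPoly, h00, h01, h10, h11, hJ, mul_comp, pow_comp, pow_comp]
      simp only [add_comp, mul_comp, C_comp, X_comp]
      have A1 : (C (e' * star (u.1 0 0) * f') * X + C (e * star (u.1 1 0) * f') : ℂ[X]) =
          C f' * C e * (C (star (u.1 0 0)) * (C (e' ^ 2) * X) + C (star (u.1 1 0))) := by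
        simp only [C_mul, C_pow]
        linear_combination (-(C e' * C (star (u.1 0 0)) * C f' * X)) * hC
      have A2 : (C (e' * star (u.1 0 1) * f) * X + C (e * star (u.1 1 1) * f) : ℂ[X]) =
          C f * C e * (C (star (u.1 0 1)) * (C (e' ^ 2) * X) + C (star (u.1 1 1))) := by
        simp only [C_mul, C_pow]
        linear_combination (-(C e' * C (star (u.1 0 1)) * C f * X)) * hC
      rw [A1, A2, mul_pow, mul_pow, mul_pow, mul_pow]
      simp only [C_mul, C_pow]
      ring
    have hphase : Complex.exp (-(Complex.I * ((((2 * (k : ℤ) - J : ℤ) : ℂ) / 2) * φ +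
        (((2 * (a : ℤ) - J : ℤ) : ℂ) / 2) * ψ))) = f' ^ a * f ^ (J - a) * e ^ J * (e' ^ 2) ^ k := by
      rw [he, he', hf, hf']
      simp only [← Complex.exp_nat_mul, ← Complex.exp_add]
      congr 1
      push_cast [Nat.cast_sub ha]
      ring
    rw [hP, coeff_C_mul, comp_C_mul_X_coeff, hphase]
    ring
  · rw [wignerD_of_not J M N _ h, wignerD_of_not J M N _ h, mul_zero]

end Poly

section Poly

open Polynomial

/-! ### Orthogonality of the Wigner `d`-functions -/

lemma hasDerivAt_coeff_mul {P Q : ℝ → ℝ[X]} {P' Q' : ℝ[X]} {θ : ℝ}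
    (hP : ∀ k, HasDerivAt (fun t => (P t).coeff k) (P'.coeff k) θ)
    (hQ : ∀ k, HasDerivAt (fun t => (Q t).coeff k) (Q'.coeff k) θ) (k : ℕ) :
    HasDerivAt (fun t => (P t * Q t).coeff k) ((P' * Q θ + P θ * Q').coeff k) θ := by
  simp only [coeff_add, coeff_mul, ← Finset.sum_add_distrib]
  exact HasDerivAt.fun_sum fun i _ => (hP _).mul (hQ _)

lemma hasDerivAt_coeff_pow {P : ℝ → ℝ[X]} {P' : ℝ[X]} {θ : ℝ}
    (hP : ∀ k, HasDerivAt (fun t => (P t).coeff k) (P'.coeff k) θ) (n k : ℕ) :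
    HasDerivAt (fun t => (P t ^ n).coeff k) ((n * P θ ^ (n - 1) * P').coeff k) θ := by
  induction n generalizing k with
  | zero => simpa using hasDerivAt_const θ _
  | succ n ih =>
    have h := hasDerivAt_coeff_mul ih hP k
    simp only [pow_succ]
    refine h.congr_deriv (congrArg (fun p => coeff p k) ?_)
    rcases n with _ | n
    · simp
    · simp only [Nat.add_sub_cancel, pow_succ]
      push_cast
      ring

/-- The first factor `c x + s` of the polynomial of the real rotation `a_θ`. -/
def rotU (θ : ℝ) : ℝ[X] := C (Real.cos (θ / 2)) * X + C (Real.sin (θ / 2))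

/-- The second factor `-s x + c` of the polynomial of the real rotation `a_θ`. -/
def rotV (θ : ℝ) : ℝ[X] := C (-Real.sin (θ / 2)) * X + C (Real.cos (θ / 2))

/-- The Wigner `d`-function up to normalisation: the `k`-th coefficient of
`(c x + s) ^ a * (-s x + c) ^ b` with `c = cos (θ / 2)` and `s = sin (θ / 2)`. -/
def dCoeff (a b k : ℕ) (θ : ℝ) : ℝ := (rotU θ ^ a * rotV θ ^ b).coeff k

lemma hasDerivAt_cos_half (θ : ℝ) :
    HasDerivAt (fun t => Real.cos (t / 2)) (-(Real.sin (θ / 2) / 2)) θ := by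
  have := ((hasDerivAt_id θ).div_const 2).cos
  simp only [id] at this
  exact this.congr_deriv (by ring)

lemma hasDerivAt_sin_half (θ : ℝ) :
    HasDerivAt (fun t => Real.sin (t / 2)) (Real.cos (θ / 2) / 2) θ := by
  have := ((hasDerivAt_id θ).div_const 2).sin
  simp only [id] at this
  exact this.congr_deriv (by ring)

lemma hasDerivAt_coeff_linear {f g : ℝ → ℝ} {f' g' θ : ℝ} (hf : HasDerivAt f f' θ)
    (hg : HasDerivAt g g' θ) (k : ℕ) :
    HasDerivAt (fun t => (C (f t) * X + C (g t)).coeff k) ((C f' * X + C g').coeff k) θ := by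
  simp only [coeff_add, coeff_C_mul, coeff_X, coeff_C]
  refine (hf.mul_const _).add ?_
  split_ifs
  · exact hg
  · exact hasDerivAt_const _ _

/-- The derivative with respect to `θ` of the polynomial `u ^ a * v ^ b` of `a_θ`, where `u = c x + s`
and `v = -s x + c`: the operator `(v ∂/∂u - u ∂/∂v) / 2` applied to it. -/
def rotDeriv (a b : ℕ) (θ : ℝ) : ℝ[X] :=
  C (1 / 2) * ((a : ℝ[X]) * rotU θ ^ (a - 1) * rotV θ * rotV θ ^ b
    - rotU θ ^ a * ((b : ℝ[X]) * rotV θ ^ (b - 1) * rotU θ))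

lemma hasDerivAt_dCoeff (a b k : ℕ) (θ : ℝ) :
    HasDerivAt (dCoeff a b k) ((rotDeriv a b θ).coeff k) θ := by
  have hU := hasDerivAt_coeff_linear (hasDerivAt_cos_half θ) (hasDerivAt_sin_half θ)
  have hV := hasDerivAt_coeff_linear (hasDerivAt_sin_half θ).neg (hasDerivAt_cos_half θ)
  have h := hasDerivAt_coeff_mul (hasDerivAt_coeff_pow (P := rotU) hU a)
    (hasDerivAt_coeff_pow (P := rotV) hV b) k
  refine h.congr_deriv (congrArg (fun p => coeff p k) ?_)
  have e1 : (C (-(Real.sin (θ / 2) / 2)) * X + C (Real.cos (θ / 2) / 2) : ℝ[X]) =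
      C (1 / 2) * rotV θ := by
    rw [rotV, mul_add, ← mul_assoc, ← C_mul, ← C_mul]
    congr 3 <;> ring
  have e2 : (C (-(Real.cos (θ / 2) / 2)) * X + C (-(Real.sin (θ / 2) / 2)) : ℝ[X]) =
      -(C (1 / 2) * rotU θ) := by
    rw [rotU, mul_add, ← mul_assoc, ← C_mul, ← C_mul, neg_add, ← neg_mul, ← C_neg, ← C_neg]
    congr 3 <;> ring_nf
  rw [e1, e2, rotDeriv]
  ring

lemma continuous_dCoeff (a b k : ℕ) : Continuous (dCoeff a b k) :=
  continuous_iff_continuousAt.2 fun θ => (hasDerivAt_dCoeff a b k θ).continuousAt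

lemma C_cos_sq_add_sin_sq (θ : ℝ) :
    (C (Real.cos (θ / 2)) ^ 2 + C (Real.sin (θ / 2)) ^ 2 : ℝ[X]) = 1 := by
  rw [← C_pow, ← C_pow, ← C_add, Real.cos_sq_add_sin_sq, C_1]

lemma cos_eq_half (θ : ℝ) : Real.cos θ = Real.cos (θ / 2) ^ 2 - Real.sin (θ / 2) ^ 2 := by
  rw [← Real.cos_two_mul']; congr 1; ring

lemma sin_eq_half (θ : ℝ) : Real.sin θ = 2 * Real.sin (θ / 2) * Real.cos (θ / 2) := by
  rw [← Real.sin_two_mul]; congr 1; ring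

lemma derivative_rotPoly (a b : ℕ) (θ : ℝ) :
    derivative (rotU θ ^ a * rotV θ ^ b) =
      (a : ℝ[X]) * rotU θ ^ (a - 1) * C (Real.cos (θ / 2)) * rotV θ ^ b
        - rotU θ ^ a * ((b : ℝ[X]) * rotV θ ^ (b - 1) * C (Real.sin (θ / 2))) := by
  simp only [derivative_mul, derivative_pow, rotU, rotV, derivative_add, derivative_C, derivative_X,
    C_neg, map_natCast, mul_one, zero_mul, zero_add, add_zero, derivative_neg, neg_zero]
  ring

lemma natCast_mul_pow_pred_mul (a : ℕ) (p : ℝ[X]) : (a : ℝ[X]) * p ^ (a - 1) * p = a * p ^ a := by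
  rcases a with _ | a
  · simp
  · rw [Nat.add_sub_cancel, mul_assoc, ← pow_succ]

/-- The same derivative in the original variable: the operator lowering the degree in `x` minus the
one raising it. -/
lemma two_mul_rotDeriv (a b : ℕ) (θ : ℝ) :
    2 * rotDeriv a b θ = (1 + X ^ 2) * derivative (rotU θ ^ a * rotV θ ^ b)
      - ((a : ℝ[X]) + (b : ℝ[X])) * X * (rotU θ ^ a * rotV θ ^ b) := by
  have h2 : (2 * C (1 / 2) : ℝ[X]) = 1 := by
    rw [← C_ofNat, ← C_mul]; norm_num
  have hu := natCast_mul_pow_pred_mul a (rotU θ)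
  have hv := natCast_mul_pow_pred_mul b (rotV θ)
  rw [derivative_rotPoly, rotDeriv, ← mul_assoc, h2, one_mul]
  have e1 : (1 + X ^ 2) * C (Real.cos (θ / 2)) = rotV θ + X * rotU θ := by
    rw [rotU, rotV, C_neg]; ring
  have e2 : (1 + X ^ 2) * C (Real.sin (θ / 2)) = rotU θ - X * rotV θ := by
    rw [rotU, rotV, C_neg]; ring
  linear_combination (-(a * rotU θ ^ (a - 1) * rotV θ ^ b)) * e1
    + (rotU θ ^ a * (b * rotV θ ^ (b - 1))) * e2 - X * rotV θ ^ b * hu - X * rotU θ ^ a * hv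

/-- The weight operator in the rotated variables in terms of the weight operator and the raising
and lowering operators in the original ones. -/
lemma rotated_weight_operator (a b : ℕ) (θ : ℝ) :
    ((a : ℝ[X]) - (b : ℝ[X])) * (rotU θ ^ a * rotV θ ^ b) =
      C (Real.cos θ) * (2 * X * derivative (rotU θ ^ a * rotV θ ^ b)
        - ((a : ℝ[X]) + (b : ℝ[X])) * (rotU θ ^ a * rotV θ ^ b))
      + C (Real.sin θ) * ((1 - X ^ 2) * derivative (rotU θ ^ a * rotV θ ^ b)
        + ((a : ℝ[X]) + (b : ℝ[X])) * X * (rotU θ ^ a * rotV θ ^ b)) := by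
  have hc := C_cos_sq_add_sin_sq θ
  have hu := natCast_mul_pow_pred_mul a (rotU θ)
  have hv := natCast_mul_pow_pred_mul b (rotV θ)
  rw [derivative_rotPoly, cos_eq_half θ, sin_eq_half θ]
  simp only [C_sub, C_mul, C_pow, C_ofNat]
  set c : ℝ[X] := C (Real.cos (θ / 2))
  set s : ℝ[X] := C (Real.sin (θ / 2))
  have hU : rotU θ = c * X + s := rfl
  have hV : rotV θ = -s * X + c := by rw [rotV, C_neg]
  have e1 : (c ^ 2 - s ^ 2) * (2 * X * c - rotU θ) + 2 * s * c * ((1 - X ^ 2) * c + X * rotU θ)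
      = rotU θ := by
    rw [hU]; linear_combination (c * X + s) * hc
  have e2 : (c ^ 2 - s ^ 2) * (2 * X * s + rotV θ) + 2 * s * c * ((1 - X ^ 2) * s - X * rotV θ)
      = rotV θ := by
    rw [hV]; linear_combination (-s * X + c) * hc
  linear_combination (-(a * rotU θ ^ (a - 1) * rotV θ ^ b)) * e1
    + (rotU θ ^ a * (b * rotV θ ^ (b - 1))) * e2
    - (1 + (c ^ 2 - s ^ 2) - 2 * s * c * X) * rotV θ ^ b * hu
    - (-1 + (c ^ 2 - s ^ 2) - 2 * s * c * X) * rotU θ ^ a * hv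

/-- Raising: `sin θ` times the derivative of a `d`-function in terms of itself and the next one. -/
lemma sin_mul_deriv_dCoeff (a b k : ℕ) (θ : ℝ) :
    2 * (Real.sin θ * (rotDeriv a b θ).coeff k) =
      2 * Real.sin θ * ((k : ℝ) + 1) * dCoeff a b (k + 1) θ
        - ((a : ℝ) - b - Real.cos θ * (2 * k - (a + b))) * dCoeff a b k θ := by
  have h : C (Real.sin θ) * (2 * rotDeriv a b θ) + (C ((a : ℝ) - b)) * (rotU θ ^ a * rotV θ ^ b) =
      C (Real.cos θ) * (C 2 * (derivative (rotU θ ^ a * rotV θ ^ b) * X)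
        - C ((a : ℝ) + b) * (rotU θ ^ a * rotV θ ^ b))
      + C (2 * Real.sin θ) * derivative (rotU θ ^ a * rotV θ ^ b) := by
    simp only [C_add, C_sub, C_mul, C_eq_natCast, C_ofNat]
    rw [rotated_weight_operator, two_mul_rotDeriv]
    ring
  have h1 := congrArg (fun p => coeff p k) h
  have h2 : (derivative (rotU θ ^ a * rotV θ ^ b) * X).coeff k = k * dCoeff a b k θ := by
    rcases k with _ | k
    · simp
    · rw [coeff_mul_X, coeff_derivative, dCoeff]; push_cast; ring
  have h3 : (2 * rotDeriv a b θ).coeff k = 2 * (rotDeriv a b θ).coeff k := by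
    rw [← C_ofNat, coeff_C_mul]
  simp only [coeff_add, coeff_sub, coeff_C_mul, h2, h3, coeff_derivative] at h1
  simp only [dCoeff] at h1 ⊢
  linear_combination h1

/-- Lowering: `sin θ` times the derivative of a `d`-function in terms of itself and the previous
one. -/
lemma sin_mul_deriv_dCoeff_succ (a b k : ℕ) (θ : ℝ) :
    2 * (Real.sin θ * (rotDeriv a b θ).coeff (k + 1)) =
      ((a : ℝ) - b - Real.cos θ * (2 * (k + 1) - (a + b))) * dCoeff a b (k + 1) θ
        - 2 * Real.sin θ * ((a : ℝ) + b - k) * dCoeff a b k θ := by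
  have h : (C ((a : ℝ) - b)) * (rotU θ ^ a * rotV θ ^ b) - C (Real.sin θ) * (2 * rotDeriv a b θ) =
      C (Real.cos θ) * (C 2 * (derivative (rotU θ ^ a * rotV θ ^ b) * X)
        - C ((a : ℝ) + b) * (rotU θ ^ a * rotV θ ^ b))
      + C (2 * Real.sin θ) * (C ((a : ℝ) + b) * (rotU θ ^ a * rotV θ ^ b)
        - derivative (rotU θ ^ a * rotV θ ^ b) * X) * X := by
    simp only [C_add, C_sub, C_mul, C_eq_natCast, C_ofNat]
    rw [rotated_weight_operator, two_mul_rotDeriv]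
    ring
  have h1 := congrArg (fun p => coeff p (k + 1)) h
  have h2 : (derivative (rotU θ ^ a * rotV θ ^ b) * X).coeff k = k * dCoeff a b k θ := by
    rcases k with _ | k
    · simp
    · rw [coeff_mul_X, coeff_derivative, dCoeff]; push_cast; ring
  have h3 : (2 * rotDeriv a b θ).coeff (k + 1) = 2 * (rotDeriv a b θ).coeff (k + 1) := by
    rw [← C_ofNat, coeff_C_mul]
  simp only [coeff_add, coeff_sub, coeff_C_mul, coeff_mul_X, h2, h3, coeff_derivative] at h1
  simp only [dCoeff] at h1 ⊢
  linear_combination -h1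

/-- The integral of a product of two `d`-functions against `sin θ`. -/
def dInner (a b k a' b' k' : ℕ) : ℝ :=
  ∫ θ in (0 : ℝ)..Real.pi, Real.sin θ * (dCoeff a b k θ * dCoeff a' b' k' θ)

lemma dInner_comm (a b k a' b' k' : ℕ) : dInner a b k a' b' k' = dInner a' b' k' a b k := by
  simp only [dInner, mul_comm (dCoeff a b k _)]

lemma intervalIntegrable_dInner (a b k a' b' k' : ℕ) :
    IntervalIntegrable (fun θ => Real.sin θ * (dCoeff a b k θ * dCoeff a' b' k' θ)) volume
      0 Real.pi :=
  (Real.continuous_sin.mul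
    ((continuous_dCoeff a b k).mul (continuous_dCoeff a' b' k'))).intervalIntegrable _ _

/-- The raising and lowering operators are adjoint: integrate the derivative of
`sin θ * d_{k + 1} * d'_{k'}` over `[0, π]`. -/
lemma dInner_ladder (a b k a' b' k' : ℕ) (hN : (a : ℝ) - b = a' - b')
    (hM : 2 * (k : ℝ) - (a + b) = 2 * k' - (a' + b')) :
    ((a : ℝ) + b - k) * dInner a b k a' b' k' =
      ((k' : ℝ) + 1) * dInner a b (k + 1) a' b' (k' + 1) := by
  have hd : ∀ θ ∈ Set.uIcc 0 Real.pi,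
      HasDerivAt (fun t => Real.sin t * (dCoeff a b (k + 1) t * dCoeff a' b' k' t))
        (((k' : ℝ) + 1) * (Real.sin θ * (dCoeff a b (k + 1) θ * dCoeff a' b' (k' + 1) θ))
          - ((a : ℝ) + b - k) * (Real.sin θ * (dCoeff a b k θ * dCoeff a' b' k' θ))) θ := by
    intro θ _
    refine ((Real.hasDerivAt_sin θ).mul
      ((hasDerivAt_dCoeff a b (k + 1) θ).mul (hasDerivAt_dCoeff a' b' k' θ))).congr_deriv ?_
    simp only [Pi.mul_apply]
    have h1 := sin_mul_deriv_dCoeff_succ a b k θ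
    have h2 := sin_mul_deriv_dCoeff a' b' k' θ
    rw [← hN, ← hM] at h2
    linear_combination (1 / 2) * dCoeff a' b' k' θ * h1 + (1 / 2) * dCoeff a b (k + 1) θ * h2
  have hi := intervalIntegral.integral_eq_sub_of_hasDerivAt hd
    (((intervalIntegrable_dInner _ _ _ _ _ _).const_mul _).sub
      ((intervalIntegrable_dInner _ _ _ _ _ _).const_mul _))
  rw [intervalIntegral.integral_sub ((intervalIntegrable_dInner _ _ _ _ _ _).const_mul _)
      ((intervalIntegrable_dInner _ _ _ _ _ _).const_mul _),
    intervalIntegral.integral_const_mul, intervalIntegral.integral_const_mul, Real.sin_pi,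
    Real.sin_zero] at hi
  simp only [dInner]
  linarith

/-- If `K`, `K'` are the inner products of vectors of neighbouring weights in representations whose
spins differ by `d`, then adjointness of the ladder operators gives the two hypotheses. -/
lemma eq_zero_of_two_ladders {x y d K K' : ℝ} (hx : 0 ≤ x) (hy : 0 ≤ y) (hd : 0 < d)
    (h1 : x * K = (y + 1 + d) * K') (h2 : (x + d) * K = (y + 1) * K') : K = 0 := by
  have h : (d * (x + y + 1 + d)) * K = 0 := by
    linear_combination (y + 1 + d) * h2 - (y + 1) * h1
  exact (mul_eq_zero.1 h).resolve_left (by positivity)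

lemma dInner_eq_zero (a b k d : ℕ) (hk : k ≤ a + b) (hd : 0 < d) :
    dInner a b k (a + d) (b + d) (k + d) = 0 := by
  have hk' : (k : ℝ) ≤ a + b := by exact_mod_cast hk
  have hd' : (0 : ℝ) < d := by exact_mod_cast hd
  have h1 := dInner_ladder a b k (a + d) (b + d) (k + d) (by push_cast; ring) (by push_cast; ring)
  have h2 := dInner_ladder (a + d) (b + d) (k + d) a b k (by push_cast; ring) (by push_cast; ring)
  rw [dInner_comm (a + d), dInner_comm (a + d)] at h2
  push_cast at h1 h2
  refine eq_zero_of_two_ladders (x := (a : ℝ) + b - k) (y := k) (d := d)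
    (K' := dInner a b (k + 1) (a + d) (b + d) (k + d + 1)) (by linarith) (by positivity) hd' ?_ ?_
  · linear_combination h1
  · linear_combination h2

/-- `∫ sin θ * sin (θ / 2) ^ (2 a) * cos (θ / 2) ^ (2 b)` over `[0, π]`. -/
def betaInt (a b : ℕ) : ℝ :=
  ∫ θ in (0 : ℝ)..Real.pi,
    Real.sin θ * (Real.sin (θ / 2) ^ (2 * a) * Real.cos (θ / 2) ^ (2 * b))

lemma intervalIntegrable_betaInt (a b : ℕ) : IntervalIntegrable (fun θ =>
    Real.sin θ * (Real.sin (θ / 2) ^ (2 * a) * Real.cos (θ / 2) ^ (2 * b))) volume 0 Real.pi := by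
  apply Continuous.intervalIntegrable
  fun_prop

lemma betaInt_ladder (a b : ℕ) :
    ((a : ℝ) + 1) * betaInt a (b + 1) = ((b : ℝ) + 1) * betaInt (a + 1) b := by
  have hd : ∀ θ ∈ Set.uIcc 0 Real.pi,
      HasDerivAt (fun t => 2 * (Real.sin (t / 2) ^ (2 * (a + 1)) * Real.cos (t / 2) ^ (2 * (b + 1))))
        (((a : ℝ) + 1) *
            (Real.sin θ * (Real.sin (θ / 2) ^ (2 * a) * Real.cos (θ / 2) ^ (2 * (b + 1))))
          - ((b : ℝ) + 1) *
            (Real.sin θ * (Real.sin (θ / 2) ^ (2 * (a + 1)) * Real.cos (θ / 2) ^ (2 * b)))) θ := by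
    intro θ _
    refine ((((hasDerivAt_sin_half θ).pow (2 * (a + 1))).mul
      ((hasDerivAt_cos_half θ).pow (2 * (b + 1)))).const_mul 2).congr_deriv ?_
    simp only [Pi.pow_apply]
    rw [sin_eq_half θ, show 2 * (a + 1) - 1 = 2 * a + 1 by omega,
      show 2 * (b + 1) - 1 = 2 * b + 1 by omega]
    push_cast
    ring
  have hi := intervalIntegral.integral_eq_sub_of_hasDerivAt hd
    (((intervalIntegrable_betaInt _ _).const_mul _).sub
      ((intervalIntegrable_betaInt _ _).const_mul _))
  rw [intervalIntegral.integral_sub ((intervalIntegrable_betaInt _ _).const_mul _)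
      ((intervalIntegrable_betaInt _ _).const_mul _),
    intervalIntegral.integral_const_mul, intervalIntegral.integral_const_mul] at hi
  simp only [zero_div, Real.cos_pi_div_two, Real.sin_zero, mul_add, mul_one, pow_add] at hi
  simp only [betaInt, mul_add, mul_one, pow_add]
  simp at hi
  linarith

lemma betaInt_add (a b : ℕ) : betaInt a (b + 1) + betaInt (a + 1) b = betaInt a b := by
  rw [betaInt, betaInt, betaInt, ← intervalIntegral.integral_add (intervalIntegrable_betaInt _ _)
    (intervalIntegrable_betaInt _ _)]
  congr 1
  funext θ
  have := Real.sin_sq_add_cos_sq (θ / 2)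
  linear_combination Real.sin θ * Real.sin (θ / 2) ^ (2 * a) * Real.cos (θ / 2) ^ (2 * b) * this

lemma betaInt_eq (a b : ℕ) :
    betaInt a b = 2 * (a.factorial * b.factorial) / (a + b + 1).factorial := by
  have hf : ∀ n : ℕ, (n.factorial : ℝ) ≠ 0 := fun n => by positivity
  induction a with
  | zero =>
    induction b with
    | zero =>
      simp [betaInt]; norm_num
    | succ b ih =>
      have h1 := betaInt_ladder 0 b
      have h2 := betaInt_add 0 b
      rw [ih] at h2
      have h3 : ((b : ℝ) + 2) * betaInt 0 (b + 1) =
          (b + 1) * (2 * ((Nat.factorial 0) * b.factorial) / (0 + b + 1).factorial) := by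
        push_cast at h1
        linear_combination h1 + (b + 1) * h2
      have hb : (b : ℝ) + 2 ≠ 0 := by positivity
      apply mul_left_cancel₀ hb
      rw [h3, show 0 + (b + 1) + 1 = (b + 1) + 1 by ring, show 0 + b + 1 = b + 1 by ring,
        Nat.factorial_succ (b + 1), Nat.factorial_succ b]
      have := hf b
      push_cast
      field_simp
      ring
  | succ a ih =>
    have h1 := betaInt_ladder a b
    have h2 := betaInt_add a b
    rw [ih] at h2
    have h3 : ((a : ℝ) + b + 2) * betaInt (a + 1) b =
        (a + 1) * (2 * (a.factorial * b.factorial) / (a + b + 1).factorial) := by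
      linear_combination (-1) * h1 + (a + 1) * h2
    have hb : (a : ℝ) + b + 2 ≠ 0 := by positivity
    apply mul_left_cancel₀ hb
    rw [h3, show a + 1 + b + 1 = (a + b + 1) + 1 by ring,
        Nat.factorial_succ (a + b + 1), Nat.factorial_succ a]
    have := hf (a + b + 1)
    push_cast
    field_simp
    ring

lemma dCoeff_zero (a b : ℕ) (θ : ℝ) :
    dCoeff a b 0 θ = Real.sin (θ / 2) ^ a * Real.cos (θ / 2) ^ b := by
  simp [dCoeff, coeff_zero_eq_eval_zero, rotU, rotV]

lemma dInner_self (a b k : ℕ) (hk : k ≤ a + b) :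
    dInner a b k a b k =
      (a + b).choose k * (2 * (a.factorial * b.factorial) / (a + b + 1).factorial) := by
  induction k with
  | zero =>
    rw [← betaInt_eq, dInner, betaInt]
    simp only [dCoeff_zero, Nat.choose_zero_right, Nat.cast_one, one_mul]
    congr 1
    funext θ
    ring
  | succ k ih =>
    have h := dInner_ladder a b k a b k rfl rfl
    rw [ih (by omega)] at h
    have hk1 : ((k : ℝ) + 1) ≠ 0 := by positivity
    apply mul_left_cancel₀ hk1
    have hc := Nat.choose_succ_right_eq (a + b) k
    have hc' : ((a + b).choose (k + 1) : ℝ) * (k + 1) = (a + b).choose k * (a + b - k) := by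
      have := congrArg (fun n : ℕ => (n : ℝ)) hc
      push_cast [Nat.cast_sub (show k ≤ a + b by omega)] at this
      exact this
    rw [← h]
    linear_combination (-(2 * ((a.factorial : ℝ) * b.factorial) / (a + b + 1).factorial)) * hc'

lemma coeff_wignerPoly_aRot (θ : ℝ) (a b k : ℕ) :
    (wignerPoly (aRot θ) a b).coeff k = (dCoeff a b k θ : ℂ) := by
  have : wignerPoly (aRot θ) a b = (rotU θ ^ a * rotV θ ^ b).map Complex.ofRealHom := by
    simp [wignerPoly, rotU, rotV, Complex.conj_ofReal, -Complex.ofReal_cos, -Complex.ofReal_sin]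
  rw [this, coeff_map, dCoeff]
  rfl

/-- Orthogonality of the Wigner `d`-functions with the same weights. -/
lemma integral_wignerD_aRot (J J' : ℕ) (M N : ℤ) (hM : IsWeight J M) (hN : IsWeight J N)
    (hM' : IsWeight J' M) (hN' : IsWeight J' N) :
    ∫ θ in (0 : ℝ)..Real.pi, ((1 / 2 * Real.sin θ : ℝ) : ℂ) *
      (wignerD J M N (aRot θ) * star (wignerD J' M N (aRot θ))) =
      if J = J' then 1 / ((J : ℂ) + 1) else 0 := by
  obtain ⟨k, hk, rfl⟩ := isWeight_iff.1 hM
  obtain ⟨a, ha, rfl⟩ := isWeight_iff.1 hN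
  obtain ⟨k', hk', hkk⟩ := isWeight_iff.1 hM'
  obtain ⟨a', ha', haa⟩ := isWeight_iff.1 hN'
  have e : ∀ θ : ℝ, ((1 / 2 * Real.sin θ : ℝ) : ℂ) *
      (wignerD J (2 * (k : ℤ) - J) (2 * (a : ℤ) - J) (aRot θ) *
        star (wignerD J' (2 * (k : ℤ) - J) (2 * (a : ℤ) - J) (aRot θ))) =
      (((1 / 2 * (Real.sqrt ((k.factorial * (J - k).factorial : ℝ) /
          (a.factorial * (J - a).factorial)) *
        Real.sqrt ((k'.factorial * (J' - k').factorial : ℝ) /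
          (a'.factorial * (J' - a').factorial)))) *
        (Real.sin θ * (dCoeff a (J - a) k θ * dCoeff a' (J' - a') k' θ)) : ℝ) : ℂ) := by
    intro θ
    rw [wignerD_weight J k a hk ha, hkk, haa, wignerD_weight J' k' a' hk' ha',
      coeff_wignerPoly_aRot, coeff_wignerPoly_aRot, star_mul']
    have hst : ∀ x : ℝ, star (x : ℂ) = x := fun x => Complex.conj_ofReal x
    rw [hst, hst]
    push_cast
    ring
  simp only [e]
  rw [intervalIntegral.integral_ofReal, intervalIntegral.integral_const_mul]
  change ((_ * dInner a (J - a) k a' (J' - a') k' : ℝ) : ℂ) = _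
  split_ifs with hJ
  · subst hJ
    obtain rfl : k = k' := by omega
    obtain rfl : a = a' := by omega
    have hf : ∀ n : ℕ, (n.factorial : ℝ) ≠ 0 := fun n => by positivity
    rw [dInner_self a (J - a) k (by omega), Real.mul_self_sqrt (by positivity),
      Nat.add_sub_cancel' ha, Nat.cast_choose ℝ hk, Nat.factorial_succ]
    have := hf J; have := hf k; have := hf (J - k); have := hf a; have := hf (J - a)
    have : (J : ℝ) + 1 ≠ 0 := by positivity
    have h2 : 1 / ((J : ℂ) + 1) = ((1 / ((J : ℝ) + 1) : ℝ) : ℂ) := by push_cast; rfl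
    rw [h2]
    congr 1
    push_cast
    field_simp
  · have : dInner a (J - a) k a' (J' - a') k' = 0 := by
      rcases lt_or_gt_of_ne hJ with h | h
      · obtain ⟨d, rfl⟩ : ∃ d, a' = a + d := ⟨a' - a, by omega⟩
        rw [show J' - (a + d) = (J - a) + d by omega, show k' = k + d by omega]
        exact dInner_eq_zero _ _ _ _ (by omega) (by omega)
      · obtain ⟨d, rfl⟩ : ∃ d, a = a' + d := ⟨a - a', by omega⟩
        rw [show J - (a' + d) = (J' - a') + d by omega, show k = k' + d by omega, dInner_comm]
        exact dInner_eq_zero _ _ _ _ (by omega) (by omega)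
    rw [this, mul_zero, Complex.ofReal_zero]

end Poly

/-! ### Van der Waerden's sum and its ladder relations -/

lemma invFact_of_neg {k : ℤ} (hk : k < 0) : invFact k = 0 := by
  rw [invFact, if_neg (by omega)]

lemma invFact_natCast (k : ℕ) : invFact k = 1 / k.factorial := by
  rw [invFact, if_pos (by omega), Int.toNat_natCast]

/-- The recursion of the reciprocal factorial holds for all integers. -/
lemma mul_invFact (k : ℤ) : (k : ℝ) * invFact k = invFact (k - 1) := by
  rcases lt_trichotomy k 0 with h | rfl | h
  · rw [invFact_of_neg h, invFact_of_neg (by omega), mul_zero]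
  · rw [invFact_of_neg (by omega : (0 : ℤ) - 1 < 0)]; simp
  · obtain ⟨m, rfl⟩ : ∃ m : ℕ, k = m + 1 := ⟨(k - 1).toNat, by omega⟩
    rw [add_sub_cancel_right, invFact_natCast, ← Nat.cast_succ, invFact_natCast, Nat.factorial_succ]
    have : ((m : ℝ) + 1) ≠ 0 := by positivity
    push_cast
    field_simp

/-- The alternating sum in Van der Waerden's formula, for `j₁ + j₂ - j = n`, `j₁ - j₂ + j = A`,
`j₂ - j₁ + j = B`, `j₁ - m₁ = a` and `j₂ + m₂ = b`. -/
def vdwSum (n A B : ℕ) (a b : ℤ) : ℝ :=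
  ∑ z ∈ Finset.range (n + 1), (-1 : ℝ) ^ z * invFact z * invFact ((n : ℤ) - z) *
    invFact (a - z) * invFact (b - z) * invFact ((A : ℤ) - a + z) * invFact ((B : ℤ) - b + z)

lemma vdwSum_swap (n A B : ℕ) (a b : ℤ) : vdwSum n A B a b = vdwSum n B A b a := by
  rw [vdwSum, vdwSum]
  exact Finset.sum_congr rfl fun z _ => by ring

lemma vdwSum_eq_zero_of_neg {n A B : ℕ} {a b : ℤ} (ha : a < 0) : vdwSum n A B a b = 0 :=
  Finset.sum_eq_zero fun z _ => by rw [invFact_of_neg (show a - z < 0 by omega)]; ring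

lemma vdwSum_eq_zero_of_gt {n A B : ℕ} {a b : ℤ} (ha : n + A < a) : vdwSum n A B a b = 0 :=
  Finset.sum_eq_zero fun z hz => by
    have := Finset.mem_range.1 hz
    rw [invFact_of_neg (show (A : ℤ) - a + z < 0 by omega)]; ring

/-- The action of the raising operator, written for the sums. Term by term the two sides differ by
a telescoping sum. -/
lemma vdwSum_raise (n A B : ℕ) (a b : ℤ) :
    ((a : ℝ) + 1) * vdwSum n A B (a + 1) b + ((n : ℝ) + B - b + 1) * vdwSum n A B a (b - 1) =
      ((A : ℝ) - a + b) * vdwSum n A B a b := by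
  let g : ℕ → ℝ := fun z => (-1 : ℝ) ^ z * invFact ((z : ℤ) - 1) * invFact ((n : ℤ) - z) *
    invFact (a + 1 - z) * invFact (b - z) * invFact ((A : ℤ) - a - 1 + z) * invFact ((B : ℤ) - b + z)
  have hg : ∑ z ∈ Finset.range (n + 1), (g z - g (z + 1)) = 0 := by
    rw [Finset.sum_range_sub']
    have h0 : g 0 = 0 := by
      simp only [g]
      rw [invFact_of_neg (show ((0 : ℕ) : ℤ) - 1 < 0 by omega)]; ring
    have h1 : g (n + 1) = 0 := by
      simp only [g]
      rw [invFact_of_neg (show (n : ℤ) - ((n + 1 : ℕ) : ℤ) < 0 by omega)]; ring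
    rw [h0, h1, sub_zero]
  rw [← sub_eq_zero, ← hg, vdwSum, vdwSum, vdwSum, Finset.mul_sum, Finset.mul_sum, Finset.mul_sum,
    ← Finset.sum_add_distrib, ← Finset.sum_sub_distrib]
  refine Finset.sum_congr rfl fun z _ => ?_
  simp only [g]
  have e1 := mul_invFact (a + 1 - z)
  have e2 := mul_invFact z
  have e3 := mul_invFact ((A : ℤ) - a + z)
  have e4 := mul_invFact ((B : ℤ) - (b - 1) + z)
  have e5 := mul_invFact ((n : ℤ) - z)
  have e6 := mul_invFact (b - z)
  rw [show a + 1 - (z : ℤ) - 1 = a - z by ring] at e1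
  rw [show (A : ℤ) - a + z - 1 = (A : ℤ) - a - 1 + z by ring] at e3
  rw [show (B : ℤ) - (b - 1) + z - 1 = (B : ℤ) - b + z by ring] at e4
  rw [show (b : ℤ) - z - 1 = b - 1 - z by ring] at e6
  rw [show (A : ℤ) - (a + 1) + z = (A : ℤ) - a - 1 + z by ring,
    show ((z + 1 : ℕ) : ℤ) - 1 = z by push_cast; ring,
    show (n : ℤ) - ((z + 1 : ℕ) : ℤ) = (n : ℤ) - z - 1 by push_cast; ring,
    show a + 1 - ((z + 1 : ℕ) : ℤ) = a - z by push_cast; ring,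
    show b - ((z + 1 : ℕ) : ℤ) = b - 1 - z by push_cast; ring,
    show (A : ℤ) - a - 1 + ((z + 1 : ℕ) : ℤ) = (A : ℤ) - a + z by push_cast; ring,
    show (B : ℤ) - b + ((z + 1 : ℕ) : ℤ) = (B : ℤ) - (b - 1) + z by push_cast; ring, pow_succ]
  push_cast at e1 e2 e3 e4 e5 e6
  rw [← e1, ← e2, ← e3, ← e4, ← e5, ← e6]
  ring

/-- The action of the lowering operator, written for the sums. -/
lemma vdwSum_lower (n A B : ℕ) (a b : ℤ) :
    ((n : ℝ) + A - a + 1) * vdwSum n A B (a - 1) b + ((b : ℝ) + 1) * vdwSum n A B a (b + 1) =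
      ((B : ℝ) - b + a) * vdwSum n A B a b := by
  rw [vdwSum_swap n A B (a - 1), vdwSum_swap n A B a (b + 1), vdwSum_swap n A B a b,
    ← vdwSum_raise]
  ring

/-! ### Inner products of coupled vectors -/

/-- `(j - m)! (j + m)!` for `J = 2j` and `a = j - m` (or `a = j + m`), zero if `m` is not a
weight. -/
def weightFact (J : ℕ) (a : ℤ) : ℝ :=
  if 0 ≤ a ∧ a ≤ J then (a.toNat.factorial : ℝ) * ((J - a).toNat.factorial : ℝ) else 0

lemma weightFact_natCast {J k : ℕ} (hk : k ≤ J) :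
    weightFact J k = k.factorial * (J - k).factorial := by
  rw [weightFact, if_pos (by omega), Int.toNat_natCast, show ((J : ℤ) - k).toNat = J - k by omega]

lemma weightFact_of_not {J : ℕ} {a : ℤ} (h : ¬ (0 ≤ a ∧ a ≤ J)) : weightFact J a = 0 := by
  rw [weightFact, if_neg h]

lemma weightFact_nonneg (J : ℕ) (a : ℤ) : 0 ≤ weightFact J a := by
  rw [weightFact]; split_ifs <;> positivity

lemma weightFact_succ {J : ℕ} {a : ℤ} (h0 : a + 1 ≠ 0) (h1 : a ≠ J) :
    ((a : ℝ) + 1) * weightFact J a = ((J : ℝ) - a) * weightFact J (a + 1) := by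
  by_cases h : 0 ≤ a ∧ a ≤ J
  · obtain ⟨k, rfl⟩ : ∃ k : ℕ, a = k := ⟨a.toNat, by omega⟩
    obtain ⟨l, rfl⟩ : ∃ l : ℕ, J = k + 1 + l := ⟨J - k - 1, by omega⟩
    rw [weightFact_natCast (by omega), ← Nat.cast_succ, weightFact_natCast (by omega),
      show k + 1 + l - k = l + 1 by omega, show k + 1 + l - k.succ = l by omega,
      Nat.factorial_succ, Nat.factorial_succ]
    push_cast
    ring
  · rw [weightFact_of_not h, weightFact_of_not (by omega), mul_zero, mul_zero]

lemma sum_range_shift (m : ℕ) (h : ℤ → ℝ) (h0 : h 0 = 0) (h1 : h (m + 1) = 0) :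
    ∑ a ∈ Finset.range (m + 1), h ((a : ℤ) + 1) = ∑ a ∈ Finset.range (m + 1), h a := by
  have e1 := Finset.sum_range_succ' (fun a : ℕ => h a) (m + 1)
  have e2 := Finset.sum_range_succ (fun a : ℕ => h a) (m + 1)
  simp only [Nat.cast_succ, Nat.cast_zero, h0, h1, add_zero] at e1 e2
  rw [← e1, ← e2]

/-- The inner product, in `V_{j₁} ⊗ V_{j₂}`, of two coupled vectors of the same weight, without the
normalisation. The weight is encoded by `δ = (j₁ - m₁) - (j₂ + m₂)`. -/
def vdwInner (n A B n' A' B' : ℕ) (δ : ℤ) : ℝ :=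
  ∑ a ∈ Finset.range (n + A + 1), weightFact (n + A) a * weightFact (n + B) (a - δ) *
    (vdwSum n A B a (a - δ) * vdwSum n' A' B' a (a - δ))

lemma vdwInner_comm {n A B n' A' B' : ℕ} (h1 : n + A = n' + A') (h2 : n + B = n' + B') (δ : ℤ) :
    vdwInner n A B n' A' B' δ = vdwInner n' A' B' n A B δ := by
  simp only [vdwInner, h1, h2]
  exact Finset.sum_congr rfl fun a _ => by ring

/-- The raising and lowering operators on `V_{j₁} ⊗ V_{j₂}` are adjoint to each other. -/
lemma vdwInner_ladder {n A B n' A' B' : ℕ} (h1 : n + A = n' + A') (h2 : n + B = n' + B') (δ : ℤ) :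
    ((A : ℝ) - δ) * vdwInner n A B n' A' B' δ =
      ((B' : ℝ) + δ + 1) * vdwInner n A B n' A' B' (δ + 1) := by
  have h1' : (n : ℝ) + A = n' + A' := by exact_mod_cast h1
  have h2' : (n : ℝ) + B = n' + B' := by exact_mod_cast h2
  let h : ℤ → ℝ := fun a => weightFact (n + A) a * ((n : ℝ) + A - a + 1) *
    weightFact (n + B) (a - 1 - δ) * vdwSum n' A' B' (a - 1) (a - 1 - δ) *
      vdwSum n A B a (a - 1 - δ)
  have hs := sum_range_shift (n + A) h
    (by simp only [h]; rw [vdwSum_eq_zero_of_neg (show (0 : ℤ) - 1 < 0 by omega)]; ring)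
    (by simp only [h]; rw [weightFact_of_not (by push_cast; omega)]; ring)
  have hA : ∀ a : ℕ, weightFact (n + A) a * ((a : ℝ) + 1) * weightFact (n + B) (a - δ) *
      vdwSum n' A' B' a (a - δ) * vdwSum n A B (a + 1) (a - δ) = h ((a : ℤ) + 1) := by
    intro a
    simp only [h, add_sub_cancel_right]
    by_cases ha : (a : ℤ) = (n + A : ℕ)
    · rw [vdwSum_eq_zero_of_gt (show (n : ℤ) + A < a + 1 by rw [ha]; push_cast; omega)]; ring
    · have := weightFact_succ (J := n + A) (a := a) (by omega) ha
      push_cast at this ⊢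
      linear_combination weightFact (n + B) (a - δ) *
        vdwSum n' A' B' a (a - δ) * vdwSum n A B (a + 1) (a - δ) * this
  have hB : ∀ a b : ℤ, weightFact (n + B) b * ((n : ℝ) + B - b + 1) *
        (vdwSum n' A' B' a b * vdwSum n A B a (b - 1)) =
      weightFact (n + B) (b - 1) * (b : ℝ) * (vdwSum n' A' B' a b * vdwSum n A B a (b - 1)) := by
    intro a b
    by_cases hb0 : b = 0
    · subst hb0
      rw [vdwSum_swap n A B, vdwSum_eq_zero_of_neg (show (0 : ℤ) - 1 < 0 by omega)]; ring
    · by_cases hb1 : b = (n + B : ℕ) + 1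
      · rw [vdwSum_swap n' A' B', vdwSum_eq_zero_of_gt (show (n' : ℤ) + B' < b by
          rw [hb1, h2]; push_cast; omega)]; ring
      · have := weightFact_succ (J := n + B) (a := b - 1) (by omega) (by omega)
        rw [sub_add_cancel] at this
        push_cast at this
        linear_combination (-vdwSum n' A' B' a b * vdwSum n A B a (b - 1)) * this
  have hl : ((A : ℝ) - δ) * vdwInner n A B n' A' B' δ =
      ∑ a ∈ Finset.range (n + A + 1), (h ((a : ℤ) + 1) + weightFact (n + A) a *
        (weightFact (n + B) (a - δ - 1) * ((a : ℝ) - δ) *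
          (vdwSum n' A' B' a (a - δ) * vdwSum n A B a (a - δ - 1)))) := by
    rw [vdwInner, Finset.mul_sum]
    refine Finset.sum_congr rfl fun a _ => ?_
    have e := vdwSum_raise n A B a (a - δ)
    have hb := hB a (a - δ)
    push_cast at e hb
    rw [← hA, ← hb]
    linear_combination (-(weightFact (n + A) a * weightFact (n + B) (a - δ) *
      vdwSum n' A' B' a (a - δ))) * e
  rw [hl, Finset.sum_add_distrib, hs, ← Finset.sum_add_distrib, vdwInner, Finset.mul_sum]
  refine Finset.sum_congr rfl fun a _ => ?_
  have e := vdwSum_lower n' A' B' a (a - (δ + 1))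
  simp only [h]
  rw [show (a : ℤ) - 1 - δ = a - (δ + 1) by ring, show (a : ℤ) - δ - 1 = a - (δ + 1) by ring]
  rw [show (a : ℤ) - (δ + 1) + 1 = a - δ by ring, ← h1'] at e
  push_cast at e ⊢
  linear_combination (weightFact (n + A) a * weightFact (n + B) (a - (δ + 1)) *
    vdwSum n A B a (a - (δ + 1))) * e

/-- Coupled vectors with different total spins are orthogonal. -/
lemma vdwInner_eq_zero {n A B d : ℕ} (hd : 0 < d) {δ : ℤ} (h0 : δ ≤ A) (h1 : -δ ≤ B) :
    vdwInner (n + d) A B n (A + d) (B + d) δ = 0 := by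
  have e1 := vdwInner_ladder (n := n + d) (A := A) (B := B) (n' := n) (A' := A + d) (B' := B + d)
    (by ring) (by ring) δ
  have e2 := vdwInner_ladder (n := n) (A := A + d) (B := B + d) (n' := n + d) (A' := A) (B' := B)
    (by ring) (by ring) δ
  rw [vdwInner_comm (by ring) (by ring) δ, vdwInner_comm (by ring) (by ring) (δ + 1)] at e2
  have h0' : (δ : ℝ) ≤ A := by exact_mod_cast h0
  have h1' : -(δ : ℝ) ≤ B := by exact_mod_cast h1
  have hd' : (0 : ℝ) < d := by exact_mod_cast hd
  push_cast at e1 e2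
  refine eq_zero_of_two_ladders (x := (A : ℝ) - δ) (y := (B : ℝ) + δ) (d := d)
    (K' := vdwInner (n + d) A B n (A + d) (B + d) (δ + 1)) (by linarith) (by linarith) hd' ?_ ?_
  · linear_combination e1
  · linear_combination e2

lemma sum_choose_mul_choose (n A B : ℕ) :
    ∑ a ∈ Finset.range (n + 1), (n - a + A).choose A * (a + B).choose B =
      (n + A + B + 1).choose n := by
  have h : ((PowerSeries.mk 1 : PowerSeries ℤ) ^ (B + 1)) * (PowerSeries.mk 1) ^ (A + 1) =
      (PowerSeries.mk 1) ^ (A + B + 1 + 1) := by ring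
  have h1 := congrArg (PowerSeries.coeff n) h
  rw [PowerSeries.mk_one_pow_eq_mk_choose_add, PowerSeries.mk_one_pow_eq_mk_choose_add,
    PowerSeries.mk_one_pow_eq_mk_choose_add, PowerSeries.coeff_mul,
    Finset.Nat.sum_antidiagonal_eq_sum_range_succ_mk] at h1
  simp only [PowerSeries.coeff_mk] at h1
  rw [show n + A + B + 1 = A + B + 1 + n by ring, ← Nat.choose_symm_add (a := A + B + 1)]
  have : ∑ a ∈ Finset.range (n + 1), (((n - a + A).choose A * (a + B).choose B : ℕ) : ℤ) =
      ((A + B + 1 + n).choose (A + B + 1) : ℕ) := by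
    rw [← h1]
    refine Finset.sum_congr rfl fun a _ => ?_
    rw [add_comm (n - a), add_comm a]
    push_cast
    ring
  exact_mod_cast this

/-- At the highest weight `m = j`, Van der Waerden's sum has a single term. -/
lemma vdwSum_highest (n A B a : ℕ) (ha : a ≤ n) : vdwSum n A B a (a + B) =
    (-1) ^ a * (1 / (a.factorial * (n - a).factorial * A.factorial * B.factorial)) := by
  rw [vdwSum, Finset.sum_eq_single a]
  · rw [show (a : ℤ) - a = (0 : ℕ) by simp, show (a : ℤ) + B - a = B by ring,
      show (A : ℤ) - a + a = A by ring, show (B : ℤ) - (a + B) + a = (0 : ℕ) by push_cast; ring,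
      show (n : ℤ) - a = ((n - a : ℕ) : ℤ) by omega]
    simp only [invFact_natCast, Nat.factorial_zero, Nat.cast_one, div_one, mul_one]
    field_simp
  · intro z _ hz
    rcases lt_or_gt_of_ne hz with h | h
    · rw [invFact_of_neg (show (B : ℤ) - (a + B) + z < 0 by omega)]; ring
    · rw [invFact_of_neg (show (a : ℤ) - z < 0 by omega)]; ring
  · intro h
    exact absurd (Finset.mem_range.2 (by omega)) h

lemma vdwInner_highest (n A B : ℕ) : vdwInner n A B n A B (-B) =
    (n + A + B + 1).choose n / (A.factorial * B.factorial) := by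
  rw [vdwInner, ← sum_choose_mul_choose, Nat.cast_sum, Finset.sum_div,
    ← Finset.sum_subset (Finset.range_mono (show n + 1 ≤ n + A + 1 by omega))]
  · refine Finset.sum_congr rfl fun a ha => ?_
    have ha : a ≤ n := by simpa [Nat.lt_succ_iff] using ha
    rw [sub_neg_eq_add, vdwSum_highest n A B a ha, weightFact_natCast (by omega),
      ← Nat.cast_add, weightFact_natCast (by omega), show n + A - a = n - a + A by omega,
      show n + B - (a + B) = n - a by omega, Nat.cast_mul,
      Nat.cast_choose ℝ (show A ≤ n - a + A by omega), Nat.add_sub_cancel,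
      Nat.cast_choose ℝ (show B ≤ a + B by omega), Nat.add_sub_cancel]
    have hs : ((-1 : ℝ) ^ a) * (-1) ^ a = 1 := by rw [← mul_pow]; norm_num
    have hf : ∀ n : ℕ, (n.factorial : ℝ) ≠ 0 := fun n => by positivity
    have := hf a; have := hf (n - a); have := hf A; have := hf B
    field_simp
    linear_combination hs
  · intro a _ ha
    rw [weightFact_of_not (J := n + B)]
    · ring
    · simp only [Finset.mem_range] at ha
      push_cast
      omega

/-- The norm of a coupled vector, by lowering from the highest weight. -/
lemma vdwInner_self (n A B : ℕ) (δ : ℤ) (h0 : δ ≤ A) (h1 : -δ ≤ B) :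
    weightFact (A + B) (A - δ) * vdwInner n A B n A B δ =
      (A + B).factorial * ((n + A + B + 1).choose n / (A.factorial * B.factorial)) := by
  obtain ⟨i, rfl⟩ : ∃ i : ℕ, δ = -B + i := ⟨(δ + B).toNat, by omega⟩
  induction i with
  | zero =>
    rw [Nat.cast_zero, add_zero, vdwInner_highest, sub_neg_eq_add, ← Nat.cast_add,
      weightFact_natCast le_rfl, Nat.sub_self, Nat.factorial_zero, Nat.cast_one, mul_one]
  | succ i ih =>
    rw [← ih (by omega) (by omega)]
    have h := vdwInner_ladder (n := n) (A := A) (B := B) (n' := n) (A' := A) (B' := B) rfl rfl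
      (-B + i)
    have hw := weightFact_succ (J := A + B) (a := A - (-B + (i + 1 : ℕ))) (by omega) (by omega)
    rw [show (A : ℤ) - (-B + (i + 1 : ℕ)) + 1 = A - (-B + i) by push_cast; ring] at hw
    rw [show -(B : ℤ) + (i + 1 : ℕ) = -B + i + 1 by push_cast; ring] at hw ⊢
    have hi : (i : ℝ) + 1 ≠ 0 := by positivity
    apply mul_left_cancel₀ hi
    push_cast at h hw
    linear_combination (-weightFact (A + B) (A - (-B + i + 1))) * h
      + vdwInner n A B n A B (-B + i) * hw

/-! ### Orthogonality of the Clebsch–Gordan coefficients of `SU(2)` -/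

lemma Triangle.exists_eq {J₁ J₂ J : ℕ} (h : Triangle J₁ J₂ J) :
    ∃ n A B : ℕ, J₁ = n + A ∧ J₂ = n + B ∧ J = A + B := by
  obtain ⟨h1, h2, t, ht⟩ := h
  rw [abs_le] at h1
  refine ⟨t.toNat, J₁ - t.toNat, J₂ - t.toNat, ?_, ?_, ?_⟩ <;> omega

lemma triangle_add (n A B : ℕ) : Triangle (n + A) (n + B) (A + B) := by
  refine ⟨by rw [abs_le]; omega, by omega, n, by push_cast; ring⟩

lemma Triangle.swap {J₁ J₂ J : ℕ} (h : Triangle J₁ J₂ J) : Triangle J J₂ J₁ := by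
  obtain ⟨n, A, B, rfl, rfl, rfl⟩ := h.exists_eq
  rw [show A + B = B + A by ring, show n + B = B + n by ring, show n + A = A + n by ring]
  exact triangle_add B A n

/-- The factor of the Clebsch–Gordan coefficients that depends on the spins only. -/
def cgNorm (n A B : ℕ) : ℝ :=
  Real.sqrt (((A : ℝ) + B + 1) *
    (n.factorial * A.factorial * B.factorial / (n + A + B + 1).factorial))

lemma clebschGordan_of_not {J₁ J₂ J : ℕ} {M₁ M₂ M : ℤ}
    (h : ¬ (IsWeight J₁ M₁ ∧ IsWeight J₂ M₂ ∧ IsWeight J M ∧ Triangle J₁ J₂ J ∧ M = M₁ + M₂)) :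
    clebschGordan J₁ M₁ J₂ M₂ J M = 0 := by
  rw [clebschGordan, if_neg h]

lemma isWeight_sub_two_mul {J : ℕ} {a : ℤ} : IsWeight J ((J : ℤ) - 2 * a) ↔ 0 ≤ a ∧ a ≤ J := by
  rw [IsWeight, abs_le]
  exact ⟨fun h => by omega, fun h => ⟨by omega, a, by ring⟩⟩

lemma clebschGordan_eq (n A B : ℕ) (a b : ℤ) :
    clebschGordan (n + A) (((n + A : ℕ) : ℤ) - 2 * a) (n + B) (2 * b - ((n + B : ℕ) : ℤ)) (A + B)
        ((A : ℤ) - B - 2 * a + 2 * b) =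
      cgNorm n A B * Real.sqrt (weightFact (n + A) a * weightFact (n + B) b *
        weightFact (A + B) (A - a + b)) * vdwSum n A B a b := by
  have w2 : IsWeight (n + B) (2 * b - ((n + B : ℕ) : ℤ)) ↔ 0 ≤ b ∧ b ≤ (n + B : ℕ) := by
    rw [← isWeight_neg, neg_sub, isWeight_sub_two_mul]
  have w3 : IsWeight (A + B) ((A : ℤ) - B - 2 * a + 2 * b) ↔
      0 ≤ A - a + b ∧ A - a + b ≤ (A + B : ℕ) := by
    rw [← isWeight_neg, ← isWeight_sub_two_mul]
    push_cast
    rw [show -((A : ℤ) - B - 2 * a + 2 * b) = A + B - 2 * (A - a + b) by ring]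
  by_cases h : (0 ≤ a ∧ a ≤ (n + A : ℕ)) ∧ (0 ≤ b ∧ b ≤ (n + B : ℕ)) ∧
      (0 ≤ A - a + b ∧ A - a + b ≤ (A + B : ℕ))
  · rw [clebschGordan, if_pos ⟨isWeight_sub_two_mul.2 h.1, w2.2 h.2.1, w3.2 h.2.2,
      triangle_add n A B, by push_cast; ring⟩]
    rw [weightFact, if_pos h.1, weightFact, if_pos h.2.1, weightFact, if_pos h.2.2, cgNorm, vdwSum]
    have e1 : (((n + A : ℕ) : ℤ) + ((n + B : ℕ) : ℤ) - ((A + B : ℕ) : ℤ)) / 2 = n := by omega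
    have e2 : (((n + A : ℕ) : ℤ) - ((n + B : ℕ) : ℤ) + ((A + B : ℕ) : ℤ)) / 2 = A := by omega
    have e3 : (((n + B : ℕ) : ℤ) - ((n + A : ℕ) : ℤ) + ((A + B : ℕ) : ℤ)) / 2 = B := by omega
    have e4 : (((n + A : ℕ) : ℤ) + ((n + B : ℕ) : ℤ) + ((A + B : ℕ) : ℤ)) / 2 + 1 =
      ((n + A + B + 1 : ℕ) : ℤ) := by omega
    have f1 : (((n + A : ℕ) : ℤ) + (((n + A : ℕ) : ℤ) - 2 * a)) / 2 = ((n + A : ℕ) : ℤ) - a := by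
      omega
    have f2 : (((n + A : ℕ) : ℤ) - (((n + A : ℕ) : ℤ) - 2 * a)) / 2 = a := by omega
    have f3 : (((n + B : ℕ) : ℤ) + (2 * b - ((n + B : ℕ) : ℤ))) / 2 = b := by omega
    have f4 : (((n + B : ℕ) : ℤ) - (2 * b - ((n + B : ℕ) : ℤ))) / 2 = ((n + B : ℕ) : ℤ) - b := by
      omega
    have f5 : (((A + B : ℕ) : ℤ) + ((A : ℤ) - B - 2 * a + 2 * b)) / 2 = A - a + b := by omega
    have f6 : (((A + B : ℕ) : ℤ) - ((A : ℤ) - B - 2 * a + 2 * b)) / 2 =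
      ((A + B : ℕ) : ℤ) - (A - a + b) := by omega
    have f7 : (((A + B : ℕ) : ℤ) - ((n + B : ℕ) : ℤ) + (((n + A : ℕ) : ℤ) - 2 * a)) / 2 = A - a := by
      omega
    have f8 : (((A + B : ℕ) : ℤ) - ((n + A : ℕ) : ℤ) - (2 * b - ((n + B : ℕ) : ℤ))) / 2 = B - b := by
      omega
    rw [e1, e2, e3, e4, f1, f2, f3, f4, f5, f6, f7, f8]
    simp only [Int.toNat_natCast]
    congr 2
    · push_cast; rfl
    · congr 1; ring
  · rw [clebschGordan_of_not]
    · have : weightFact (n + A) a * weightFact (n + B) b * weightFact (A + B) (A - a + b) = 0 := by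
        by_cases h1 : 0 ≤ a ∧ a ≤ (n + A : ℕ)
        · by_cases h2 : 0 ≤ b ∧ b ≤ (n + B : ℕ)
          · rw [weightFact_of_not (J := A + B) (fun h3 => h ⟨h1, h2, h3⟩), mul_zero]
          · rw [weightFact_of_not h2]; ring
        · rw [weightFact_of_not h1]; ring
      rw [this, Real.sqrt_zero]; ring
    · rintro ⟨h1, h2, h3, -, -⟩
      exact h ⟨isWeight_sub_two_mul.1 h1, w2.1 h2, w3.1 h3⟩

/-- The coupled vectors of the same weight are orthonormal. -/
lemma sum_clebschGordan_mul {J₁ J₂ J J' : ℕ} {M : ℤ} (hT : Triangle J₁ J₂ J)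
    (hT' : Triangle J₁ J₂ J') (hM : IsWeight J M) (hM' : IsWeight J' M) :
    ∑ M₁ ∈ weights J₁, clebschGordan J₁ M₁ J₂ (M - M₁) J M *
      clebschGordan J₁ M₁ J₂ (M - M₁) J' M = if J = J' then 1 else 0 := by
  obtain ⟨n, A, B, rfl, rfl, rfl⟩ := hT.exists_eq
  obtain ⟨n', A', B', h1, h2, rfl⟩ := hT'.exists_eq
  obtain ⟨δ, rfl⟩ : ∃ δ : ℤ, M = A - B - 2 * δ := by
    obtain ⟨-, t, ht⟩ := hM
    exact ⟨t - B, by push_cast at ht; omega⟩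
  have b1 : δ ≤ A ∧ -δ ≤ B := by
    have := (abs_le.1 hM.1); push_cast at this; omega
  have b2 : δ ≤ A' ∧ -δ ≤ B' := by
    have := (abs_le.1 hM'.1); push_cast at this; omega
  have hterm : ∀ a : ℕ, clebschGordan (n + A) (((n + A : ℕ) : ℤ) - 2 * a) (n + B)
        (A - B - 2 * δ - (((n + A : ℕ) : ℤ) - 2 * a)) (A + B) (A - B - 2 * δ) *
      clebschGordan (n + A) (((n + A : ℕ) : ℤ) - 2 * a) (n + B)
        (A - B - 2 * δ - (((n + A : ℕ) : ℤ) - 2 * a)) (A' + B') (A - B - 2 * δ) =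
      cgNorm n A B * cgNorm n' A' B' * (Real.sqrt (weightFact (A + B) (A - δ)) *
        Real.sqrt (weightFact (A' + B') (A' - δ))) *
      (weightFact (n + A) a * weightFact (n + B) (a - δ) *
        (vdwSum n A B a (a - δ) * vdwSum n' A' B' a (a - δ))) := by
    intro a
    have c1 := clebschGordan_eq n A B a (a - δ)
    have c2 := clebschGordan_eq n' A' B' a (a - δ)
    rw [← h1, ← h2] at c2
    rw [show 2 * ((a : ℤ) - δ) - ((n + B : ℕ) : ℤ) =
        A - B - 2 * δ - (((n + A : ℕ) : ℤ) - 2 * a) by push_cast; ring] at c1 c2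
    rw [show (A : ℤ) - B - 2 * a + 2 * (a - δ) = A - B - 2 * δ by ring,
      show (A : ℤ) - a + (a - δ) = A - δ by ring] at c1
    rw [show (A' : ℤ) - B' - 2 * a + 2 * (a - δ) = A - B - 2 * δ by omega,
      show (A' : ℤ) - a + (a - δ) = A' - δ by ring] at c2
    have p1 := weightFact_nonneg (n + A) a
    have p2 := weightFact_nonneg (n + B) (a - δ)
    rw [c1, c2, Real.sqrt_mul (mul_nonneg p1 p2), Real.sqrt_mul (mul_nonneg p1 p2)]
    have := Real.mul_self_sqrt (mul_nonneg p1 p2)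
    linear_combination cgNorm n A B * cgNorm n' A' B' * (Real.sqrt (weightFact (A + B) (A - δ)) *
        Real.sqrt (weightFact (A' + B') (A' - δ))) *
        (vdwSum n A B a (a - δ) * vdwSum n' A' B' a (a - δ)) * this
  rw [sum_weights, ← Finset.sum_range_reflect]
  have hk : ∀ k ∈ Finset.range (n + A + 1),
      2 * ((n + A + 1 - 1 - k : ℕ) : ℤ) - ((n + A : ℕ) : ℤ) = ((n + A : ℕ) : ℤ) - 2 * k := by
    intro k hk
    have := Finset.mem_range.1 hk
    omega
  rw [Finset.sum_congr rfl fun k hk' => by rw [hk k hk', hterm], ← Finset.mul_sum]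
  change _ * vdwInner n A B n' A' B' δ = _
  split_ifs with hJ
  · obtain rfl : n = n' := by omega
    obtain rfl : A = A' := by omega
    obtain rfl : B = B' := by omega
    rw [Real.mul_self_sqrt (weightFact_nonneg _ _), mul_assoc, vdwInner_self n A B δ b1.1 b1.2,
      cgNorm, Real.mul_self_sqrt (by positivity), Nat.cast_choose ℝ (show n ≤ n + A + B + 1 by omega),
      show n + A + B + 1 - n = A + B + 1 by omega, Nat.factorial_succ (A + B)]
    have hf : ∀ n : ℕ, (n.factorial : ℝ) ≠ 0 := fun n => by positivity
    have := hf n; have := hf A; have := hf B; have := hf (A + B); have := hf (n + A + B + 1)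
    have : (A : ℝ) + B + 1 ≠ 0 := by positivity
    push_cast
    field_simp
  · have : vdwInner n A B n' A' B' δ = 0 := by
      rcases lt_trichotomy n n' with h | h | h
      · obtain ⟨d, rfl⟩ : ∃ d, n' = n + d := ⟨n' - n, by omega⟩
        obtain rfl : A = A' + d := by omega
        obtain rfl : B = B' + d := by omega
        rw [vdwInner_comm (by ring) (by ring)]
        exact vdwInner_eq_zero (by omega) b2.1 b2.2
      · exact absurd (by omega) hJ
      · obtain ⟨d, rfl⟩ : ∃ d, n = n' + d := ⟨n - n', by omega⟩
        obtain rfl : A' = A + d := by omega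
        obtain rfl : B' = B + d := by omega
        exact vdwInner_eq_zero (by omega) b1.1 b1.2
    rw [this, mul_zero]

open Classical in
/-- The spins `j` in `V_{j₁} ⊗ V_{j₂}` that have a given weight. -/
def coupledSpins (J₁ J₂ : ℕ) (M : ℤ) : Finset ℕ :=
  (Finset.range (J₁ + J₂ + 1)).filter fun J => Triangle J₁ J₂ J ∧ IsWeight J M

lemma mem_coupledSpins {J₁ J₂ J : ℕ} {M : ℤ} :
    J ∈ coupledSpins J₁ J₂ M ↔ Triangle J₁ J₂ J ∧ IsWeight J M := by
  classical
  rw [coupledSpins, Finset.mem_filter, Finset.mem_range, Nat.lt_succ_iff]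
  exact ⟨fun h => h.2, fun h => ⟨h.1.2.1, h⟩⟩

open Classical in
/-- The weights `m₁` of `V_{j₁}` for which `m - m₁` is a weight of `V_{j₂}`. -/
def coupledWeights (J₁ J₂ : ℕ) (M : ℤ) : Finset ℤ :=
  (weights J₁).filter fun M₁ => IsWeight J₂ (M - M₁)

lemma mem_coupledWeights {J₁ J₂ : ℕ} {M M₁ : ℤ} :
    M₁ ∈ coupledWeights J₁ J₂ M ↔ IsWeight J₁ M₁ ∧ IsWeight J₂ (M - M₁) := by
  classical
  rw [coupledWeights, Finset.mem_filter, mem_weights]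

lemma card_coupledSpins (J₁ J₂ : ℕ) (M : ℤ) (hM : Even ((J₁ : ℤ) + J₂ - M)) :
    (coupledSpins J₁ J₂ M).card = (coupledWeights J₁ J₂ M).card := by
  obtain ⟨t, ht⟩ := hM
  -- both sets are progressions of step two of the same length; shift one onto the other
  refine Finset.card_nbij'
    (fun J => (J : ℤ) - max |(J₁ : ℤ) - J₂| |M| + max (-(J₁ : ℤ)) (M - J₂))
    (fun M₁ => (M₁ + max |(J₁ : ℤ) - J₂| |M| - max (-(J₁ : ℤ)) (M - J₂)).toNat) ?_ ?_ ?_ ?_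
  · intro J hJ
    obtain ⟨⟨h1, h2, s, hs⟩, h3, r, hr⟩ := mem_coupledSpins.1 hJ
    refine mem_coupledWeights.2 ⟨⟨?_, ?_⟩, ?_, ?_⟩
    · rw [abs_le]; simp only [abs_eq_max_neg] at *; omega
    · rw [Int.even_iff]; simp only [abs_eq_max_neg] at *; omega
    · rw [abs_le]; simp only [abs_eq_max_neg] at *; omega
    · rw [Int.even_iff]; simp only [abs_eq_max_neg] at *; omega
  · intro M₁ hM₁
    obtain ⟨⟨h1, s, hs⟩, h3, r, hr⟩ := mem_coupledWeights.1 hM₁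
    refine mem_coupledSpins.2 ⟨⟨?_, ?_, ?_⟩, ?_, ?_⟩
    · simp only [abs_eq_max_neg] at *; omega
    · simp only [abs_eq_max_neg] at *; omega
    · rw [Int.even_iff]; simp only [abs_eq_max_neg] at *; omega
    · simp only [abs_eq_max_neg] at *; omega
    · rw [Int.even_iff]; simp only [abs_eq_max_neg] at *; omega
  · intro J hJ
    simp only
    omega
  · intro M₁ hM₁
    obtain ⟨⟨h1, s, hs⟩, h3, r, hr⟩ := mem_coupledWeights.1 hM₁
    simp only [abs_eq_max_neg] at *; omega

/-- The coupled vectors span: the square matrix of Clebsch–Gordan coefficients with orthonormal rows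
has orthonormal columns. -/
lemma sum_coupledSpins_clebschGordan_mul {J₁ J₂ : ℕ} {M M₁ M₁' : ℤ} (h1 : IsWeight J₁ M₁)
    (h2 : IsWeight J₂ (M - M₁)) (h1' : IsWeight J₁ M₁') (h2' : IsWeight J₂ (M - M₁')) :
    ∑ J ∈ coupledSpins J₁ J₂ M, clebschGordan J₁ M₁ J₂ (M - M₁) J M *
      clebschGordan J₁ M₁' J₂ (M - M₁') J M = if M₁ = M₁' then 1 else 0 := by
  obtain ⟨U, hUa⟩ : ∃ U : Matrix (coupledSpins J₁ J₂ M) (coupledWeights J₁ J₂ M) ℝ,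
      ∀ J m, U J m = clebschGordan J₁ m J₂ (M - m) J M := ⟨Matrix.of _, fun _ _ => rfl⟩
  have hcard : Fintype.card (coupledSpins J₁ J₂ M) = Fintype.card (coupledWeights J₁ J₂ M) := by
    rw [Fintype.card_coe, Fintype.card_coe]
    refine card_coupledSpins J₁ J₂ M ?_
    rw [show (J₁ : ℤ) + J₂ - M = (J₁ - M₁) + (J₂ - (M - M₁)) by ring]
    exact h1.2.add h2.2
  have hU : U * U.transpose = 1 := by
    ext J J'
    obtain ⟨hT, hJ⟩ := mem_coupledSpins.1 J.2
    obtain ⟨hT', hJ'⟩ := mem_coupledSpins.1 J'.2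
    have h := sum_clebschGordan_mul hT hT' hJ hJ'
    rw [Matrix.mul_apply, Matrix.one_apply]
    simp only [Subtype.ext_iff]
    rw [← h]
    simp only [Matrix.transpose_apply, hUa]
    rw [Finset.sum_coe_sort (coupledWeights J₁ J₂ M) fun m =>
      clebschGordan J₁ m J₂ (M - m) J M * clebschGordan J₁ m J₂ (M - m) J' M]
    refine Finset.sum_subset (fun m hm => mem_weights.2 (mem_coupledWeights.1 hm).1) fun m hm hm' => ?_
    rw [clebschGordan_of_not, zero_mul]
    rintro ⟨a1, a2, -⟩
    exact hm' (mem_coupledWeights.2 ⟨a1, a2⟩)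
  have hU' := (Matrix.mul_eq_one_comm_of_equiv (Fintype.equivOfCardEq hcard)).1 hU
  have := congrFun (congrFun hU' ⟨M₁, mem_coupledWeights.2 ⟨h1, h2⟩⟩)
    ⟨M₁', mem_coupledWeights.2 ⟨h1', h2'⟩⟩
  rw [Matrix.mul_apply, Matrix.one_apply] at this
  simp only [Subtype.mk.injEq] at this
  rw [← this]
  simp only [Matrix.transpose_apply, hUa]
  rw [Finset.sum_coe_sort (coupledSpins J₁ J₂ M) fun J =>
    clebschGordan J₁ M₁ J₂ (M - M₁) J M * clebschGordan J₁ M₁' J₂ (M - M₁') J M]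

/-- The substitution `z ↦ b - z` in Van der Waerden's sum, which exchanges `j₁` and `j`. -/
lemma vdwSum_exchange (n A B : ℕ) (a : ℤ) (b : ℕ) :
    vdwSum n A B a b = (-1) ^ b * vdwSum B A n (A - a + b) b := by
  have ext : ∀ (n A B : ℕ) (a : ℤ), vdwSum n A B a b = ∑ z ∈ Finset.range (b + 1),
      (-1 : ℝ) ^ z * invFact z * invFact ((n : ℤ) - z) * invFact (a - z) * invFact (b - z) *
        invFact ((A : ℤ) - a + z) * invFact ((B : ℤ) - b + z) := by
    intro n A B a
    rw [vdwSum, ← Finset.sum_subset (Finset.range_mono (show min n b + 1 ≤ n + 1 by omega)),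
      ← Finset.sum_subset (Finset.range_mono (show min n b + 1 ≤ b + 1 by omega))]
    · intro z hz hz'
      simp only [Finset.mem_range] at hz hz'
      rw [invFact_of_neg (show (n : ℤ) - z < 0 by omega)]; ring
    · intro z hz hz'
      simp only [Finset.mem_range] at hz hz'
      rw [invFact_of_neg (show (b : ℤ) - z < 0 by omega)]; ring
  rw [ext, ext, ← Finset.sum_range_reflect, Finset.mul_sum]
  refine Finset.sum_congr rfl fun z hz => ?_
  have hz : z ≤ b := by simpa [Nat.lt_succ_iff] using hz
  rw [Nat.add_sub_cancel]
  have hs : (-1 : ℝ) ^ b = (-1) ^ (b - z) * (-1) ^ z := by rw [← pow_add, Nat.sub_add_cancel hz]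
  have hs' : (-1 : ℝ) ^ z * (-1) ^ z = 1 := by rw [← mul_pow]; norm_num
  rw [hs, Nat.cast_sub hz, show (b : ℤ) - (b - z) = z by ring,
    show (A : ℤ) - (A - a + b) + z = a - (b - z) by ring,
    show (A : ℤ) - a + b - z = A - a + (b - z) by ring,
    show (B : ℤ) - b + (b - z) = B - z by ring, show (n : ℤ) - b + z = n - (b - z) by ring]
  linear_combination (-((-1 : ℝ) ^ (b - z) * invFact (b - z) * invFact (n - (b - z)) *
    invFact (a - (b - z)) * invFact z * invFact (A - a + (b - z)) * invFact (B - z))) * hs'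

/-- The symmetry of the Clebsch–Gordan coefficients that exchanges `j₁` and `j`. -/
lemma clebschGordan_exchange {J₁ J₂ J : ℕ} {M₁ M₂ M : ℤ} (hT : Triangle J₁ J₂ J)
    (h2 : IsWeight J₂ M₂) (hM₁ : IsWeight J₁ M₁) (hM : M = M₁ + M₂) :
    Real.sqrt ((J₁ : ℝ) + 1) * clebschGordan J₁ M₁ J₂ M₂ J M =
      (-1) ^ ((J₂ + M₂) / 2).toNat * Real.sqrt ((J : ℝ) + 1) *
        clebschGordan J (-M) J₂ M₂ J₁ (-M₁) := by
  obtain ⟨n, A, B, rfl, rfl, rfl⟩ := hT.exists_eq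
  obtain ⟨b, hb, rfl⟩ := isWeight_iff.1 h2
  obtain ⟨a, rfl⟩ : ∃ a : ℤ, M₁ = ((n + A : ℕ) : ℤ) - 2 * a := by
    obtain ⟨-, t, ht⟩ := hM₁
    exact ⟨t, by omega⟩
  subst hM
  have c1 := clebschGordan_eq n A B a b
  have c2 := clebschGordan_eq B A n (A - a + b) b
  rw [show (((B + A : ℕ) : ℤ)) - 2 * (A - a + b) =
    -(((n + A : ℕ) : ℤ) - 2 * a + (2 * (b : ℤ) - ((n + B : ℕ) : ℤ))) by push_cast; ring,
    show (A : ℤ) - n - 2 * (A - a + b) + 2 * b = -(((n + A : ℕ) : ℤ) - 2 * a) by push_cast; ring,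
    show (A : ℤ) - (A - a + b) + b = a by ring, show B + A = A + B by ring,
    show B + n = n + B by ring, show A + n = n + A by ring] at c2
  rw [show (A : ℤ) - B - 2 * a + 2 * b =
    ((n + A : ℕ) : ℤ) - 2 * a + (2 * (b : ℤ) - ((n + B : ℕ) : ℤ)) by push_cast; ring] at c1
  have e : ((((n + B : ℕ) : ℤ) + (2 * (b : ℤ) - ((n + B : ℕ) : ℤ))) / 2).toNat = b := by omega
  rw [c1, c2, e, vdwSum_exchange n A B a b]
  have hn : Real.sqrt (((n + A : ℕ) : ℝ) + 1) * cgNorm n A B =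
      Real.sqrt (((A + B : ℕ) : ℝ) + 1) * cgNorm B A n := by
    rw [cgNorm, cgNorm, ← Real.sqrt_mul (by positivity), ← Real.sqrt_mul (by positivity),
      show B + A + n + 1 = n + A + B + 1 by ring]
    congr 1
    push_cast
    ring
  rw [show weightFact (A + B) (A - a + b) * weightFact (n + B) b * weightFact (n + A) a =
    weightFact (n + A) a * weightFact (n + B) b * weightFact (A + B) (A - a + b) by ring]
  linear_combination Real.sqrt (weightFact (n + A) a * weightFact (n + B) b *
    weightFact (A + B) (A - a + b)) * ((-1) ^ b * vdwSum B A n (A - a + b) b) * hn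

/-- Orthogonality of the Clebsch–Gordan coefficients in the first spin. -/
lemma sum_clebschGordan_mul_exchange {J₁ J₁' J₂ J : ℕ} {N : ℤ} (hT : Triangle J₁ J₂ J)
    (hT' : Triangle J₁' J₂ J) (hN : IsWeight J₁ N) (hN' : IsWeight J₁' N) :
    ∑ Q ∈ weights J, clebschGordan J₁ N J₂ (Q - N) J Q * clebschGordan J₁' N J₂ (Q - N) J Q =
      if J₁ = J₁' then ((J : ℝ) + 1) / ((J₁ : ℝ) + 1) else 0 := by
  have h := sum_clebschGordan_mul hT.swap hT'.swap (isWeight_neg.2 hN) (isWeight_neg.2 hN')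
  have hneg : ∑ Q ∈ weights J, clebschGordan J Q J₂ (-N - Q) J₁ (-N) *
        clebschGordan J Q J₂ (-N - Q) J₁' (-N) =
      ∑ Q ∈ weights J, clebschGordan J (-Q) J₂ (Q - N) J₁ (-N) *
        clebschGordan J (-Q) J₂ (Q - N) J₁' (-N) := by
    refine Finset.sum_nbij' (fun Q => -Q) (fun Q => -Q) ?_ ?_ ?_ ?_ ?_
    · exact fun Q hQ => mem_weights.2 (isWeight_neg.2 (mem_weights.1 hQ))
    · exact fun Q hQ => mem_weights.2 (isWeight_neg.2 (mem_weights.1 hQ))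
    · exact fun Q _ => neg_neg Q
    · exact fun Q _ => neg_neg Q
    · intro Q _
      rw [neg_neg, show -Q - N = -N - Q by ring]
  rw [hneg] at h
  have hterm : ∀ Q ∈ weights J, Real.sqrt ((J₁ : ℝ) + 1) * Real.sqrt ((J₁' : ℝ) + 1) *
      (clebschGordan J₁ N J₂ (Q - N) J Q * clebschGordan J₁' N J₂ (Q - N) J Q) =
      ((J : ℝ) + 1) * (clebschGordan J (-Q) J₂ (Q - N) J₁ (-N) *
        clebschGordan J (-Q) J₂ (Q - N) J₁' (-N)) := by
    intro Q _
    by_cases h2 : IsWeight J₂ (Q - N)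
    · have e1 := clebschGordan_exchange hT h2 hN (show Q = N + (Q - N) by ring)
      have e2 := clebschGordan_exchange hT' h2 hN' (show Q = N + (Q - N) by ring)
      have hs : ((-1 : ℝ) ^ ((J₂ + (Q - N)) / 2).toNat) * (-1) ^ ((J₂ + (Q - N)) / 2).toNat = 1 := by
        rw [← mul_pow]; norm_num
      have hq := Real.mul_self_sqrt (show (0 : ℝ) ≤ (J : ℝ) + 1 by positivity)
      rw [mul_mul_mul_comm, e1, e2]
      linear_combination (clebschGordan J (-Q) J₂ (Q - N) J₁ (-N) *
        clebschGordan J (-Q) J₂ (Q - N) J₁' (-N)) * (hq +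
        Real.sqrt ((J : ℝ) + 1) * Real.sqrt ((J : ℝ) + 1) * hs)
    · rw [clebschGordan_of_not (fun h => h2 h.2.1),
        clebschGordan_of_not (J₁ := J) (J := J₁) (fun h => h2 h.2.1)]
      ring
  have hp : ∀ n : ℕ, Real.sqrt ((n : ℝ) + 1) ≠ 0 := fun n => (Real.sqrt_pos.2 (by positivity)).ne'
  apply mul_left_cancel₀ (mul_ne_zero (hp J₁) (hp J₁'))
  rw [Finset.mul_sum, Finset.sum_congr rfl hterm, ← Finset.mul_sum, h]
  split_ifs with hJ
  · subst hJ
    rw [Real.mul_self_sqrt (by positivity)]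
    have : (J₁ : ℝ) + 1 ≠ 0 := by positivity
    field_simp
  · ring

/-! ### Conjugation in `SU(2)` and admissible choices -/

lemma su2_inv_apply (u : SU2) (i l : Fin 2) : (u⁻¹).1 i l = star (u.1 l i) := rfl

lemma su2_star_eq_adjugate (u : SU2) : star u.1 = u.1.adjugate := by
  obtain ⟨h1, h2⟩ := Matrix.mem_specialUnitaryGroup_iff.1 u.2
  have h3 := Matrix.mem_unitaryGroup_iff.1 h1
  calc star u.1 = u.1.adjugate * u.1 * star u.1 := by rw [Matrix.adjugate_mul, h2, one_smul, one_mul]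
    _ = u.1.adjugate := by rw [mul_assoc, h3, mul_one]

lemma su2_one_one (u : SU2) : u.1 1 1 = star (u.1 0 0) := by
  have := congrFun (congrFun (su2_star_eq_adjugate u) 0) 0
  rw [Matrix.star_apply, Matrix.adjugate_fin_two] at this
  simpa using this.symm

lemma su2_one_zero (u : SU2) : u.1 1 0 = -star (u.1 0 1) := by
  have := congrFun (congrFun (su2_star_eq_adjugate u) 1) 0
  rw [Matrix.star_apply, Matrix.adjugate_fin_two] at this
  rw [this]
  simp

/-- An element of `SU(2)` is determined by its first row. -/
lemma su2_ext {u v : SU2} (h0 : u.1 0 0 = v.1 0 0) (h1 : u.1 0 1 = v.1 0 1) : u = v := by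
  apply Subtype.ext
  ext i l
  fin_cases i <;> fin_cases l
  · exact h0
  · exact h1
  · exact (su2_one_zero u).trans ((congrArg (fun z => -star z) h1).trans (su2_one_zero v).symm)
  · exact (su2_one_one u).trans ((congrArg star h0).trans (su2_one_one v).symm)

lemma gDiag_mul_gDiag (φ ψ : ℝ) : gDiag φ * gDiag ψ = gDiag (φ + ψ) := by
  refine su2_ext ?_ ?_
  · rw [su2_mul_apply]
    simp only [gDiag_zero_zero, gDiag_zero_one, zero_mul, add_zero, ← Complex.exp_add]
    congr 1
    push_cast
    ring
  · simp [su2_mul_apply]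

lemma gDiag_zero : gDiag 0 = 1 := by
  have h : gDiag 0 * gDiag 0 = gDiag 0 := by rw [gDiag_mul_gDiag, add_zero]
  exact mul_eq_right.1 h

lemma gDiag_comm (φ ψ : ℝ) : gDiag φ * gDiag ψ = gDiag ψ * gDiag φ := by
  rw [gDiag_mul_gDiag, gDiag_mul_gDiag, add_comm]

lemma exp_I_mul_half (r : ℝ) :
    Complex.exp (Complex.I * (r / 2)) = Real.cos (r / 2) + Complex.I * Real.sin (r / 2) := by
  rw [mul_comm, Complex.exp_mul_I]
  push_cast
  ring

lemma exp_neg_I_mul_half (r : ℝ) :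
    Complex.exp (-(Complex.I * (r / 2))) = Real.cos (r / 2) - Complex.I * Real.sin (r / 2) := by
  rw [← mul_neg, mul_comm, Complex.exp_mul_I, Complex.cos_neg, Complex.sin_neg]
  push_cast
  ring

lemma aRot_conj_zero_zero (θ r : ℝ) : (aRot θ * gDiag r * (aRot θ)⁻¹).1 0 0 =
    Real.cos (r / 2) + Complex.I * (Real.sin (r / 2) * Real.cos θ : ℝ) := by
  simp only [su2_mul_apply, su2_inv_apply, aRot_zero_zero, aRot_zero_one, gDiag_zero_zero,
    gDiag_zero_one, gDiag_one_zero, gDiag_one_one, exp_I_mul_half, exp_neg_I_mul_half, star_neg]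
  have hst : ∀ x : ℝ, star (x : ℂ) = x := fun x => Complex.conj_ofReal x
  have h1 : ((Real.cos (θ / 2) : ℂ)) ^ 2 + (Real.sin (θ / 2) : ℂ) ^ 2 = 1 := by
    exact_mod_cast Real.cos_sq_add_sin_sq (θ / 2)
  rw [hst, hst, cos_eq_half θ]
  push_cast at h1 ⊢
  linear_combination (Complex.cos (r / 2)) * h1

lemma aRot_conj_zero_one (θ r : ℝ) : (aRot θ * gDiag r * (aRot θ)⁻¹).1 0 1 =
    Complex.I * (Real.sin (r / 2) * Real.sin θ : ℝ) := by
  simp only [su2_mul_apply, su2_inv_apply, aRot_zero_zero, aRot_zero_one, aRot_one_zero,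
    aRot_one_one, gDiag_zero_zero, gDiag_zero_one, gDiag_one_zero, gDiag_one_one, exp_I_mul_half,
    exp_neg_I_mul_half]
  have hst : ∀ x : ℝ, star (x : ℂ) = x := fun x => Complex.conj_ofReal x
  rw [hst, hst, sin_eq_half θ]
  push_cast
  ring

lemma gDiag_conj_zero_zero (φ : ℝ) (k : SU2) : (gDiag φ * k * (gDiag φ)⁻¹).1 0 0 = k.1 0 0 := by
  simp only [su2_mul_apply, su2_inv_apply, gDiag_zero_zero, gDiag_zero_one, star_zero,
    star_exp_I_mul]
  have : Complex.exp (Complex.I * (φ / 2)) * Complex.exp (-(Complex.I * (φ / 2))) = 1 := by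
    rw [← Complex.exp_add, add_neg_cancel, Complex.exp_zero]
  linear_combination k.1 0 0 * this

lemma gDiag_conj_zero_one (φ : ℝ) (k : SU2) :
    (gDiag φ * k * (gDiag φ)⁻¹).1 0 1 = Complex.exp (Complex.I * φ) * k.1 0 1 := by
  simp only [su2_mul_apply, su2_inv_apply, gDiag_zero_zero, gDiag_zero_one, gDiag_one_zero,
    gDiag_one_one, star_zero]
  have h : star (Complex.exp (-(Complex.I * (φ / 2)))) = Complex.exp (Complex.I * (φ / 2)) := by
    rw [← star_exp_I_mul, star_star]
  have h2 : Complex.exp (Complex.I * φ) =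
      Complex.exp (Complex.I * (φ / 2)) * Complex.exp (Complex.I * (φ / 2)) := by
    rw [← Complex.exp_add]; ring_nf
  rw [h, h2]
  ring

lemma sin_half_pos {r : ℝ} (hr : r ∈ Set.Ioo 0 (2 * Real.pi)) : 0 < Real.sin (r / 2) :=
  Real.sin_pos_of_pos_of_lt_pi (by linarith [hr.1]) (by linarith [hr.2])

lemma sin_lam_half_nonneg (r₁ r₂ θ : ℝ) : 0 ≤ Real.sin (lam r₁ r₂ θ / 2) := by
  rw [lam, mul_div_cancel_left₀ _ two_ne_zero, Real.sin_arccos]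
  exact Real.sqrt_nonneg _

/-- `1 - cos² (r₃ / 2)` is the square of the length of the vector that defines `n̂_w`. -/
lemma lam_identity (r₁ r₂ θ : ℝ) :
    (Real.sin (r₁ / 2) * Real.cos (r₂ / 2) +
        Real.cos θ * Real.cos (r₁ / 2) * Real.sin (r₂ / 2)) ^ 2 +
      (Real.sin θ * Real.cos (r₁ / 2) * Real.sin (r₂ / 2)) ^ 2 +
      (Real.sin θ * Real.sin (r₁ / 2) * Real.sin (r₂ / 2)) ^ 2 =
    1 - (Real.cos (r₁ / 2) * Real.cos (r₂ / 2) -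
      Real.cos θ * Real.sin (r₁ / 2) * Real.sin (r₂ / 2)) ^ 2 := by
  have h1 := Real.sin_sq_add_cos_sq (r₁ / 2)
  have h2 := Real.sin_sq_add_cos_sq (r₂ / 2)
  have h3 := Real.sin_sq_add_cos_sq θ
  set s1 := Real.sin (r₁ / 2)
  set c1 := Real.cos (r₁ / 2)
  set s2 := Real.sin (r₂ / 2)
  set c2 := Real.cos (r₂ / 2)
  set s := Real.sin θ
  set c := Real.cos θ
  linear_combination (s1 ^ 2 + c1 ^ 2) * s2 ^ 2 * h3 + (c2 ^ 2 + s2 ^ 2) * h1 + h2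

lemma lam_arg_mem (r₁ r₂ θ : ℝ) :
    Real.cos (r₁ / 2) * Real.cos (r₂ / 2) - Real.cos θ * Real.sin (r₁ / 2) * Real.sin (r₂ / 2) ∈
      Set.Icc (-1 : ℝ) 1 := by
  have h := lam_identity r₁ r₂ θ
  rw [Set.mem_Icc, ← abs_le, ← sq_le_one_iff_abs_le_one]
  nlinarith [sq_nonneg (Real.sin (r₁ / 2) * Real.cos (r₂ / 2) +
        Real.cos θ * Real.cos (r₁ / 2) * Real.sin (r₂ / 2)),
      sq_nonneg (Real.sin θ * Real.cos (r₁ / 2) * Real.sin (r₂ / 2)),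
      sq_nonneg (Real.sin θ * Real.sin (r₁ / 2) * Real.sin (r₂ / 2))]

lemma cos_lam_half (r₁ r₂ θ : ℝ) : Real.cos (lam r₁ r₂ θ / 2) =
    Real.cos (r₁ / 2) * Real.cos (r₂ / 2) -
      Real.cos θ * Real.sin (r₁ / 2) * Real.sin (r₂ / 2) := by
  obtain ⟨h1, h2⟩ := lam_arg_mem r₁ r₂ θ
  rw [lam, mul_div_cancel_left₀ _ two_ne_zero, Real.cos_arccos h1 h2]

lemma sin_lam_half_sq (r₁ r₂ θ : ℝ) : Real.sin (lam r₁ r₂ θ / 2) ^ 2 =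
    (Real.sin (r₁ / 2) * Real.cos (r₂ / 2) +
        Real.cos θ * Real.cos (r₁ / 2) * Real.sin (r₂ / 2)) ^ 2 +
      (Real.sin θ * Real.cos (r₁ / 2) * Real.sin (r₂ / 2)) ^ 2 +
      (Real.sin θ * Real.sin (r₁ / 2) * Real.sin (r₂ / 2)) ^ 2 := by
  rw [lam_identity, ← cos_lam_half, Real.sin_sq]

lemma sin_lam_half_pos {r₁ r₂ θ : ℝ} (hr₁ : r₁ ∈ Set.Ioo 0 (2 * Real.pi))
    (hr₂ : r₂ ∈ Set.Ioo 0 (2 * Real.pi)) (hθ : θ ∈ Set.Ioo 0 Real.pi) :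
    0 < Real.sin (lam r₁ r₂ θ / 2) := by
  have h := sin_lam_half_sq r₁ r₂ θ
  have hz : 0 < Real.sin θ * Real.sin (r₁ / 2) * Real.sin (r₂ / 2) :=
    mul_pos (mul_pos (Real.sin_pos_of_pos_of_lt_pi hθ.1 hθ.2) (sin_half_pos hr₁)) (sin_half_pos hr₂)
  refine lt_of_le_of_ne (sin_lam_half_nonneg _ _ _) fun h0 => ?_
  rw [← h0] at h
  nlinarith [sq_nonneg (Real.sin (r₁ / 2) * Real.cos (r₂ / 2) +
        Real.cos θ * Real.cos (r₁ / 2) * Real.sin (r₂ / 2)),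
      sq_nonneg (Real.sin θ * Real.cos (r₁ / 2) * Real.sin (r₂ / 2)), mul_pos hz hz]

/-- The spherical coordinates of `n̂_w`, multiplied by `sin (r₃ / 2)` so as to include the degenerate
case `sin (r₃ / 2) = 0`. -/
lemma spherical_coordinates_nHat (r₁ r₂ θ : ℝ) :
    Real.sin (lam r₁ r₂ θ / 2) * Real.cos (Real.arccos (nHat r₁ r₂ θ 0)) =
      Real.sin (r₁ / 2) * Real.cos (r₂ / 2) +
        Real.cos θ * Real.cos (r₁ / 2) * Real.sin (r₂ / 2) ∧
    Complex.exp (Complex.I * (Complex.arg ⟨nHat r₁ r₂ θ 1, nHat r₁ r₂ θ 2⟩ : ℝ)) *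
        (Real.sin (lam r₁ r₂ θ / 2) * Real.sin (Real.arccos (nHat r₁ r₂ θ 0)) : ℝ) =
      (Real.sin θ * Real.cos (r₁ / 2) * Real.sin (r₂ / 2) : ℝ) +
        Complex.I * (Real.sin θ * Real.sin (r₁ / 2) * Real.sin (r₂ / 2) : ℝ) := by
  have hS := sin_lam_half_sq r₁ r₂ θ
  have hS0 := sin_lam_half_nonneg r₁ r₂ θ
  have n0 : nHat r₁ r₂ θ 0 = (Real.sin (r₁ / 2) * Real.cos (r₂ / 2) +
      Real.cos θ * Real.cos (r₁ / 2) * Real.sin (r₂ / 2)) / Real.sin (lam r₁ r₂ θ / 2) := by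
    simp [nHat, div_eq_inv_mul]
  have n1 : nHat r₁ r₂ θ 1 =
      Real.sin θ * Real.cos (r₁ / 2) * Real.sin (r₂ / 2) / Real.sin (lam r₁ r₂ θ / 2) := by
    simp [nHat, div_eq_inv_mul]
  have n2 : nHat r₁ r₂ θ 2 =
      Real.sin θ * Real.sin (r₁ / 2) * Real.sin (r₂ / 2) / Real.sin (lam r₁ r₂ θ / 2) := by
    simp [nHat, div_eq_inv_mul]
  set S := Real.sin (lam r₁ r₂ θ / 2)
  set x := Real.sin (r₁ / 2) * Real.cos (r₂ / 2) +
        Real.cos θ * Real.cos (r₁ / 2) * Real.sin (r₂ / 2)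
  set y := Real.sin θ * Real.cos (r₁ / 2) * Real.sin (r₂ / 2)
  set z := Real.sin θ * Real.sin (r₁ / 2) * Real.sin (r₂ / 2)
  rcases hS0.eq_or_lt with h0 | hpos
  · rw [← h0] at hS ⊢
    have hx : x = 0 := by nlinarith [sq_nonneg x, sq_nonneg y, sq_nonneg z]
    have hy : y = 0 := by nlinarith [sq_nonneg x, sq_nonneg y, sq_nonneg z]
    have hz : z = 0 := by nlinarith [sq_nonneg x, sq_nonneg y, sq_nonneg z]
    simp [hx, hy, hz]
  · have hsum : nHat r₁ r₂ θ 1 ^ 2 + nHat r₁ r₂ θ 2 ^ 2 = 1 - nHat r₁ r₂ θ 0 ^ 2 := by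
      rw [n0, n1, n2]
      field_simp
      linarith
    have hx1 : nHat r₁ r₂ θ 0 ^ 2 ≤ 1 := by
      nlinarith [sq_nonneg (nHat r₁ r₂ θ 1), sq_nonneg (nHat r₁ r₂ θ 2)]
    have habs := abs_le.1 (sq_le_one_iff_abs_le_one _ |>.1 hx1)
    constructor
    · rw [Real.cos_arccos habs.1 habs.2, n0]
      field_simp
    · have hn : Real.sin (Real.arccos (nHat r₁ r₂ θ 0)) =
          ‖(⟨nHat r₁ r₂ θ 1, nHat r₁ r₂ θ 2⟩ : ℂ)‖ := by
        rw [Real.sin_arccos, ← hsum, Complex.norm_eq_sqrt_sq_add_sq]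
      have hz := Complex.norm_mul_exp_arg_mul_I (⟨nHat r₁ r₂ θ 1, nHat r₁ r₂ θ 2⟩ : ℂ)
      rw [hn, Complex.ofReal_mul, mul_left_comm, mul_comm (Complex.exp _), mul_comm Complex.I, hz,
        Complex.mk_eq_add_mul_I, n1, n2]
      have : (S : ℂ) ≠ 0 := by exact_mod_cast hpos.ne'
      push_cast
      field_simp

lemma wExplicit_conj (r₁ r₂ θ : ℝ) :
    gDiag r₁ * aRot θ * gDiag r₂ * (aRot θ)⁻¹ =
      wExplicit r₁ r₂ θ * gDiag (lam r₁ r₂ θ) * (wExplicit r₁ r₂ θ)⁻¹ := by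
  obtain ⟨h1, h2⟩ := spherical_coordinates_nHat r₁ r₂ θ
  have hc := cos_lam_half r₁ r₂ θ
  rw [wExplicit]
  set t := Real.arccos (nHat r₁ r₂ θ 0)
  set φ := Complex.arg ⟨nHat r₁ r₂ θ 1, nHat r₁ r₂ θ 2⟩
  have e1 : gDiag φ * aRot t * gDiag (lam r₁ r₂ θ) * (gDiag φ * aRot t)⁻¹ =
      gDiag φ * (aRot t * gDiag (lam r₁ r₂ θ) * (aRot t)⁻¹) * (gDiag φ)⁻¹ := by group
  have e2 : gDiag r₁ * aRot θ * gDiag r₂ * (aRot θ)⁻¹ =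
      gDiag r₁ * (aRot θ * gDiag r₂ * (aRot θ)⁻¹) := by group
  have hI := Complex.I_sq
  rw [e1, e2]
  refine su2_ext ?_ ?_
  · rw [gDiag_conj_zero_zero, aRot_conj_zero_zero, su2_mul_apply, aRot_conj_zero_zero,
      gDiag_zero_zero, gDiag_zero_one, exp_I_mul_half, h1, hc]
    push_cast
    linear_combination Complex.sin (r₁ / 2) * Complex.sin (r₂ / 2) * Complex.cos θ * hI
  · rw [gDiag_conj_zero_one, aRot_conj_zero_one, su2_mul_apply, aRot_conj_zero_one,
      gDiag_zero_zero, gDiag_zero_one, exp_I_mul_half]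
    push_cast at h2 ⊢
    linear_combination (-Complex.I) * h2

/-- Conjugating both sides of the admissibility equation. -/
lemma admissible_equation_change {r₁ r₂ r₃ : ℝ} {y w : SU2}
    (h : gDiag r₁ * y * gDiag r₂ * y⁻¹ = w * gDiag r₃ * w⁻¹) (φ ψ ζ : ℝ) :
    gDiag r₁ * (gDiag φ * y * gDiag ψ) * gDiag r₂ * (gDiag φ * y * gDiag ψ)⁻¹ =
      (gDiag φ * w * gDiag ζ) * gDiag r₃ * (gDiag φ * w * gDiag ζ)⁻¹ := by
  have h1 : gDiag r₁ * (gDiag φ * y * gDiag ψ) * gDiag r₂ * (gDiag φ * y * gDiag ψ)⁻¹ =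
      (gDiag r₁ * gDiag φ) * y * (gDiag ψ * gDiag r₂) * (gDiag ψ)⁻¹ * y⁻¹ * (gDiag φ)⁻¹ := by group
  have h2 : (gDiag φ * w * gDiag ζ) * gDiag r₃ * (gDiag φ * w * gDiag ζ)⁻¹ =
      gDiag φ * w * (gDiag ζ * gDiag r₃) * (gDiag ζ)⁻¹ * w⁻¹ * (gDiag φ)⁻¹ := by group
  rw [h1, h2, gDiag_comm r₁, gDiag_comm ψ, gDiag_comm ζ]
  calc gDiag φ * gDiag r₁ * y * (gDiag r₂ * gDiag ψ) * (gDiag ψ)⁻¹ * y⁻¹ * (gDiag φ)⁻¹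
      = gDiag φ * (gDiag r₁ * y * gDiag r₂ * y⁻¹) * (gDiag φ)⁻¹ := by group
    _ = gDiag φ * (w * gDiag r₃ * w⁻¹) * (gDiag φ)⁻¹ := by rw [h]
    _ = _ := by group

lemma isAdmissible_explicit (r₁ r₂ : ℝ) : IsAdmissible r₁ r₂ aRot (wExplicit r₁ r₂) := by
  refine fun θ _ => ⟨⟨0, 0, ?_⟩, wExplicit_conj r₁ r₂ θ⟩
  rw [gDiag_zero, one_mul, mul_one]

lemma IsAdmissible.change {r₁ r₂ : ℝ} {y w : ℝ → SU2} (h : IsAdmissible r₁ r₂ y w)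
    (φ ψ ζ : ℝ → ℝ) : IsAdmissible r₁ r₂ (fun θ => gDiag (φ θ) * y θ * gDiag (ψ θ))
      (fun θ => gDiag (φ θ) * w θ * gDiag (ζ θ)) := by
  intro θ hθ
  obtain ⟨⟨α, β, hy⟩, he⟩ := h θ hθ
  refine ⟨⟨φ θ + α, β + ψ θ, ?_⟩, admissible_equation_change he _ _ _⟩
  simp only [hy, ← gDiag_mul_gDiag]
  group

/-- The centraliser of a non-central `g_r` is `U(1)`. -/
lemma exists_eq_gDiag_of_commute {r : ℝ} (hr : Real.sin (r / 2) ≠ 0) {u : SU2}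
    (h : u * gDiag r = gDiag r * u) : ∃ ζ : ℝ, u = gDiag ζ := by
  have h01 : u.1 0 1 = 0 := by
    have h1 := congrArg (fun v : SU2 => v.1 0 1) h
    simp only [su2_mul_apply, gDiag_zero_zero, gDiag_zero_one, gDiag_one_one, mul_zero, zero_add,
      zero_mul, add_zero, exp_I_mul_half, exp_neg_I_mul_half] at h1
    have h2 : (2 * Complex.I * (Real.sin (r / 2) : ℂ)) * u.1 0 1 = 0 := by linear_combination -h1
    refine (mul_eq_zero.1 h2).resolve_left ?_
    have : (Real.sin (r / 2) : ℂ) ≠ 0 := by exact_mod_cast hr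
    exact mul_ne_zero (mul_ne_zero two_ne_zero Complex.I_ne_zero) this
  have hnorm : ‖u.1 0 0‖ = 1 := by
    have h1 := su2_rows u 0 0
    rw [h01, zero_mul, add_zero, if_pos rfl] at h1
    have h2 := congrArg norm h1
    rw [norm_mul, norm_star, norm_one] at h2
    nlinarith [norm_nonneg (u.1 0 0)]
  refine ⟨2 * Complex.arg (u.1 0 0), su2_ext ?_ ?_⟩
  · have h1 := Complex.norm_mul_exp_arg_mul_I (u.1 0 0)
    rw [hnorm, Complex.ofReal_one, one_mul] at h1
    rw [gDiag_zero_zero, ← h1, h1]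
    conv_lhs => rw [← h1]
    congr 1
    push_cast
    ring
  · rw [h01, gDiag_zero_one]

lemma IsAdmissible.exists_change {r₁ r₂ : ℝ} (hr₁ : r₁ ∈ Set.Ioo 0 (2 * Real.pi))
    (hr₂ : r₂ ∈ Set.Ioo 0 (2 * Real.pi)) {y w : ℝ → SU2} (h : IsAdmissible r₁ r₂ y w) :
    ∃ φ ψ ζ : ℝ → ℝ, ∀ θ ∈ Set.Ioo 0 Real.pi,
      y θ = gDiag (φ θ) * aRot θ * gDiag (ψ θ) ∧
        w θ = gDiag (φ θ) * wExplicit r₁ r₂ θ * gDiag (ζ θ) := by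
  have key : ∀ θ, ∃ φ ψ ζ : ℝ, θ ∈ Set.Ioo 0 Real.pi →
      y θ = gDiag φ * aRot θ * gDiag ψ ∧ w θ = gDiag φ * wExplicit r₁ r₂ θ * gDiag ζ := by
    intro θ
    by_cases hθ : θ ∈ Set.Ioo 0 Real.pi
    · obtain ⟨⟨φ, ψ, hy⟩, he⟩ := h θ (Set.Ioo_subset_Icc_self hθ)
      have he' := admissible_equation_change (wExplicit_conj r₁ r₂ θ) φ ψ 0
      rw [← hy, he, gDiag_zero, mul_one] at he'
      -- both elements conjugate `g_{r₃}` to the same element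
      have hc : ((gDiag φ * wExplicit r₁ r₂ θ)⁻¹ * w θ) * gDiag (lam r₁ r₂ θ) =
          gDiag (lam r₁ r₂ θ) * ((gDiag φ * wExplicit r₁ r₂ θ)⁻¹ * w θ) := by
        calc _ = (gDiag φ * wExplicit r₁ r₂ θ)⁻¹ * (w θ * gDiag (lam r₁ r₂ θ) * (w θ)⁻¹) * w θ := by
              group
          _ = _ := by rw [he']; group
      obtain ⟨ζ, hζ⟩ := exists_eq_gDiag_of_commute (sin_lam_half_pos hr₁ hr₂ hθ).ne' hc
      exact ⟨φ, ψ, ζ, fun _ => ⟨hy, by rw [← hζ]; group⟩⟩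
    · exact ⟨0, 0, 0, fun hh => absurd hh hθ⟩
  choose φ ψ ζ hh using key
  exact ⟨φ, ψ, ζ, hh⟩

lemma cgValue_change (N₁ : ℤ) (J₁ : ℕ) (M₁ N₂ : ℤ) (J₂ : ℕ) (M₂ N₃ : ℤ) (J : ℕ) (M : ℤ)
    (y w : SU2) (φ ψ ζ : ℝ) :
    cgValue N₁ J₁ M₁ N₂ J₂ M₂ N₃ J M (gDiag φ * y * gDiag ψ) (gDiag φ * w * gDiag ζ) =
      Complex.exp (Complex.I * ((N₁ / 2 : ℂ) * φ - (N₂ / 2 : ℂ) * ψ + (N₃ / 2 : ℂ) * ζ)) *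
        cgValue N₁ J₁ M₁ N₂ J₂ M₂ N₃ J M y w := by
  rw [cgValue, cgValue, Finset.mul_sum]
  refine Finset.sum_congr rfl fun P _ => ?_
  have hst : star (Complex.exp (-(Complex.I * ((((N₁ + P : ℤ) : ℂ) / 2) * φ + (N₃ / 2 : ℂ) * ζ)))) =
      Complex.exp (Complex.I * ((((N₁ + P : ℤ) : ℂ) / 2) * φ + (N₃ / 2 : ℂ) * ζ)) := by
    change (starRingEnd ℂ) _ = _
    rw [← Complex.exp_conj]
    simp only [map_neg, map_mul, map_add, map_div₀, Complex.conj_I, Complex.conj_ofReal,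
      Complex.conj_ofNat, map_intCast]
    congr 1
    ring
  have hexp : Complex.exp (Complex.I * ((N₁ / 2 : ℂ) * φ - (N₂ / 2 : ℂ) * ψ + (N₃ / 2 : ℂ) * ζ)) =
      Complex.exp (-(Complex.I * ((P / 2 : ℂ) * φ + (N₂ / 2 : ℂ) * ψ))) *
        Complex.exp (Complex.I * ((((N₁ + P : ℤ) : ℂ) / 2) * φ + (N₃ / 2 : ℂ) * ζ)) := by
    rw [← Complex.exp_add]
    congr 1
    push_cast
    ring
  rw [wignerD_gDiag_mul_gDiag, wignerD_gDiag_mul_gDiag, star_mul', hst, hexp]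
  ring

/-! ### The change of variables `r₃ = λ(θ)` -/

lemma lam_mem (r₁ r₂ θ : ℝ) : lam r₁ r₂ θ / 2 ∈ Set.Icc 0 Real.pi := by
  rw [lam, mul_div_cancel_left₀ _ two_ne_zero]
  exact ⟨Real.arccos_nonneg _, Real.arccos_le_pi _⟩

lemma injOn_lam {r₁ r₂ : ℝ} (hr₁ : r₁ ∈ Set.Ioo 0 (2 * Real.pi))
    (hr₂ : r₂ ∈ Set.Ioo 0 (2 * Real.pi)) : Set.InjOn (lam r₁ r₂) (Set.Icc 0 Real.pi) := by
  intro θ hθ θ' hθ' h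
  have h1 := congrArg (fun r => Real.cos (r / 2)) h
  simp only [cos_lam_half] at h1
  have hs := mul_pos (sin_half_pos hr₁) (sin_half_pos hr₂)
  refine Real.injOn_cos hθ hθ' ?_
  apply mul_right_cancel₀ hs.ne'
  linear_combination -h1

lemma lamInv_lam {r₁ r₂ θ : ℝ} (hr₁ : r₁ ∈ Set.Ioo 0 (2 * Real.pi))
    (hr₂ : r₂ ∈ Set.Ioo 0 (2 * Real.pi)) (hθ : θ ∈ Set.Icc 0 Real.pi) :
    lamInv r₁ r₂ (lam r₁ r₂ θ) = θ :=
  (injOn_lam hr₁ hr₂).leftInvOn_invFunOn hθ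

lemma image_lam {r₁ r₂ : ℝ} (hr₁ : r₁ ∈ Set.Ioo 0 (2 * Real.pi))
    (hr₂ : r₂ ∈ Set.Ioo 0 (2 * Real.pi)) : lam r₁ r₂ '' Set.Ioo 0 Real.pi =
      Set.Ioo |r₁ - r₂| (min (r₁ + r₂) (4 * Real.pi - (r₁ + r₂))) := by
  have hs := mul_pos (sin_half_pos hr₁) (sin_half_pos hr₂)
  have hp : Real.cos ((r₁ + r₂) / 2) =
      Real.cos (r₁ / 2) * Real.cos (r₂ / 2) - Real.sin (r₁ / 2) * Real.sin (r₂ / 2) := by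
    rw [add_div, Real.cos_add]
  have hm : Real.cos (|r₁ - r₂| / 2) =
      Real.cos (r₁ / 2) * Real.cos (r₂ / 2) + Real.sin (r₁ / 2) * Real.sin (r₂ / 2) := by
    rw [← Real.cos_sub, ← Real.cos_abs (r₁ / 2 - r₂ / 2), ← sub_div, abs_div, abs_two]
  have hp' : Real.cos ((4 * Real.pi - (r₁ + r₂)) / 2) = Real.cos ((r₁ + r₂) / 2) := by
    rw [show (4 * Real.pi - (r₁ + r₂)) / 2 = 2 * Real.pi - (r₁ + r₂) / 2 by ring,
      Real.cos_two_pi_sub]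
  have hr₁' := hr₁.1
  have hr₁'' := hr₁.2
  have hr₂' := hr₂.1
  have hr₂'' := hr₂.2
  have habs : |r₁ - r₂| ≤ 2 * Real.pi := abs_le.2 ⟨by linarith, by linarith⟩
  ext r
  constructor
  · rintro ⟨θ, hθ, rfl⟩
    have h := cos_lam_half r₁ r₂ θ
    obtain ⟨l0, l1⟩ := lam_mem r₁ r₂ θ
    have hc1 : Real.cos θ < 1 := by
      rw [← Real.cos_zero]
      exact Real.cos_lt_cos_of_nonneg_of_le_pi le_rfl hθ.2.le hθ.1
    have hc2 : -1 < Real.cos θ := by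
      rw [← Real.cos_pi]
      exact Real.cos_lt_cos_of_nonneg_of_le_pi hθ.1.le le_rfl hθ.2
    refine ⟨?_, lt_min ?_ ?_⟩
    · by_contra! hle
      have := Real.cos_le_cos_of_nonneg_of_le_pi l0 (by linarith : |r₁ - r₂| / 2 ≤ Real.pi)
        (by linarith)
      rw [hm, h] at this
      nlinarith
    · by_contra! hle
      have := Real.cos_le_cos_of_nonneg_of_le_pi (by linarith : 0 ≤ (r₁ + r₂) / 2) l1 (by linarith)
      rw [hp, h] at this
      nlinarith
    · by_contra! hle
      have := Real.cos_le_cos_of_nonneg_of_le_pi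
        (by linarith : 0 ≤ (4 * Real.pi - (r₁ + r₂)) / 2) l1 (by linarith)
      rw [hp', hp, h] at this
      nlinarith
  · rintro ⟨h1, h2⟩
    obtain ⟨h2, h3⟩ := lt_min_iff.1 h2
    have h0 : 0 ≤ |r₁ - r₂| := abs_nonneg _
    have hle : r / 2 ≤ Real.pi := by linarith
    have k1 := Real.cos_lt_cos_of_nonneg_of_le_pi (by linarith : 0 ≤ |r₁ - r₂| / 2) hle
      (by linarith)
    have k2 : Real.cos ((r₁ + r₂) / 2) < Real.cos (r / 2) := by
      rcases le_total ((r₁ + r₂) / 2) Real.pi with h | h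
      · exact Real.cos_lt_cos_of_nonneg_of_le_pi (by linarith) h (by linarith)
      · rw [← hp']
        exact Real.cos_lt_cos_of_nonneg_of_le_pi (by linarith) (by linarith) (by linarith)
    rw [hm] at k1
    rw [hp] at k2
    set x := (Real.cos (r₁ / 2) * Real.cos (r₂ / 2) - Real.cos (r / 2)) /
      (Real.sin (r₁ / 2) * Real.sin (r₂ / 2)) with hx
    have x1 : x < 1 := by rw [hx, div_lt_one hs]; linarith
    have x2 : -1 < x := by rw [hx, lt_div_iff₀ hs]; linarith
    refine ⟨Real.arccos x, ⟨Real.arccos_pos.2 x1, ?_⟩, ?_⟩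
    · rw [← Real.arccos_neg_one]
      exact Real.strictAntiOn_arccos ⟨le_rfl, by norm_num⟩ ⟨x2.le, x1.le⟩ x2
    · rw [lam, Real.cos_arccos x2.le x1.le, hx, mul_assoc, div_mul_cancel₀ _ hs.ne', sub_sub_cancel,
        Real.arccos_cos (by linarith) hle]
      ring

lemma hasDerivAt_lam {r₁ r₂ θ : ℝ} (hr₁ : r₁ ∈ Set.Ioo 0 (2 * Real.pi))
    (hr₂ : r₂ ∈ Set.Ioo 0 (2 * Real.pi)) (hθ : θ ∈ Set.Ioo 0 Real.pi) :
    HasDerivAt (lam r₁ r₂) (-(2 * (Real.sin θ * Real.sin (r₁ / 2) * Real.sin (r₂ / 2)) /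
      Real.sin (lam r₁ r₂ θ / 2))) θ := by
  have hS := sin_lam_half_pos hr₁ hr₂ hθ
  have hsq := Real.sin_sq_add_cos_sq (lam r₁ r₂ θ / 2)
  have hsin : Real.sin (lam r₁ r₂ θ / 2) = Real.sqrt (1 - (Real.cos (r₁ / 2) * Real.cos (r₂ / 2) -
      Real.cos θ * Real.sin (r₁ / 2) * Real.sin (r₂ / 2)) ^ 2) := by
    rw [← Real.sin_arccos, lam, mul_div_cancel_left₀ _ two_ne_zero]
  rw [cos_lam_half] at hsq
  have hX : HasDerivAt (fun t => Real.cos (r₁ / 2) * Real.cos (r₂ / 2) -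
      Real.cos t * Real.sin (r₁ / 2) * Real.sin (r₂ / 2))
      (Real.sin θ * Real.sin (r₁ / 2) * Real.sin (r₂ / 2)) θ := by
    refine ((((Real.hasDerivAt_cos θ).mul_const _).mul_const _).const_sub _).congr_deriv ?_
    ring
  have hA := Real.hasDerivAt_arccos (x := Real.cos (r₁ / 2) * Real.cos (r₂ / 2) -
      Real.cos θ * Real.sin (r₁ / 2) * Real.sin (r₂ / 2))
    (fun h => by rw [h] at hsq; nlinarith) (fun h => by rw [h] at hsq; nlinarith)
  refine ((hA.comp θ hX).const_mul 2).congr_deriv ?_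
  rw [hsin]
  ring

/-- The density of `ν`. -/
def nuDensity (r₁ r₂ r₃ : ℝ) : ℝ :=
  Real.sin (r₃ / 2) / (4 * Real.sin (r₁ / 2) * Real.sin (r₂ / 2))

lemma measurableSet_classInterval (r₁ r₂ : ℝ) : MeasurableSet (classInterval r₁ r₂) :=
  measurableSet_Icc

lemma nu_restrict (r₁ r₂ : ℝ) : (nu r₁ r₂).restrict (classInterval r₁ r₂) =
    (volume.restrict (classInterval r₁ r₂)).withDensity
      fun r => ENNReal.ofReal (nuDensity r₁ r₂ r) := by
  have hI := measurableSet_classInterval r₁ r₂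
  rw [nu, withDensity_indicator hI, restrict_withDensity hI, Measure.restrict_restrict hI,
    Set.inter_self]
  rfl

lemma measurable_nuDensity (r₁ r₂ : ℝ) :
    Measurable fun r => ENNReal.ofReal (nuDensity r₁ r₂ r) := by
  unfold nuDensity
  fun_prop

lemma classInterval_ae_eq {r₁ r₂ : ℝ} (hr₁ : r₁ ∈ Set.Ioo 0 (2 * Real.pi))
    (hr₂ : r₂ ∈ Set.Ioo 0 (2 * Real.pi)) :
    (volume : Measure ℝ).restrict (classInterval r₁ r₂) =
      volume.restrict (lam r₁ r₂ '' Set.Ioo 0 Real.pi) := by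
  rw [image_lam hr₁ hr₂, classInterval]
  exact Measure.restrict_congr_set Ioo_ae_eq_Icc.symm

lemma abs_deriv_smul_density {r₁ r₂ θ : ℝ} (hr₁ : r₁ ∈ Set.Ioo 0 (2 * Real.pi))
    (hr₂ : r₂ ∈ Set.Ioo 0 (2 * Real.pi)) (hθ : θ ∈ Set.Ioo 0 Real.pi) (z : ℂ) :
    |-(2 * (Real.sin θ * Real.sin (r₁ / 2) * Real.sin (r₂ / 2)) / Real.sin (lam r₁ r₂ θ / 2))| •
      ((ENNReal.ofReal (nuDensity r₁ r₂ (lam r₁ r₂ θ))).toReal • z) =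
      (1 / 2 * Real.sin θ : ℝ) * z := by
  have hS := sin_lam_half_pos hr₁ hr₂ hθ
  have h1 := sin_half_pos hr₁
  have h2 := sin_half_pos hr₂
  have hs := Real.sin_pos_of_pos_of_lt_pi hθ.1 hθ.2
  rw [abs_neg, abs_of_pos (by positivity), nuDensity, ENNReal.toReal_ofReal (by positivity),
    smul_smul, Complex.real_smul]
  congr 2
  field_simp
  norm_num

/-- The substitution `r₃ = λ(θ)` turns `ν` into `½ sin θ dθ`. -/
lemma setIntegral_nu {r₁ r₂ : ℝ} (hr₁ : r₁ ∈ Set.Ioo 0 (2 * Real.pi))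
    (hr₂ : r₂ ∈ Set.Ioo 0 (2 * Real.pi)) (g : ℝ → ℂ) :
    ∫ r in classInterval r₁ r₂, g r ∂(nu r₁ r₂) =
      ∫ θ in Set.Ioo 0 Real.pi, ((1 / 2 * Real.sin θ : ℝ) : ℂ) * g (lam r₁ r₂ θ) := by
  rw [nu_restrict, integral_withDensity_eq_integral_toReal_smul (measurable_nuDensity r₁ r₂)
    (Filter.Eventually.of_forall fun _ => ENNReal.ofReal_lt_top), classInterval_ae_eq hr₁ hr₂,
    integral_image_eq_integral_abs_deriv_smul measurableSet_Ioo
      (fun θ hθ => (hasDerivAt_lam hr₁ hr₂ hθ).hasDerivWithinAt)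
      ((injOn_lam hr₁ hr₂).mono Set.Ioo_subset_Icc_self)]
  exact setIntegral_congr_fun measurableSet_Ioo fun θ hθ => abs_deriv_smul_density hr₁ hr₂ hθ _

lemma integrableOn_nu_iff {r₁ r₂ : ℝ} (hr₁ : r₁ ∈ Set.Ioo 0 (2 * Real.pi))
    (hr₂ : r₂ ∈ Set.Ioo 0 (2 * Real.pi)) (g : ℝ → ℂ) :
    IntegrableOn g (classInterval r₁ r₂) (nu r₁ r₂) ↔
      IntegrableOn (fun θ => ((1 / 2 * Real.sin θ : ℝ) : ℂ) * g (lam r₁ r₂ θ))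
        (Set.Ioo 0 Real.pi) := by
  rw [IntegrableOn, nu_restrict, integrable_withDensity_iff_integrable_smul'
    (measurable_nuDensity r₁ r₂) (Filter.Eventually.of_forall fun _ => ENNReal.ofReal_lt_top),
    classInterval_ae_eq hr₁ hr₂, ← IntegrableOn,
    integrableOn_image_iff_integrableOn_abs_deriv_smul measurableSet_Ioo
      (fun θ hθ => (hasDerivAt_lam hr₁ hr₂ hθ).hasDerivWithinAt)
      ((injOn_lam hr₁ hr₂).mono Set.Ioo_subset_Icc_self)]
  exact integrableOn_congr_fun (fun θ hθ => abs_deriv_smul_density hr₁ hr₂ hθ _) measurableSet_Ioo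

/-! ### Measurability and boundedness of the coefficients of the explicit choice -/

lemma measurable_aRot (i l : Fin 2) : Measurable fun θ => (aRot θ).1 i l := by
  fin_cases i <;> fin_cases l <;>
    simp only [Fin.zero_eta, Fin.mk_one, Fin.isValue, aRot_zero_zero, aRot_zero_one, aRot_one_zero,
      aRot_one_one] <;> fun_prop

lemma measurable_gDiag (i l : Fin 2) : Measurable fun φ => (gDiag φ).1 i l := by
  fin_cases i <;> fin_cases l <;>
    simp only [Fin.zero_eta, Fin.mk_one, Fin.isValue, gDiag_zero_zero, gDiag_zero_one,
      gDiag_one_zero, gDiag_one_one] <;> fun_prop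

lemma measurable_lam (r₁ r₂ : ℝ) : Measurable (lam r₁ r₂) := by
  unfold lam
  exact (Real.continuous_arccos.measurable.comp (by fun_prop)).const_mul 2

lemma measurable_nHat (r₁ r₂ : ℝ) (i : Fin 3) : Measurable fun θ => nHat r₁ r₂ θ i := by
  have hl := measurable_lam r₁ r₂
  have h : Measurable fun θ => 1 / Real.sin (lam r₁ r₂ θ / 2) :=
    ((Real.measurable_sin.comp (hl.div_const 2))).const_div 1
  simp only [nHat, Pi.smul_apply, smul_eq_mul]
  refine h.mul ?_
  fin_cases i <;> simp <;> fun_prop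

lemma measurable_wExplicit (r₁ r₂ : ℝ) (i l : Fin 2) :
    Measurable fun θ => (wExplicit r₁ r₂ θ).1 i l := by
  have hn := measurable_nHat r₁ r₂
  have harg : Measurable fun θ => Complex.arg ⟨nHat r₁ r₂ θ 1, nHat r₁ r₂ θ 2⟩ := by
    simp only [Complex.mk_eq_add_mul_I]
    exact Complex.measurable_arg.comp ((Complex.measurable_ofReal.comp (hn 1)).add
      ((Complex.measurable_ofReal.comp (hn 2)).mul_const _))
  have hacos : Measurable fun θ => Real.arccos (nHat r₁ r₂ θ 0) :=
    Real.continuous_arccos.measurable.comp (hn 0)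
  simp only [wExplicit, su2_mul_apply]
  exact (((measurable_gDiag _ _).comp harg).mul ((measurable_aRot _ _).comp hacos)).add
    (((measurable_gDiag _ _).comp harg).mul ((measurable_aRot _ _).comp hacos))

lemma measurable_cgValue (r₁ r₂ : ℝ) (N₁ : ℤ) (J₁ : ℕ) (M₁ N₂ : ℤ) (J₂ : ℕ) (M₂ N₃ : ℤ) (J : ℕ)
    (M : ℤ) : Measurable fun θ =>
      cgValue N₁ J₁ M₁ N₂ J₂ M₂ N₃ J M (aRot θ) (wExplicit r₁ r₂ θ) := by
  unfold cgValue
  refine Finset.measurable_sum _ fun P _ => ?_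
  exact ((measurable_wignerD measurable_aRot J₂ P N₂).const_mul _).mul
    (continuous_star.measurable.comp (measurable_wignerD (measurable_wExplicit r₁ r₂) J (N₁ + P) N₃))

lemma exists_norm_cgValue_le (N₁ : ℤ) (J₁ : ℕ) (M₁ N₂ : ℤ) (J₂ : ℕ) (M₂ N₃ : ℤ) (J : ℕ) (M : ℤ) :
    ∃ K : ℝ, ∀ y w : SU2, ‖cgValue N₁ J₁ M₁ N₂ J₂ M₂ N₃ J M y w‖ ≤ K := by
  refine ⟨_, fun y w => norm_sum_le_of_le _ (n := fun P =>
    ‖(clebschGordan J₁ M₁ J₂ M₂ J M : ℂ) * (clebschGordan J₁ N₁ J₂ P J (N₁ + P) : ℂ)‖)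
    fun P _ => ?_⟩
  rw [norm_mul, norm_mul _ (wignerD J₂ P N₂ y), norm_star, mul_assoc]
  refine mul_le_of_le_one_right (norm_nonneg _) ?_
  exact mul_le_one₀ (norm_wignerD_le_one _ _ _ _) (norm_nonneg _) (norm_wignerD_le_one _ _ _ _)

lemma integrableOn_cgValue_mul_star (r₁ r₂ : ℝ) (N₁ N₂ : ℤ) (J₁ J₂ J₁' J₂' : ℕ) (M₁ M₂ M₁' M₂' : ℤ)
    (J : ℕ) (M N₃ : ℤ) : IntegrableOn (fun θ => ((1 / 2 * Real.sin θ : ℝ) : ℂ) *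
      (cgValue N₁ J₁ M₁ N₂ J₂ M₂ N₃ J M (aRot θ) (wExplicit r₁ r₂ θ) *
        star (cgValue N₁ J₁' M₁' N₂ J₂' M₂' N₃ J M (aRot θ) (wExplicit r₁ r₂ θ))))
      (Set.Ioo 0 Real.pi) := by
  obtain ⟨K, hK⟩ := exists_norm_cgValue_le N₁ J₁ M₁ N₂ J₂ M₂ N₃ J M
  obtain ⟨K', hK'⟩ := exists_norm_cgValue_le N₁ J₁' M₁' N₂ J₂' M₂' N₃ J M
  refine Measure.integrableOn_of_bounded (M := 1 * (K * K')) (by simp) ?_ ?_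
  · refine Measurable.aestronglyMeasurable ?_
    exact (by fun_prop : Measurable fun θ : ℝ => ((1 / 2 * Real.sin θ : ℝ) : ℂ)).mul
      ((measurable_cgValue _ _ _ _ _ _ _ _ _ _ _).mul
        (continuous_star.measurable.comp (measurable_cgValue _ _ _ _ _ _ _ _ _ _ _)))
  · refine Filter.Eventually.of_forall fun θ => ?_
    have h1 : ‖((1 / 2 * Real.sin θ : ℝ) : ℂ)‖ ≤ 1 := by
      rw [Complex.norm_real, Real.norm_eq_abs, abs_mul]
      have := Real.abs_sin_le_one θ
      rw [abs_of_pos (by norm_num : (0 : ℝ) < 1 / 2)]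
      linarith
    rw [norm_mul, norm_mul, norm_star]
    have h0 := (norm_nonneg _).trans (hK (aRot θ) (wExplicit r₁ r₂ θ))
    exact mul_le_mul h1 (mul_le_mul (hK _ _) (hK' _ _) (norm_nonneg _) h0) (by positivity)
      zero_le_one

/-! ### The orthogonality relations -/

/-- The sum over `p` as a sum over the weights `n₁ + p` of the spin `j` representation. -/
lemma cgValue_eq_sum_weights (N₁ : ℤ) (J₁ : ℕ) (M₁ N₂ : ℤ) (J₂ : ℕ) (M₂ N₃ : ℤ) (J : ℕ) (M : ℤ)
    (y w : SU2) : cgValue N₁ J₁ M₁ N₂ J₂ M₂ N₃ J M y w =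
      (clebschGordan J₁ M₁ J₂ M₂ J M : ℂ) * ∑ Q ∈ weights J,
        (clebschGordan J₁ N₁ J₂ (Q - N₁) J Q : ℂ) * wignerD J₂ (Q - N₁) N₂ y *
          star (wignerD J Q N₃ w) := by
  rw [cgValue, Finset.mul_sum]
  refine Finset.sum_bij_ne_zero (fun P _ _ => N₁ + P) ?_ ?_ ?_ ?_
  · intro P _ hP
    refine mem_weights.2 ?_
    by_contra hw
    rw [clebschGordan_of_not (fun h => hw h.2.2.1)] at hP
    simp at hP
  · intro P _ _ P' _ _ h
    exact add_left_cancel h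
  · intro Q hQ hQ0
    have h2 : IsWeight J₂ (Q - N₁) := by
      by_contra hw
      rw [clebschGordan_of_not (J₂ := J₂) (M₂ := Q - N₁) (fun h => hw h.2.1)] at hQ0
      simp at hQ0
    have h1 := abs_le.1 (mem_weights.1 hQ).1
    have h3 := abs_le.1 h2.1
    refine ⟨Q - N₁, ?_, ?_, add_sub_cancel _ _⟩
    · rw [Finset.mem_filter, Finset.mem_Icc]
      exact ⟨⟨max_le (by omega) (by omega), le_min (by omega) (by omega)⟩, h2.2⟩
    · rw [add_sub_cancel]
      simpa only [mul_assoc] using hQ0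
  · intro P _ _
    simp only [add_sub_cancel_left]
    ring

lemma cgValue_of_not_isWeight {N₁ : ℤ} {J₁ : ℕ} {M₁ N₂ : ℤ} {J₂ : ℕ} {M₂ N₃ : ℤ} {J : ℕ} {M : ℤ}
    (h : ¬ IsWeight J N₃) (y w : SU2) : cgValue N₁ J₁ M₁ N₂ J₂ M₂ N₃ J M y w = 0 := by
  refine Finset.sum_eq_zero fun P _ => ?_
  rw [wignerD_of_not J (N₁ + P) N₃ w (fun hh => h hh.2), star_zero, mul_zero]

/-- By unitarity of the Wigner functions, the sum over `n₃` eliminates `w`. -/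
lemma sum_cgValue_mul_star (N₁ N₂ : ℤ) (J₁ J₂ J₁' J₂' : ℕ) (M₁ M₂ M₁' M₂' : ℤ) (J : ℕ) (M : ℤ)
    (y w : SU2) :
    ∑ N₃ ∈ weights J, cgValue N₁ J₁ M₁ N₂ J₂ M₂ N₃ J M y w *
        star (cgValue N₁ J₁' M₁' N₂ J₂' M₂' N₃ J M y w) =
      (clebschGordan J₁ M₁ J₂ M₂ J M * clebschGordan J₁' M₁' J₂' M₂' J M : ℝ) *
        ∑ Q ∈ weights J, ((clebschGordan J₁ N₁ J₂ (Q - N₁) J Q *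
          clebschGordan J₁' N₁ J₂' (Q - N₁) J Q : ℝ) : ℂ) *
            (wignerD J₂ (Q - N₁) N₂ y * star (wignerD J₂' (Q - N₁) N₂ y)) := by
  have hst : ∀ x : ℝ, star (x : ℂ) = x := fun x => Complex.conj_ofReal x
  have expand : ∀ N₃, cgValue N₁ J₁ M₁ N₂ J₂ M₂ N₃ J M y w *
      star (cgValue N₁ J₁' M₁' N₂ J₂' M₂' N₃ J M y w) =
      (clebschGordan J₁ M₁ J₂ M₂ J M * clebschGordan J₁' M₁' J₂' M₂' J M : ℝ) *
      ∑ Q ∈ weights J, ∑ Q' ∈ weights J,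
        ((clebschGordan J₁ N₁ J₂ (Q - N₁) J Q * clebschGordan J₁' N₁ J₂' (Q' - N₁) J Q' : ℝ) : ℂ) *
          (wignerD J₂ (Q - N₁) N₂ y * star (wignerD J₂' (Q' - N₁) N₂ y)) *
          (star (wignerD J Q N₃ w) * wignerD J Q' N₃ w) := by
    intro N₃
    rw [cgValue_eq_sum_weights, cgValue_eq_sum_weights, star_mul', hst, star_sum,
      mul_mul_mul_comm, Finset.sum_mul_sum]
    push_cast
    congr 1
    refine Finset.sum_congr rfl fun Q _ => Finset.sum_congr rfl fun Q' _ => ?_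
    rw [star_mul', star_mul', hst, star_star]
    ring
  simp only [expand]
  rw [← Finset.mul_sum, Finset.sum_comm]
  congr 1
  refine Finset.sum_congr rfl fun Q hQ => ?_
  rw [Finset.sum_comm]
  have h : ∀ Q' ∈ weights J, ∑ N₃ ∈ weights J,
      ((clebschGordan J₁ N₁ J₂ (Q - N₁) J Q * clebschGordan J₁' N₁ J₂' (Q' - N₁) J Q' : ℝ) : ℂ) *
          (wignerD J₂ (Q - N₁) N₂ y * star (wignerD J₂' (Q' - N₁) N₂ y)) *
          (star (wignerD J Q N₃ w) * wignerD J Q' N₃ w) = if Q = Q' then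
      ((clebschGordan J₁ N₁ J₂ (Q - N₁) J Q * clebschGordan J₁' N₁ J₂' (Q' - N₁) J Q' : ℝ) : ℂ) *
          (wignerD J₂ (Q - N₁) N₂ y * star (wignerD J₂' (Q' - N₁) N₂ y)) else 0 := by
    intro Q' hQ'
    rw [← Finset.mul_sum, sum_wignerD_mul_star J Q Q' (mem_weights.1 hQ) (mem_weights.1 hQ')]
    split_ifs <;> ring
  rw [Finset.sum_congr rfl h, Finset.sum_ite_eq, if_pos hQ]

/-- A change of the choices does not affect the products of two coefficients with the same labels
`n₁, n₂, n₃`. -/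
lemma cgValue_mul_star_change (N₁ N₂ : ℤ) (J₁ J₂ J₁' J₂' : ℕ) (M₁ M₂ M₁' M₂' N₃ : ℤ) (J : ℕ) (M : ℤ)
    (y w : SU2) (φ ψ ζ : ℝ) :
    cgValue N₁ J₁ M₁ N₂ J₂ M₂ N₃ J M (gDiag φ * y * gDiag ψ) (gDiag φ * w * gDiag ζ) *
        star (cgValue N₁ J₁' M₁' N₂ J₂' M₂' N₃ J M (gDiag φ * y * gDiag ψ)
          (gDiag φ * w * gDiag ζ)) =
      cgValue N₁ J₁ M₁ N₂ J₂ M₂ N₃ J M y w * star (cgValue N₁ J₁' M₁' N₂ J₂' M₂' N₃ J M y w) := by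
  rw [cgValue_change, cgValue_change, star_mul']
  set e := Complex.exp (Complex.I * ((N₁ / 2 : ℂ) * φ - (N₂ / 2 : ℂ) * ψ + (N₃ / 2 : ℂ) * ζ)) with he
  have hn : ‖e‖ = 1 := by
    have h := Complex.norm_exp_I_mul_ofReal
      ((N₁ / 2 : ℝ) * φ - (N₂ / 2 : ℝ) * ψ + (N₃ / 2 : ℝ) * ζ)
    push_cast at h
    exact h
  have h1 : e * star e = 1 := by
    have := Complex.mul_conj' e
    rw [hn, Complex.ofReal_one, one_pow] at this
    exact this
  rw [mul_mul_mul_comm, h1, one_mul]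

/-- The sum over `n₃` of the integrals, for fixed `j`: first `w` and then `y` are eliminated, and
what remains is a sum over `p` of products of Clebsch–Gordan coefficients. -/
lemma sum_integral_cgValue {r₁ r₂ : ℝ} {N₁ N₂ : ℤ} {J₁ J₂ J₁' J₂' J : ℕ} {M₁ M₂ M₁' M₂' M : ℤ}
    (h1 : IsWeight J₁ N₁) (h2 : IsWeight J₂ N₂) (h1' : IsWeight J₁' N₁) (h2' : IsWeight J₂' N₂)
    (hT : Triangle J₁ J₂ J) (hT' : Triangle J₁' J₂' J) :
    ∑ N₃ ∈ weights J, ∫ θ in Set.Ioo 0 Real.pi, ((1 / 2 * Real.sin θ : ℝ) : ℂ) *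
      (cgValue N₁ J₁ M₁ N₂ J₂ M₂ N₃ J M (aRot θ) (wExplicit r₁ r₂ θ) *
        star (cgValue N₁ J₁' M₁' N₂ J₂' M₂' N₃ J M (aRot θ) (wExplicit r₁ r₂ θ))) =
      if J₁ = J₁' ∧ J₂ = J₂' then
        (clebschGordan J₁ M₁ J₂ M₂ J M * clebschGordan J₁' M₁' J₂' M₂' J M : ℝ) *
          (((J : ℂ) + 1) / (((J₁ : ℂ) + 1) * ((J₂ : ℂ) + 1)))
      else 0 := by
  rw [← integral_finsetSum _ fun N₃ _ => integrableOn_cgValue_mul_star _ _ _ _ _ _ _ _ _ _ _ _ _ _ _]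
  simp only [← Finset.mul_sum, sum_cgValue_mul_star]
  have hint : ∀ (P : ℤ), IntegrableOn (fun θ => ((1 / 2 * Real.sin θ : ℝ) : ℂ) *
      (wignerD J₂ P N₂ (aRot θ) * star (wignerD J₂' P N₂ (aRot θ)))) (Set.Ioo 0 Real.pi) := by
    intro P
    refine Measure.integrableOn_of_bounded (M := 1 * (1 * 1)) (by simp) ?_ ?_
    · refine Measurable.aestronglyMeasurable ?_
      exact (by fun_prop : Measurable fun θ : ℝ => ((1 / 2 * Real.sin θ : ℝ) : ℂ)).mul
        ((measurable_wignerD measurable_aRot _ _ _).mul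
          (continuous_star.measurable.comp (measurable_wignerD measurable_aRot _ _ _)))
    · refine Filter.Eventually.of_forall fun θ => ?_
      have h1 : ‖((1 / 2 * Real.sin θ : ℝ) : ℂ)‖ ≤ 1 := by
        rw [Complex.norm_real, Real.norm_eq_abs, abs_mul]
        have := Real.abs_sin_le_one θ
        rw [abs_of_pos (by norm_num : (0 : ℝ) < 1 / 2)]
        linarith
      rw [norm_mul, norm_mul, norm_star]
      exact mul_le_mul h1 (mul_le_mul (norm_wignerD_le_one _ _ _ _) (norm_wignerD_le_one _ _ _ _)
        (norm_nonneg _) zero_le_one) (by positivity) zero_le_one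
  have hswap : ∀ θ : ℝ, ((1 / 2 * Real.sin θ : ℝ) : ℂ) *
      (((clebschGordan J₁ M₁ J₂ M₂ J M * clebschGordan J₁' M₁' J₂' M₂' J M : ℝ) : ℂ) *
        ∑ Q ∈ weights J, ((clebschGordan J₁ N₁ J₂ (Q - N₁) J Q *
          clebschGordan J₁' N₁ J₂' (Q - N₁) J Q : ℝ) : ℂ) *
            (wignerD J₂ (Q - N₁) N₂ (aRot θ) * star (wignerD J₂' (Q - N₁) N₂ (aRot θ)))) =
      ((clebschGordan J₁ M₁ J₂ M₂ J M * clebschGordan J₁' M₁' J₂' M₂' J M : ℝ) : ℂ) *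
        ∑ Q ∈ weights J, ((clebschGordan J₁ N₁ J₂ (Q - N₁) J Q *
          clebschGordan J₁' N₁ J₂' (Q - N₁) J Q : ℝ) : ℂ) * (((1 / 2 * Real.sin θ : ℝ) : ℂ) *
            (wignerD J₂ (Q - N₁) N₂ (aRot θ) * star (wignerD J₂' (Q - N₁) N₂ (aRot θ)))) := by
    intro θ
    rw [mul_left_comm, Finset.mul_sum]
    congr 1
    exact Finset.sum_congr rfl fun Q _ => by ring
  simp only [hswap]
  rw [integral_const_mul, integral_finsetSum _ fun Q _ => (hint (Q - N₁)).const_mul _]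
  simp only [integral_const_mul]
  have hterm : ∀ Q ∈ weights J, ((clebschGordan J₁ N₁ J₂ (Q - N₁) J Q *
        clebschGordan J₁' N₁ J₂' (Q - N₁) J Q : ℝ) : ℂ) *
      ∫ θ in Set.Ioo 0 Real.pi, ((1 / 2 * Real.sin θ : ℝ) : ℂ) *
        (wignerD J₂ (Q - N₁) N₂ (aRot θ) * star (wignerD J₂' (Q - N₁) N₂ (aRot θ))) =
      ((clebschGordan J₁ N₁ J₂ (Q - N₁) J Q * clebschGordan J₁' N₁ J₂' (Q - N₁) J Q : ℝ) : ℂ) *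
        if J₂ = J₂' then 1 / ((J₂ : ℂ) + 1) else 0 := by
    intro Q _
    by_cases hw : IsWeight J₂ (Q - N₁)
    · by_cases hw' : IsWeight J₂' (Q - N₁)
      · rw [← integral_wignerD_aRot J₂ J₂' (Q - N₁) N₂ hw h2 hw' h2',
          intervalIntegral.integral_of_le Real.pi_pos.le, integral_Ioc_eq_integral_Ioo]
      · rw [clebschGordan_of_not (J₁ := J₁') (fun h => hw' h.2.1)]; simp
    · rw [clebschGordan_of_not (J₁ := J₁) (fun h => hw h.2.1)]; simp
  rw [Finset.sum_congr rfl hterm, ← Finset.sum_mul, ← Complex.ofReal_sum]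
  by_cases hJ₂ : J₂ = J₂'
  · subst hJ₂
    rw [sum_clebschGordan_mul_exchange hT hT' h1 h1', if_pos rfl]
    by_cases hJ₁ : J₁ = J₁'
    · rw [if_pos hJ₁, if_pos ⟨hJ₁, rfl⟩]
      push_cast
      rw [div_mul_div_comm, mul_one]
    · rw [if_neg hJ₁, if_neg fun h => hJ₁ h.1]
      simp
  · rw [if_neg hJ₂, if_neg fun h => hJ₂ h.2]
    simp

/-- A function on `n₁ + n₂ + ℤ` that is supported on the weights of a representation. -/
lemma hasSum_weights {J : ℕ} {N₀ : ℤ} (hN₀ : Even ((J : ℤ) - N₀)) {f : ℤ → ℂ}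
    (hf : ∀ N, ¬ IsWeight J N → f N = 0) :
    HasSum (fun k : ℤ => f (N₀ + 2 * k)) (∑ N ∈ weights J, f N) := by
  obtain ⟨t, ht⟩ := hN₀
  have hpar : ∀ N ∈ weights J, N₀ + 2 * ((N - N₀) / 2) = N := by
    intro N hN
    obtain ⟨-, s, hs⟩ := mem_weights.1 hN
    omega
  have hsum : ∑ k ∈ (weights J).image (fun N => (N - N₀) / 2), f (N₀ + 2 * k) =
      ∑ N ∈ weights J, f N := by
    rw [Finset.sum_image]
    · exact Finset.sum_congr rfl fun N hN => by rw [hpar N hN]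
    · intro N hN N' hN' h
      rw [← hpar N hN, ← hpar N' hN']
      simp only at h
      rw [h]
  rw [← hsum]
  refine hasSum_sum_of_ne_finset_zero fun k hk => hf _ fun hw => hk ?_
  exact Finset.mem_image.2 ⟨_, mem_weights.2 hw, by omega⟩

lemma orthogonalityRelations {r₁ r₂ : ℝ} (hr₁ : r₁ ∈ Set.Ioo 0 (2 * Real.pi))
    (hr₂ : r₂ ∈ Set.Ioo 0 (2 * Real.pi)) (N₁ N₂ : ℤ) {y w : ℝ → SU2}
    (hyw : IsAdmissible r₁ r₂ y w) : OrthogonalityRelations r₁ r₂ N₁ N₂ y w := by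
  classical
  intro J₁ J₂ J₁' J₂' M M₁ M₁' h1 h2 h1' h2' hm1 hm2 hm1' hm2'
  obtain ⟨φ, ψ, ζ, hchange⟩ := hyw.exists_change hr₁ hr₂
  -- on the open interval, the products of coefficients are those of the explicit choice
  have hexp : ∀ (J : ℕ) (N₃ : ℤ), ∀ θ ∈ Set.Ioo 0 Real.pi,
      ((1 / 2 * Real.sin θ : ℝ) : ℂ) *
        (doubleCG y w r₁ N₁ J₁ M₁ r₂ N₂ J₂ (M - M₁) (lam r₁ r₂ θ) N₃ J M *
          star (doubleCG y w r₁ N₁ J₁' M₁' r₂ N₂ J₂' (M - M₁') (lam r₁ r₂ θ) N₃ J M)) =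
      ((1 / 2 * Real.sin θ : ℝ) : ℂ) *
        (cgValue N₁ J₁ M₁ N₂ J₂ (M - M₁) N₃ J M (aRot θ) (wExplicit r₁ r₂ θ) *
          star (cgValue N₁ J₁' M₁' N₂ J₂' (M - M₁') N₃ J M (aRot θ) (wExplicit r₁ r₂ θ))) := by
    intro J N₃ θ hθ
    obtain ⟨hy, hw⟩ := hchange θ hθ
    rw [doubleCG, doubleCG, lamInv_lam hr₁ hr₂ (Set.Ioo_subset_Icc_self hθ), hy, hw,
      cgValue_mul_star_change]
  let F : ℕ → ℤ → ℂ := fun J N₃ => ∫ θ in Set.Ioo 0 Real.pi, ((1 / 2 * Real.sin θ : ℝ) : ℂ) *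
      (cgValue N₁ J₁ M₁ N₂ J₂ (M - M₁) N₃ J M (aRot θ) (wExplicit r₁ r₂ θ) *
        star (cgValue N₁ J₁' M₁' N₂ J₂' (M - M₁') N₃ J M (aRot θ) (wExplicit r₁ r₂ θ)))
  refine ⟨fun J N₃ => ?_, ?_⟩
  · rw [integrableOn_nu_iff hr₁ hr₂]
    exact (integrableOn_congr_fun (hexp J N₃) measurableSet_Ioo).2
      (integrableOn_cgValue_mul_star _ _ _ _ _ _ _ _ _ _ _ _ _ _ _)
  have hF : ∀ (J : ℕ) (N₃ : ℤ), ∫ r₃ in classInterval r₁ r₂,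
      doubleCG y w r₁ N₁ J₁ M₁ r₂ N₂ J₂ (M - M₁) r₃ N₃ J M *
        star (doubleCG y w r₁ N₁ J₁' M₁' r₂ N₂ J₂' (M - M₁') r₃ N₃ J M) ∂(nu r₁ r₂) = F J N₃ := by
    intro J N₃
    rw [setIntegral_nu hr₁ hr₂]
    exact setIntegral_congr_fun measurableSet_Ioo (hexp J N₃)
  simp only [hF]
  have hF0 : ∀ (J : ℕ) (N₃ : ℤ), ¬ IsWeight J N₃ → F J N₃ = 0 := by
    intro J N₃ h
    simp only [F, cgValue_of_not_isWeight h, zero_mul, mul_zero, integral_zero]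
  let T : Finset ℕ := (coupledSpins J₁ J₂ M).filter fun J => Triangle J₁' J₂' J
  have hT : ∀ J ∈ T, Triangle J₁ J₂ J ∧ IsWeight J M ∧ Triangle J₁' J₂' J := fun J hJ => by
    obtain ⟨a, b⟩ := Finset.mem_filter.1 hJ
    exact ⟨(mem_coupledSpins.1 a).1, (mem_coupledSpins.1 a).2, b⟩
  have hsub : ∀ N₃ : ℤ, ∑ J ∈ jRange J₁ J₂ J₁' J₂' M N₃, (1 / ((J : ℂ) + 1)) * F J N₃ =
      ∑ J ∈ T, (1 / ((J : ℂ) + 1)) * F J N₃ := by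
    intro N₃
    refine Finset.sum_subset ?_ ?_
    · intro J hJ
      obtain ⟨-, a, b, c, -⟩ := Finset.mem_filter.1 hJ
      exact Finset.mem_filter.2 ⟨mem_coupledSpins.2 ⟨a, c⟩, b⟩
    · intro J hJ hJ'
      obtain ⟨a, b, c⟩ := hT J hJ
      rw [hF0, mul_zero]
      exact fun hw => hJ' (Finset.mem_filter.2 ⟨Finset.mem_range.2 (Nat.lt_succ_of_le a.2.1),
        a, c, b, hw⟩)
  simp only [hsub]
  have hJsum : ∀ J ∈ T, HasSum (fun k : ℤ => (1 / ((J : ℂ) + 1)) * F J (N₁ + N₂ + 2 * k))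
      (if J₁ = J₁' ∧ J₂ = J₂' then
        (clebschGordan J₁ M₁ J₂ (M - M₁) J M * clebschGordan J₁' M₁' J₂' (M - M₁') J M : ℝ) *
          (1 / (((J₁ : ℂ) + 1) * ((J₂ : ℂ) + 1))) else 0) := by
    intro J hJ
    obtain ⟨a, -, c⟩ := hT J hJ
    have hpar : Even ((J : ℤ) - (N₁ + N₂)) := by
      rw [show (J : ℤ) - (N₁ + N₂) = (J₁ - N₁) + (J₂ - N₂) - (J₁ + J₂ - J) by ring]
      exact (h1.2.add h2.2).sub a.2.2
    have hs := (hasSum_weights hpar (hF0 J)).mul_left (1 / ((J : ℂ) + 1))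
    rw [sum_integral_cgValue h1 h2 h1' h2' a c] at hs
    rw [mul_ite, mul_zero] at hs
    have e : ∀ c : ℂ, (1 / ((J : ℂ) + 1)) * (c * (((J : ℂ) + 1) / (((J₁ : ℂ) + 1) * ((J₂ : ℂ) + 1))))
        = c * (1 / (((J₁ : ℂ) + 1) * ((J₂ : ℂ) + 1))) := by
      intro c
      have hJ0 : (J : ℂ) + 1 ≠ 0 := Nat.cast_add_one_ne_zero J
      field_simp
    rw [e] at hs
    exact hs
  suffices hvalue : (if J₁ = J₁' ∧ J₂ = J₂' ∧ M₁ = M₁' then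
      1 / (((J₁ : ℂ) + 1) * ((J₂ : ℂ) + 1)) else 0) = ∑ J ∈ T, if J₁ = J₁' ∧ J₂ = J₂' then
        ((clebschGordan J₁ M₁ J₂ (M - M₁) J M * clebschGordan J₁' M₁' J₂' (M - M₁') J M : ℝ) : ℂ) *
          (1 / (((J₁ : ℂ) + 1) * ((J₂ : ℂ) + 1))) else 0 by
    rw [hvalue]
    exact hasSum_sum hJsum
  by_cases hJ : J₁ = J₁' ∧ J₂ = J₂'
  · obtain ⟨rfl, rfl⟩ := hJ
    have hTeq : T = coupledSpins J₁ J₂ M :=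
      Finset.filter_true_of_mem fun J hJ => (mem_coupledSpins.1 hJ).1
    simp only [and_self, if_true, true_and]
    rw [hTeq, ← Finset.sum_mul, ← Complex.ofReal_sum,
      sum_coupledSpins_clebschGordan_mul hm1 hm2 hm1' hm2']
    split_ifs <;> simp
  · rw [if_neg fun h => hJ ⟨h.1, h.2.1⟩]
    simp only [if_neg hJ, Finset.sum_const_zero]

end DoubleSU2

end

theorem mainTheorem4 (r₁ r₂ : ℝ) (hr₁ : r₁ ∈ Set.Ioo 0 (2 * Real.pi))
    (hr₂ : r₂ ∈ Set.Ioo 0 (2 * Real.pi)) (N₁ N₂ : ℤ) :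
    -- the explicit choice is admissible, and its coefficients are orthogonal
    IsAdmissible r₁ r₂ aRot (wExplicit r₁ r₂) ∧
    OrthogonalityRelations r₁ r₂ N₁ N₂ aRot (wExplicit r₁ r₂) ∧
    -- an admissible change of the choices changes the coefficients by a phase factor
    (∀ (y w : ℝ → SU2), IsAdmissible r₁ r₂ y w → ∀ φ ψ ζ : ℝ → ℝ,
      IsAdmissible r₁ r₂ (fun θ => gDiag (φ θ) * y θ * gDiag (ψ θ)) (fun θ => gDiag (φ θ) * w θ * gDiag (ζ θ)) ∧
      ∀ (J₁ J₂ J : ℕ) (M₁ M₂ M N₃ : ℤ) (r₃ : ℝ),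
        doubleCG (fun θ => gDiag (φ θ) * y θ * gDiag (ψ θ)) (fun θ => gDiag (φ θ) * w θ * gDiag (ζ θ))
            r₁ N₁ J₁ M₁ r₂ N₂ J₂ M₂ r₃ N₃ J M =
          Complex.exp (Complex.I *
            ((N₁ / 2 : ℂ) * φ (lamInv r₁ r₂ r₃) - (N₂ / 2 : ℂ) * ψ (lamInv r₁ r₂ r₃) +
              (N₃ / 2 : ℂ) * ζ (lamInv r₁ r₂ r₃))) *
            doubleCG y w r₁ N₁ J₁ M₁ r₂ N₂ J₂ M₂ r₃ N₃ J M) ∧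
    -- every admissible choice arises from the explicit one by such a change, for `0 < θ < π`
    (∀ (y w : ℝ → SU2), IsAdmissible r₁ r₂ y w → ∃ φ ψ ζ : ℝ → ℝ, ∀ θ ∈ Set.Ioo 0 Real.pi,
      y θ = gDiag (φ θ) * aRot θ * gDiag (ψ θ) ∧ w θ = gDiag (φ θ) * wExplicit r₁ r₂ θ * gDiag (ζ θ)) ∧
    -- the orthogonality relations hold for every admissible choice
    (∀ (y w : ℝ → SU2), IsAdmissible r₁ r₂ y w → OrthogonalityRelations r₁ r₂ N₁ N₂ y w) := by
  refine ⟨isAdmissible_explicit r₁ r₂,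
    orthogonalityRelations hr₁ hr₂ N₁ N₂ (isAdmissible_explicit r₁ r₂),
    fun y w h φ ψ ζ => ⟨h.change φ ψ ζ, fun J₁ J₂ J M₁ M₂ M N₃ r₃ => ?_⟩,
    fun y w h => h.exists_change hr₁ hr₂,
    fun y w h => orthogonalityRelations hr₁ hr₂ N₁ N₂ h⟩
  exact cgValue_change N₁ J₁ M₁ N₂ J₂ M₂ N₃ J M _ _ _ _ _
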